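/- Let $k$ be a field of characteristic $0$ and let $A$ be a Poisson $k$-algebra, i.e. a commutative $k$-algebra with a bivector $\pi$ (a skew-symmetric biderivation) whose bracket $\{f,g\}=\pi(f,g)$ satisfies the Jacobi identity. Let $\mathfrak X^p(A)$ be the space of skew-symmetric $k$-multilinear maps $A^p\to A$ that are derivations in each argument. Let $(\Omega^\bullet,d)$ be the algebra of Kähler differential forms of $A$ over $k$ with its de Rham differential, or more generally a quotient of it by a graded subspace of relations that are stable under multiplication by $A$, under $d$ and under contraction $\iota_P$ with polyvectors $P\in\mathfrak X^\bullet(A)$ (for instance the smooth forms, if $A=C^\infty(X)$ for a smooth manifold $X$). Suppose that $\eta\in\Omega^n$ is a volume form, i.e. that $P\mapsto\iota_P\eta$ is an isomorphism $\mathfrak X^\bullet(A)\to\Omega^{n-\bullet}$; in particular $\mathfrak X^p(A)=0$ and $\Omega^p=0$ for $p>n$. Let $\mathrm{Div}:\mathfrak X^\bullet(A)\to\mathfrak X^{\bullet-1}(A)$ be given by $\iota_{\mathrm{Div}(P)}\eta=d(\iota_P\eta)$, and let $\nu=-\mathrm{Div}(\pi)\in\mathfrak X^1(A)$ be the modular vector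 of $A$. Suppose that $\nu$ is semisimple, i.e. that $A$ is spanned over $k$ by eigenvectors of $\nu$ with eigenvalues in $k$. Let $\mathrm{HP}^\bullet(A)$ be the Poisson cohomology of $A$, the cohomology of $\mathfrak X^\bullet(A)$ with the differential $$\delta P(f_0,\dots,f_p)=\sum_i(-1)^i\{f_i,P(f_0,\dots,\widehat{f_i},\dots,f_p)\}+\sum_{i<j}(-1)^{i+j}P(\{f_i,f_j\},f_0,\dots,\widehat{f_i},\dots,\widehat{f_j},\dots,f_p).$$ Then the wedge product and the Schouten bracket of polyvectors induce a product and a bracket $\{-,-\}$ on $\mathrm{HP}^\bullet(A)$, and there is a linear operator $\Delta:\mathrm{HP}^\bullet(A)\to\mathrm{HP}^{\bullet-1}(A)$ such that $\mathrm{HP}^\bullet(A)$ with this product and $\Delta$ is a Batalin–Vilkovisky algebra, i.e. the product is unital, associative and graded commutative, $\Delta^2=0$, and, for homogeneous $a,b,c$, $$\Delta(abc)=\Delta(ab)c+(-1)^{|a|}a\Delta(bc)+(-1)^{(|a|-1)|b|}b\Delta(ac)-\Delta(a)bc-(-1)^{|a|}a\Delta(b)c-(-1)^{|a|+|b|}ab\Delta(c),$$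 and such that $\Delta$ generates the Schouten (Gerstenhaber) bracket: for homogeneous $a,b$, $$\{a,b\}=(-1)^{|a|}\bigl(\Delta(ab)-\Delta(a)b-(-1)^{|a|}a\Delta(b)\bigr).$$ -/

import Mathlib

open scoped TensorProduct

noncomputable section

namespace PoissonBV

/-! ### Polyvectors: alternating multiderivations -/

section Polyvectors

variable (k A N : Type*) [Field k] [CommRing A] [Algebra k A]
  [AddCommGroup N] [Module k N] [Module A N] [IsScalarTower k A N]

/-- The space `𝔛^p_A(N)` of skew-symmetric `k`-multilinear maps `A^p → N` that are derivations in
each argument. -/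
def Polyvector (p : ℕ) : Submodule A (A [⋀^Fin p]→ₗ[k] N) where
  carrier := {P | ∀ (f : Fin p → A) (i : Fin p) (a b : A),
    P (Function.update f i (a * b)) =
      a • P (Function.update f i b) + b • P (Function.update f i a)}
  add_mem' := by
    intro P Q hP hQ f i a b
    simp only [AlternatingMap.add_apply, hP f i a b, hQ f i a b, smul_add]
    abel
  zero_mem' := by
    intro f i a b
    simp
  smul_mem' := by
    intro c P hP f i a b
    simp only [AlternatingMap.smul_apply, hP f i a b, smul_add, smul_comm c a, smul_comm c b]

instance {p : ℕ} : IsScalarTower k A (A [⋀^Fin p]→ₗ[k] N) :=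
  ⟨fun c a P => by ext f; exact smul_assoc c a (P f)⟩

end Polyvectors

section Products

variable {k A N : Type*} [Field k] [CommRing A] [Algebra k A]
  [AddCommGroup N] [Module k N] [Module A N] [IsScalarTower k A N]

/-- The shuffle product of two alternating maps along a bilinear map `B`:
`(f₁, …, f_m) ↦ ∑ sgn(σ) B (φ (f_σ(1), …, f_σ(p))) (ψ (f_σ(p+1), …, f_σ(p+q)))`,
the sum being over the `(p, q)`-shuffles `σ`, where `p + q = m`. -/
def shuffleProd {N₁ N₂ N₃ : Type*} [AddCommGroup N₁] [Module k N₁] [AddCommGroup N₂] [Module k N₂]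
    [AddCommGroup N₃] [Module k N₃] (B : N₁ →ₗ[k] N₂ →ₗ[k] N₃) {p q m : ℕ} (h : p + q = m)
    (φ : A [⋀^Fin p]→ₗ[k] N₁) (ψ : A [⋀^Fin q]→ₗ[k] N₂) : A [⋀^Fin m]→ₗ[k] N₃ :=
  ((TensorProduct.lift B).compAlternatingMap (φ.domCoprod ψ)).domDomCongr
    (finSumFinEquiv.trans (finCongr h))

theorem smul_apply_mem_leibniz {p q : ℕ} (P : Polyvector k A A p) (Q : Polyvector k A N q)
    (v : Fin p ⊕ Fin q → A) (i : Fin p ⊕ Fin q) (a b : A) :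
    let F : (Fin p ⊕ Fin q → A) → N := fun w =>
      P.1 (fun j => w (Sum.inl j)) • Q.1 (fun j => w (Sum.inr j))
    F (Function.update v i (a * b)) =
      a • F (Function.update v i b) + b • F (Function.update v i a) := by
  intro F
  rcases i with i | i
  · have h1 : ∀ x : A, (fun j => Function.update v (Sum.inl i) x (Sum.inl j)) =
        Function.update (fun j => v (Sum.inl j)) i x := by
      intro x; ext j; by_cases hj : j = i
      · subst hj; simp
      · simp [hj]
    have h2 : ∀ x : A, (fun j : Fin q => Function.update v (Sum.inl i) x (Sum.inr j)) =
        (fun j => v (Sum.inr j)) := by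
      intro x; ext j; simp
    simp only [F, h1, h2, P.2 _ i a b, add_smul, smul_assoc]
  · have h1 : ∀ x : A, (fun j => Function.update v (Sum.inr i) x (Sum.inr j)) =
        Function.update (fun j => v (Sum.inr j)) i x := by
      intro x; ext j; by_cases hj : j = i
      · subst hj; simp
      · simp [hj]
    have h2 : ∀ x : A, (fun j : Fin p => Function.update v (Sum.inr i) x (Sum.inl j)) =
        (fun j => v (Sum.inl j)) := by
      intro x; ext j; simp
    simp only [F, h1, h2, Q.2 _ i a b, smul_add]
    rw [smul_comm a, smul_comm b]

/-- The wedge product `P ∧ Q` of a polyvector `P ∈ 𝔛^p(A)` and `Q ∈ 𝔛^q_A(N)`: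
`(P ∧ Q)(f₁, …, f_m) = ∑ sgn(σ) P(f_σ(1), …, f_σ(p)) Q(f_σ(p+1), …, f_σ(m))`, the sum being over
the `(p, q)`-shuffles, where `p + q = m`. -/
def wedge {p q m : ℕ} (h : p + q = m) (P : Polyvector k A A p) (Q : Polyvector k A N q) :
    Polyvector k A N m :=
  ⟨shuffleProd (Algebra.lsmul k k N : A →ₐ[k] Module.End k N).toLinearMap h P.1 Q.1, by
    intro f i a b
    have key : ∀ w : Fin m → A,
        shuffleProd (Algebra.lsmul k k N : A →ₐ[k] Module.End k N).toLinearMap h P.1 Q.1 w =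
        ∑ σ : Equiv.Perm.ModSumCongr (Fin p) (Fin q),
          (TensorProduct.lift (Algebra.lsmul k k N : A →ₐ[k] Module.End k N).toLinearMap)
            (AlternatingMap.domCoprod.summand P.1 Q.1 σ
              (fun x => w ((finSumFinEquiv.trans (finCongr h)) x))) := by
      intro w
      simp [shuffleProd, AlternatingMap.domCoprod, map_sum]
      rfl
    simp only [key, Finset.smul_sum]
    rw [← Finset.sum_add_distrib]
    refine Finset.sum_congr rfl fun σ _ => ?_
    induction σ using Quotient.inductionOn' with | _ σ
    simp only [AlternatingMap.domCoprod.summand_mk'']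
    set e := finSumFinEquiv.trans (finCongr h) with he
    have hu : ∀ x : A, (fun y => Function.update f i x (e (σ y))) =
        Function.update (fun y => f (e (σ y))) (σ.symm (e.symm i)) x := by
      intro x; ext y
      by_cases hy : y = σ.symm (e.symm i)
      · subst hy; simp
      · have : e (σ y) ≠ i := fun hh => hy (by simp [← hh])
        simp [hy, this]
    have hl := smul_apply_mem_leibniz P Q (fun y => f (e (σ y))) (σ.symm (e.symm i)) a b
    simp only [← hu] at hl
    have hs : ∀ w : Fin m → A,
        (TensorProduct.lift (Algebra.lsmul k k N : A →ₐ[k] Module.End k N).toLinearMap)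
          ((Equiv.Perm.sign σ • ((P.1 : MultilinearMap k (fun _ : Fin p => A) A).domCoprod
            (Q.1 : MultilinearMap k (fun _ : Fin q => A) N)).domDomCongr σ)
              (fun x => w (e x))) =
        (Equiv.Perm.sign σ : ℤ) • (P.1 (fun j => w (e (σ (Sum.inl j)))) •
          Q.1 (fun j => w (e (σ (Sum.inr j))))) := by
      intro w
      rw [Units.smul_def, _root_.smul_apply, map_zsmul]
      rfl
    rw [hs, hs, hs, smul_comm a, smul_comm b, ← smul_add, hl]⟩

/-- The alternating map `(f₁, …, f_p) ↦ (g ↦ P(g, f₁, …, f_p))` with values in the endomorphisms of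
`A`, for an alternating map `P` of degree `p + 1`. -/
def firstSlot {p : ℕ} (P : A [⋀^Fin (p + 1)]→ₗ[k] A) : A [⋀^Fin p]→ₗ[k] (A →ₗ[k] A) where
  toFun f :=
    { toFun := fun g => P.curryLeft g f
      map_add' := by intro x y; simp [map_add]
      map_smul' := by intro c x; simp [map_smul] }
  map_update_add' := by intro _ f i x y; ext g; exact (P.curryLeft g).map_update_add f i x y
  map_update_smul' := by intro _ f i c x; ext g; exact (P.curryLeft g).map_update_smul f i c x
  map_eq_zero_of_eq' := by
    intro f i j hf hij; ext g; exact (P.curryLeft g).map_eq_zero_of_eq f hf hij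

/-- Insertion of `Q` into the first slot of `P`, for `P` of degree `p` and `Q` of degree `q`, with
`p + q = m + 1`:
`(P ∘ Q)(f₁, …, f_m) = ∑ sgn(σ) P(Q(f_σ(1), …, f_σ(q)), f_σ(q+1), …, f_σ(m))`, the sum being over
the `(q, p - 1)`-shuffles. It is `0` when `p = 0`. -/
def insertion : {p q m : ℕ} → (h : p + q = m + 1) → (A [⋀^Fin p]→ₗ[k] A) → (A [⋀^Fin q]→ₗ[k] A) →
    (A [⋀^Fin m]→ₗ[k] A)
  | 0, _, _, _, _, _ => 0
  | _ + 1, _, _, h, P, Q => shuffleProd LinearMap.applyₗ (by omega) Q (firstSlot P)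

/-- The Schouten bracket `[P, Q] = (-1)^((p-1)(q-1)) P ∘ Q - Q ∘ P`, of degree `m = p + q - 1`. It
is the extension of the commutator of derivations with `[X, f] = X(f)` for a derivation `X` and a
function `f`, such that `[P, -]` is a graded derivation of degree `p - 1` of the wedge product. -/
def schouten {p q m : ℕ} (h : p + q = m + 1) (P : A [⋀^Fin p]→ₗ[k] A)
    (Q : A [⋀^Fin q]→ₗ[k] A) : A [⋀^Fin m]→ₗ[k] A :=
  (-1 : ℤ) ^ ((p + 1) * (q + 1)) • insertion h P Q - insertion (by omega : q + p = m + 1) Q P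

end Products

/-! ### Poisson algebras and Poisson cohomology -/

section Subquotient

variable {k M : Type*} [Ring k] [AddCommGroup M] [Module k M] (Z B : Submodule k M)

/-- The quotient `Z / (B ∩ Z)` of a submodule `Z` of `M` (cocycles, containing the coboundaries
`B` in the case of a complex). -/
def Subquotient : Type _ := Z ⧸ B.submoduleOf Z

instance : AddCommGroup (Subquotient Z B) :=
  inferInstanceAs (AddCommGroup (Z ⧸ B.submoduleOf Z))

instance : Module k (Subquotient Z B) :=
  inferInstanceAs (Module k (Z ⧸ B.submoduleOf Z))

/-- The class of an element of `Z`. -/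
def Subquotient.mk : Z →ₗ[k] Subquotient Z B := (B.submoduleOf Z).mkQ

end Subquotient

section Cohomology

variable (k A : Type*) [Field k] [CommRing A] [Algebra k A]

/-- A Poisson structure on the commutative `k`-algebra `A`: a bivector `π`, that is, a
skew-symmetric `k`-bilinear bracket `{f, g} = π(f, g)` which is a derivation in each argument, that
satisfies the Jacobi identity. -/
structure PoissonStructure where
  /-- the Poisson bivector -/
  bivector : Polyvector k A A 2
  jacobi : ∀ f g h : A,
    bivector.1 ![f, bivector.1 ![g, h]] + bivector.1 ![g, bivector.1 ![h, f]] +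
      bivector.1 ![h, bivector.1 ![f, g]] = 0

variable {k A}

namespace PoissonStructure

variable (π : PoissonStructure k A)

/-- The Poisson bracket. -/
def bracket (f g : A) : A := π.bivector.1 ![f, g]

/-- The second sum in the Poisson differential,
`∑_{i<j} (-1)^(i+j) P({f_i, f_j}, f₀, …, f̂_i, …, f̂_j, …, f_p)`. The pair `i < j` in `{0, …, p}` is
given by `j : Fin (p + 1)` and `i : Fin p` with `i.castSucc < j`. -/
def deltaBracketSum : {p : ℕ} → (A [⋀^Fin p]→ₗ[k] A) → (Fin (p + 1) → A) → A
  | 0, _, _ => 0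
  | p + 1, P, f => ∑ j : Fin (p + 2), ∑ i : Fin (p + 1),
      if i.castSucc < j then
        (-1 : A) ^ ((i : ℕ) + (j : ℕ)) *
          P (Matrix.vecCons (π.bracket (f i.castSucc) (f j))
            (fun l : Fin p => f (j.succAbove (i.succAbove l))))
      else 0

/-- The Poisson differential
`(δP)(f₀, …, f_p) = ∑_i (-1)^i {f_i, P(f₀, …, f̂_i, …, f_p)}
  + ∑_{i<j} (-1)^(i+j) P({f_i, f_j}, f₀, …, f̂_i, …, f̂_j, …, f_p)`. -/
def delta {p : ℕ} (P : A [⋀^Fin p]→ₗ[k] A) (f : Fin (p + 1) → A) : A :=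
  ∑ i : Fin (p + 1), (-1 : A) ^ (i : ℕ) * π.bracket (f i) (P (i.removeNth f)) +
    π.deltaBracketSum P f

theorem bracket_add (f g h : A) : π.bracket f (g + h) = π.bracket f g + π.bracket f h := by
  exact (π.bivector.1.curryLeft f).map_vecCons_add ![] g h

theorem bracket_smul (c : k) (f g : A) : π.bracket f (c • g) = c • π.bracket f g := by
  exact (π.bivector.1.curryLeft f).map_vecCons_smul ![] c g

theorem delta_add {p : ℕ} (P Q : A [⋀^Fin p]→ₗ[k] A) :
    π.delta (P + Q) = π.delta P + π.delta Q := by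
  ext f
  rcases p with _ | p
  · simp [delta, deltaBracketSum, bracket_add]
  · simp only [delta, deltaBracketSum, AlternatingMap.add_apply, bracket_add, mul_add,
      Finset.sum_add_distrib, ite_add_zero, Pi.add_apply]
    abel

theorem delta_smul {p : ℕ} (c : k) (P : A [⋀^Fin p]→ₗ[k] A) :
    π.delta (c • P) = c • π.delta P := by
  ext f
  rcases p with _ | p
  · simp [delta, deltaBracketSum, bracket_smul]
  · simp only [delta, deltaBracketSum, AlternatingMap.smul_apply, bracket_smul, mul_smul_comm,
      Pi.smul_apply, smul_add, Finset.smul_sum, smul_ite, smul_zero]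

/-- The Poisson `p`-cocycles: the polyvectors `P ∈ 𝔛^p(A)` with `δP = 0`. -/
def cocycles (p : ℕ) : Submodule k (A [⋀^Fin p]→ₗ[k] A) where
  carrier := {P | P ∈ Polyvector k A A p ∧ π.delta P = 0}
  add_mem' := by
    rintro P Q ⟨hP, hP'⟩ ⟨hQ, hQ'⟩
    exact ⟨add_mem hP hQ, by rw [delta_add, hP', hQ', add_zero]⟩
  zero_mem' := by
    refine ⟨zero_mem _, ?_⟩
    have := π.delta_smul (0 : k) (0 : A [⋀^Fin p]→ₗ[k] A)
    simpa using this
  smul_mem' := by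
    rintro c P ⟨hP, hP'⟩
    refine ⟨?_, by rw [delta_smul, hP', smul_zero]⟩
    rw [← algebraMap_smul A c P]
    exact Submodule.smul_mem _ _ hP

/-- The Poisson `p`-coboundaries: the polyvectors `δQ` with `Q ∈ 𝔛^(p-1)(A)`. -/
def coboundaries : (p : ℕ) → Submodule k (A [⋀^Fin p]→ₗ[k] A)
  | 0 => ⊥
  | p + 1 =>
    { carrier := {P | ∃ Q ∈ Polyvector k A A p, ⇑P = π.delta Q}
      add_mem' := by
        rintro P P' ⟨Q, hQ, h⟩ ⟨Q', hQ', h'⟩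
        exact ⟨Q + Q', add_mem hQ hQ', by rw [delta_add, ← h, ← h']; rfl⟩
      zero_mem' := by
        refine ⟨0, zero_mem _, ?_⟩
        have := π.delta_smul (0 : k) (0 : A [⋀^Fin p]→ₗ[k] A)
        simp only [zero_smul] at this
        rw [this]
        rfl
      smul_mem' := by
        rintro c P ⟨Q, hQ, h⟩
        refine ⟨c • Q, ?_, by rw [delta_smul, ← h]; rfl⟩
        rw [← algebraMap_smul A c Q]
        exact Submodule.smul_mem _ _ hQ }

/-- The Poisson cohomology `HP^p(A)`: cocycles modulo coboundaries. -/
abbrev HPdeg (p : ℕ) : Type _ := Subquotient (π.cocycles p) (π.coboundaries p)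

/-- The total Poisson cohomology `HP^•(A) = ⨁_p HP^p(A)`. -/
abbrev HP : Type _ := DirectSum ℕ π.HPdeg

/-- The class in `HP^•(A)` of a Poisson `p`-cocycle. -/
def cls (p : ℕ) : π.cocycles p →ₗ[k] π.HP :=
  (DirectSum.lof k ℕ π.HPdeg p).comp (Subquotient.mk (π.cocycles p) (π.coboundaries p))

/-- The grading of `HP^•(A)`; the negative degrees vanish. -/
def grading : ℤ → Submodule k π.HP
  | Int.ofNat p => LinearMap.range (π.cls p)
  | Int.negSucc _ => ⊥

variable {π} in
/-- A cocycle as a polyvector. -/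
def toPolyvector {p : ℕ} (P : π.cocycles p) : Polyvector k A A p := ⟨P.1, P.2.1⟩

/-- `cup` is the product induced on `HP^•(A)` by the wedge product of polyvectors. -/
def IsInducedProduct (cup : π.HP →ₗ[k] π.HP →ₗ[k] π.HP) : Prop :=
  ∀ (p q : ℕ) (P : π.cocycles p) (Q : π.cocycles q),
    ∃ R : π.cocycles (p + q), toPolyvector R = wedge rfl (toPolyvector P) (toPolyvector Q) ∧
      cup (π.cls p P) (π.cls q Q) = π.cls (p + q) R

/-- `br` is the bracket induced on `HP^•(A)` by the Schouten bracket of polyvectors. As the bracket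
has degree `-1`, it vanishes on two classes of degree `0`. -/
def IsInducedBracket (br : π.HP →ₗ[k] π.HP →ₗ[k] π.HP) : Prop :=
  (∀ (p q m : ℕ) (h : p + q = m + 1) (P : π.cocycles p) (Q : π.cocycles q),
    ∃ R : π.cocycles m, R.1 = schouten h P.1 Q.1 ∧
      br (π.cls p P) (π.cls q Q) = π.cls m R) ∧
  ∀ P Q : π.cocycles 0, br (π.cls 0 P) (π.cls 0 Q) = 0

end PoissonStructure

end Cohomology

/-! ### Batalin–Vilkovisky algebras -/

section BV

variable {k V : Type*} [Field k] [AddCommGroup V] [Module k V]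

/-- `V = ⨁ 𝒱 i` with the product `mul` is a unital graded commutative algebra. -/
structure IsGradedCommAlgebra (𝒱 : ℤ → Submodule k V) (mul : V →ₗ[k] V →ₗ[k] V) : Prop where
  internal : DirectSum.IsInternal 𝒱
  mul_mem : ∀ {i j : ℤ} {a b : V}, a ∈ 𝒱 i → b ∈ 𝒱 j → mul a b ∈ 𝒱 (i + j)
  mul_assoc : ∀ a b c : V, mul (mul a b) c = mul a (mul b c)
  exists_one : ∃ e ∈ 𝒱 0, ∀ a : V, mul e a = a ∧ mul a e = a
  mul_comm : ∀ {i j : ℤ} {a b : V}, a ∈ 𝒱 i → b ∈ 𝒱 j →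
    mul a b = (i * j).negOnePow • mul b a

/-- `(V, mul, Δ)` is a Batalin–Vilkovisky algebra: `Δ` is a differential of degree `-1` and a
second order operator. -/
structure IsBVAlgebra (𝒱 : ℤ → Submodule k V) (mul : V →ₗ[k] V →ₗ[k] V) (Δ : V →ₗ[k] V) : Prop
    extends IsGradedCommAlgebra 𝒱 mul where
  map_mem : ∀ {i : ℤ} {a : V}, a ∈ 𝒱 i → Δ a ∈ 𝒱 (i - 1)
  sq_zero : ∀ a : V, Δ (Δ a) = 0
  second_order : ∀ {i j l : ℤ} {a b c : V}, a ∈ 𝒱 i → b ∈ 𝒱 j → c ∈ 𝒱 l →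
    Δ (mul (mul a b) c) =
      mul (Δ (mul a b)) c + i.negOnePow • mul a (Δ (mul b c))
        + ((i - 1) * j).negOnePow • mul b (Δ (mul a c))
        - mul (mul (Δ a) b) c - i.negOnePow • mul (mul a (Δ b)) c
        - (i + j).negOnePow • mul (mul a b) (Δ c)

/-- The operator `Δ` generates the bracket `br`:
`{a, b} = (-1)^|a| (Δ(ab) - Δ(a)b - (-1)^|a| aΔ(b))`. -/
def Generates (𝒱 : ℤ → Submodule k V) (mul : V →ₗ[k] V →ₗ[k] V) (Δ : V →ₗ[k] V)
    (br : V →ₗ[k] V →ₗ[k] V) : Prop :=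
  ∀ {i j : ℤ} {a b : V}, a ∈ 𝒱 i → b ∈ 𝒱 j →
    br a b = i.negOnePow • (Δ (mul a b) - mul (Δ a) b - i.negOnePow • mul a (Δ b))

end BV

/-! ### Kähler forms, contraction and the de Rham differential -/

section Extension

variable {k A N : Type*} [Field k] [CommRing A] [Algebra k A]
  [AddCommGroup N] [Module k N] [Module A N] [IsScalarTower k A N]

/-- Fixing the first argument of a polyvector. -/
theorem curryLeft_mem {p : ℕ} (P : Polyvector k A N (p + 1)) (a : A) :
    P.1.curryLeft a ∈ Polyvector k A N p := by
  intro f i b c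
  have := P.2 (Matrix.vecCons a f) i.succ b c
  simpa [Matrix.vecCons, Fin.cons_update] using this

/-- The polyvector obtained from `P` by fixing the first argument. -/
def curryFirst {p : ℕ} (P : Polyvector k A N (p + 1)) (a : A) : Polyvector k A N p :=
  ⟨P.1.curryLeft a, curryLeft_mem P a⟩

instance {p : ℕ} : IsScalarTower k A (Ω[A⁄k] [⋀^Fin p]→ₗ[A] N) :=
  ⟨fun c a P => by ext f; exact smul_assoc c a (P f)⟩

/-- The derivation `a ↦ E (P(a, …))` of `A` attached to a polyvector `P` of degree `p + 1` and an
`A`-linear map `E` on polyvectors of degree `p`. -/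
def curryDerivation {p : ℕ} {M : Type*} [AddCommGroup M] [Module k M] [Module A M]
    [IsScalarTower k A M] (E : Polyvector k A N p →ₗ[A] M) (P : Polyvector k A N (p + 1)) :
    Derivation k A M :=
  Derivation.mk'
    { toFun := fun a => E (curryFirst P a)
      map_add' := by
        intro a b
        rw [← map_add]
        congr 1
        ext f
        simp [curryFirst]
      map_smul' := by
        intro c a
        rw [RingHom.id_apply, ← algebraMap_smul A c (E (curryFirst P a)), ← map_smul]
        congr 1
        ext f
        simp [curryFirst] }
    (by
      intro a b
      simp only [LinearMap.coe_mk, AddHom.coe_mk]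
      rw [← map_smul, ← map_smul, ← map_add]
      congr 1
      ext f
      have := P.2 (Matrix.vecCons 0 f) 0 a b
      simpa [curryFirst, Matrix.vecCons] using this)

variable (k A N) in
/-- The extension of a multiderivation `P ∈ 𝔛^p_A(N)` to the `A`-multilinear alternating map `P̃`
on Kähler differentials with `P̃(df₁, …, df_p) = P(f₁, …, f_p)` (see `extend_apply`). -/
def extend [CharZero k] : (p : ℕ) → Polyvector k A N p →ₗ[A] (Ω[A⁄k] [⋀^Fin p]→ₗ[A] N)
  | 0 =>
    { toFun := fun P => AlternatingMap.constOfIsEmpty A Ω[A⁄k] (Fin 0) (P.1 ![])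
      map_add' := by intro P Q; ext; simp
      map_smul' := by intro c P; ext; simp }
  | p + 1 =>
    { toFun := fun P => algebraMap k A (((p + 1 : ℕ) : k)⁻¹) •
        AlternatingMap.alternatizeUncurryFin
          (curryDerivation (extend p) P).liftKaehlerDifferential
      map_add' := by
        intro P Q
        rw [← smul_add, ← AlternatingMap.alternatizeUncurryFin_add]
        congr 2
        apply Derivation.liftKaehlerDifferential_unique
        ext a : 1
        change (curryDerivation (extend p) (P + Q)).liftKaehlerDifferential
            (KaehlerDifferential.D k A a) =
          (curryDerivation (extend p) P).liftKaehlerDifferential (KaehlerDifferential.D k A a) +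
          (curryDerivation (extend p) Q).liftKaehlerDifferential (KaehlerDifferential.D k A a)
        simp only [Derivation.liftKaehlerDifferential_comp_D]
        exact map_add (extend p) (curryFirst P a) (curryFirst Q a)
      map_smul' := by
        intro c P
        rw [RingHom.id_apply, smul_comm c]
        congr 1
        rw [← AlternatingMap.alternatizeUncurryFin_smul]
        congr 1
        apply Derivation.liftKaehlerDifferential_unique
        ext a : 1
        change (curryDerivation (extend p) (c • P)).liftKaehlerDifferential
            (KaehlerDifferential.D k A a) =
          c • (curryDerivation (extend p) P).liftKaehlerDifferential (KaehlerDifferential.D k A a)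
        simp only [Derivation.liftKaehlerDifferential_comp_D]
        exact map_smul (extend p) c (curryFirst P a) }

theorem extend_apply [CharZero k] {p : ℕ} (P : Polyvector k A N p) (f : Fin p → A) :
    extend k A N p P (fun i => KaehlerDifferential.D k A (f i)) = P.1 f := by
  induction p with
  | zero =>
    exact congrArg P.1 (Subsingleton.elim _ _)
  | succ p ih =>
    have h : ∀ i : Fin (p + 1),
        (curryDerivation (extend k A N p) P).liftKaehlerDifferential
          (KaehlerDifferential.D k A (f i))
          (i.removeNth fun j => KaehlerDifferential.D k A (f j)) =
        P.1.curryLeft (f i) (i.removeNth f) := by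
      intro i
      rw [Derivation.liftKaehlerDifferential_comp_D]
      exact ih (curryFirst P (f i)) (i.removeNth f)
    simp only [extend, LinearMap.coe_mk, AddHom.coe_mk, AlternatingMap.smul_apply,
      AlternatingMap.alternatizeUncurryFin_apply, h]
    rw [← AlternatingMap.alternatizeUncurryFin_apply (P.1.curryLeft),
      AlternatingMap.alternatizeUncurryFin_curryLeft, algebraMap_smul]
    have hp : ((p + 1 : ℕ) : k) ≠ 0 := Nat.cast_ne_zero.mpr (Nat.succ_ne_zero p)
    rw [AlternatingMap.smul_apply, ← Nat.cast_smul_eq_nsmul k, smul_smul,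
      inv_mul_cancel₀ hp, one_smul]

end Extension

section Forms

variable (k A : Type*) [Field k] [CommRing A] [Algebra k A]

/-- The Kähler forms `Ω^p(A)`. -/
abbrev KForm (p : ℕ) : Type _ := ⋀[A]^p Ω[A⁄k]

variable {k A}

instance (p : ℕ) : IsScalarTower k A (KForm k A p) := inferInstance

/-- The form `df₁ ∧ ⋯ ∧ df_p`. -/
def dForm {p : ℕ} (f : Fin p → A) : KForm k A p :=
  exteriorPower.ιMulti A p fun i => KaehlerDifferential.D k A (f i)

theorem dForm_update {p : ℕ} [DecidableEq (Fin p)] (f : Fin p → A) (i : Fin p) (x : A) :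
    dForm (k := k) (Function.update f i x) =
      exteriorPower.ιMulti A p (Function.update (fun j => KaehlerDifferential.D k A (f j)) i
        (KaehlerDifferential.D k A x)) := by
  rw [dForm]
  congr 1
  ext j
  by_cases hj : j = i
  · subst hj; simp
  · simp [hj]

variable (k A) in
/-- The polyvector `(f₁, …, f_p) ↦ df₁ ∧ ⋯ ∧ df_p` with values in `Ω^p(A)`. -/
def dFormPolyvector (p : ℕ) : Polyvector k A (KForm k A p) p :=
  ⟨{ toFun := dForm
     map_update_add' := by
       intro _ f i a b
       rw [dForm_update, dForm_update, dForm_update, map_add, AlternatingMap.map_update_add]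
     map_update_smul' := by
       intro _ f i c a
       rw [dForm_update, dForm_update, Derivation.map_smul,
         ← algebraMap_smul A c (KaehlerDifferential.D k A a), AlternatingMap.map_update_smul,
         algebraMap_smul]
     map_eq_zero_of_eq' := by
       intro f i j hf hij
       exact (exteriorPower.ιMulti A p).map_eq_zero_of_eq _ (by simp [hf]) hij },
    by
      intro f i a b
      change dForm _ = a • dForm _ + b • dForm _
      rw [dForm_update, dForm_update, dForm_update, Derivation.leibniz,
        AlternatingMap.map_update_add, AlternatingMap.map_update_smul,
        AlternatingMap.map_update_smul]⟩

/-- The contraction `ι_P : Ω^m(A) → Ω^r(A)` with a polyvector `P` of degree `p`, where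
`p + r = m`: the `A`-linear map with
`ι_P (df₁ ∧ ⋯ ∧ df_m) = (-1)^(p(p-1)/2) ∑ sgn(σ) P(f_σ(1), …, f_σ(p)) df_σ(p+1) ∧ ⋯ ∧ df_σ(m)`,
the sum being over the `(p, r)`-shuffles (see `contract_dForm`). The sign is the one for which
`ι_(P ∧ Q) = ι_P ι_Q`. -/
def contract [CharZero k] {p r m : ℕ} (h : p + r = m) (P : Polyvector k A A p) :
    KForm k A m →ₗ[A] KForm k A r :=
  (-1 : A) ^ (p.choose 2) • exteriorPower.alternatingMapLinearEquiv
    (extend k A (KForm k A r) m (wedge h P (dFormPolyvector k A r)))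

theorem contract_dForm [CharZero k] {p r m : ℕ} (h : p + r = m) (P : Polyvector k A A p)
    (f : Fin m → A) :
    contract h P (dForm f) =
      (-1 : A) ^ (p.choose 2) • (wedge h P (dFormPolyvector k A r)).1 f := by
  rw [contract, LinearMap.smul_apply, dForm, exteriorPower.alternatingMapLinearEquiv_apply_ιMulti,
    extend_apply]

/-- Left multiplication `x ↦ ω ∧ x` by a `1`-form. -/
def wedgeLeft (p : ℕ) : Ω[A⁄k] →ₗ[A] KForm k A p →ₗ[A] KForm k A (p + 1) :=
  LinearMap.mk₂ A
    (fun ω x => ⟨ExteriorAlgebra.ι A ω * x.1, by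
      change _ ∈ LinearMap.range (ExteriorAlgebra.ι A) ^ (p + 1)
      rw [pow_succ']
      exact Submodule.mul_mem_mul (LinearMap.mem_range_self _ _) x.2⟩)
    (by intros; ext; simp [add_mul])
    (by intros; ext; simp)
    (by intros; ext; simp [mul_add])
    (by intros; ext; simp)

theorem wedgeLeft_dForm {p : ℕ} (a : A) (f : Fin p → A) :
    wedgeLeft p (KaehlerDifferential.D k A a) (dForm f) = dForm (Matrix.vecCons a f) := by
  ext
  simp [wedgeLeft, dForm, ExteriorAlgebra.ιMulti_succ_apply]
  rfl

variable (k A) in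
/-- The group `Ω^p(A) × Ω^(p+1)(A)`, made into an `A`-module by
`a • (x, y) = (a x, a y + da ∧ x)`. The `A`-linear maps into it that lift the identity of `Ω^p(A)`
are the operators that satisfy the Leibniz rule of the de Rham differential. -/
def JetForm (p : ℕ) : Type _ := KForm k A p × KForm k A (p + 1)

namespace JetForm

instance (p : ℕ) : AddCommGroup (JetForm k A p) :=
  inferInstanceAs (AddCommGroup (KForm k A p × KForm k A (p + 1)))

instance (p : ℕ) : Module k (JetForm k A p) :=
  inferInstanceAs (Module k (KForm k A p × KForm k A (p + 1)))

instance (p : ℕ) : SMul A (JetForm k A p) :=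
  ⟨fun a z => (a • z.1, a • z.2 + wedgeLeft p (KaehlerDifferential.D k A a) z.1)⟩

theorem smul_def {p : ℕ} (a : A) (z : JetForm k A p) :
    a • z = (a • z.1, a • z.2 + wedgeLeft p (KaehlerDifferential.D k A a) z.1) := rfl

theorem smul_fst {p : ℕ} (a : A) (z : JetForm k A p) : (a • z).1 = a • z.1 := rfl

theorem smul_snd {p : ℕ} (a : A) (z : JetForm k A p) :
    (a • z).2 = a • z.2 + wedgeLeft p (KaehlerDifferential.D k A a) z.1 := rfl

theorem add_fst {p : ℕ} (z w : JetForm k A p) : (z + w).1 = z.1 + w.1 := rfl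

theorem add_snd {p : ℕ} (z w : JetForm k A p) : (z + w).2 = z.2 + w.2 := rfl

theorem zero_fst {p : ℕ} : (0 : JetForm k A p).1 = 0 := rfl

theorem zero_snd {p : ℕ} : (0 : JetForm k A p).2 = 0 := rfl

instance (p : ℕ) : Module A (JetForm k A p) where
  one_smul z := Prod.ext (by rw [smul_fst, one_smul]) (by simp [smul_snd])
  mul_smul a b z := Prod.ext (by simp only [smul_fst, mul_smul]) (by
    simp only [smul_fst, smul_snd, Derivation.leibniz, map_add, map_smul, LinearMap.add_apply,
      LinearMap.smul_apply, smul_add, mul_smul]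
    abel)
  smul_zero a := Prod.ext (by simp [smul_fst, zero_fst]) (by simp [smul_snd, zero_fst, zero_snd])
  smul_add a z w := Prod.ext (by simp [smul_fst, add_fst]) (by
    simp only [smul_snd, add_snd, add_fst, smul_add, map_add]; abel)
  add_smul a b z := Prod.ext (by simp [smul_fst, add_fst, add_smul]) (by
    simp only [smul_snd, add_snd, add_smul, map_add, LinearMap.add_apply]; abel)
  zero_smul z := Prod.ext (by simp [smul_fst, zero_fst]) (by simp [smul_snd, zero_snd])

instance (p : ℕ) : IsScalarTower k A (JetForm k A p) :=
  ⟨fun c a z => Prod.ext (smul_assoc c a z.1) (by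
    change (c • a) • z.2 + wedgeLeft p (KaehlerDifferential.D k A (c • a)) z.1 =
      c • (a • z.2 + wedgeLeft p (KaehlerDifferential.D k A a) z.1)
    rw [Derivation.map_smul, smul_assoc, smul_add,
      ← algebraMap_smul A c (KaehlerDifferential.D k A a), map_smul, LinearMap.smul_apply,
      algebraMap_smul])⟩

end JetForm

theorem dForm_swap {p : ℕ} (f : Fin p → A) (i : Fin p) (a b : A) :
    dForm (k := k) (Matrix.vecCons a (Function.update f i b)) =
      -dForm (k := k) (Matrix.vecCons b (Function.update f i a)) := by
  have h := (dFormPolyvector k A (p + 1)).1.map_swap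
    (Matrix.vecCons b (Function.update f i a)) (i := 0) (j := i.succ) (Fin.succ_ne_zero i).symm
  refine Eq.trans ?_ h
  change dForm _ = dForm _
  congr 1
  ext j
  refine Fin.cases ?_ (fun j => ?_) j
  · simp
  · by_cases hj : j = i
    · subst hj; simp
    · have h1 : j.succ ≠ i.succ := fun h => hj (Fin.succ_injective _ h)
      simp [hj, Equiv.swap_apply_of_ne_of_ne (Fin.succ_ne_zero j) h1]

variable (k A) in
/-- The polyvector `(f₁, …, f_p) ↦ (df₁ ∧ ⋯ ∧ df_p, 0)`. -/
def jetPolyvector (p : ℕ) : Polyvector k A (JetForm k A p) p :=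
  ⟨(show KForm k A p →ₗ[k] JetForm k A p from
      LinearMap.inl k (KForm k A p) (KForm k A (p + 1))).compAlternatingMap
        (dFormPolyvector k A p).1, by
    intro f i a b
    refine Prod.ext ((dFormPolyvector k A p).2 f i a b) ?_
    rw [JetForm.add_snd, JetForm.smul_snd, JetForm.smul_snd]
    change (0 : KForm k A (p + 1)) = a • (0 : KForm k A (p + 1)) +
      wedgeLeft p (KaehlerDifferential.D k A a) (dForm (Function.update f i b)) +
      (b • (0 : KForm k A (p + 1)) +
        wedgeLeft p (KaehlerDifferential.D k A b) (dForm (Function.update f i a)))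
    rw [wedgeLeft_dForm, wedgeLeft_dForm, dForm_swap f i a b]
    simp⟩

variable (k A) in
/-- The `A`-linear map `ω ↦ (ω, dω)`. -/
def jet [CharZero k] (p : ℕ) : KForm k A p →ₗ[A] JetForm k A p :=
  exteriorPower.alternatingMapLinearEquiv (extend k A (JetForm k A p) p (jetPolyvector k A p))

theorem jet_dForm_fst [CharZero k] {p : ℕ} (f : Fin p → A) :
    (jet k A p (dForm f)).1 = dForm f := by
  rw [jet, dForm, exteriorPower.alternatingMapLinearEquiv_apply_ιMulti, extend_apply]
  rfl

theorem jet_dForm_snd [CharZero k] {p : ℕ} (f : Fin p → A) :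
    (jet k A p (dForm f)).2 = 0 := by
  rw [jet, dForm, exteriorPower.alternatingMapLinearEquiv_apply_ιMulti, extend_apply]
  rfl

variable (k A) in
/-- The de Rham differential `d : Ω^p(A) → Ω^(p+1)(A)`, the `k`-linear map with
`d(f₀ df₁ ∧ ⋯ ∧ df_p) = df₀ ∧ df₁ ∧ ⋯ ∧ df_p` (see `deRham_smul_dForm`). -/
def deRham [CharZero k] (p : ℕ) : KForm k A p →ₗ[k] KForm k A (p + 1) :=
  (show JetForm k A p →ₗ[k] KForm k A (p + 1) from
    LinearMap.snd k (KForm k A p) (KForm k A (p + 1))) ∘ₗ (jet k A p).restrictScalars k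

theorem deRham_smul_dForm [CharZero k] {p : ℕ} (a : A) (f : Fin p → A) :
    deRham k A p (a • dForm f) = dForm (Matrix.vecCons a f) := by
  change (jet k A p (a • dForm f)).2 = _
  rw [map_smul, JetForm.smul_snd, jet_dForm_fst, jet_dForm_snd, wedgeLeft_dForm, smul_zero,
    zero_add]

end Forms

/-! ### Forms modulo relations, volume forms and the modular vector -/

section Volume

variable (k A : Type*) [Field k] [CharZero k] [CommRing A] [Algebra k A]

/-- A system of relations between Kähler forms, stable under the de Rham differential and under
contraction with polyvectors. The quotient by the trivial system `⊥` is the algebra of Kähler forms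
itself. If `A = C^∞(X)` for a smooth manifold `X`, the Kähler forms whose associated smooth form is
zero constitute such a system, and the quotient is the algebra of smooth forms on `X`. -/
structure FormRelations where
  /-- the relations in degree `p` -/
  rel : ∀ p : ℕ, Submodule A (KForm k A p)
  deRham_mem : ∀ {p : ℕ} (ω : KForm k A p), ω ∈ rel p → deRham k A p ω ∈ rel (p + 1)
  contract_mem : ∀ {p r m : ℕ} (h : p + r = m) (P : Polyvector k A A p) (ω : KForm k A m),
    ω ∈ rel m → contract h P ω ∈ rel r

instance : Bot (FormRelations k A) :=
  ⟨{ rel := fun _ => ⊥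
     deRham_mem := by intro p ω hω; rw [Submodule.mem_bot] at *; rw [hω, map_zero]
     contract_mem := by intro p r m h P ω hω; rw [Submodule.mem_bot] at *; rw [hω, map_zero] }⟩

variable {k A}

namespace FormRelations

variable (I : FormRelations k A)

/-- The space `Ω^p` of differential `p`-forms: Kähler forms modulo the given relations. -/
abbrev Form (p : ℕ) : Type _ := KForm k A p ⧸ I.rel p

/-- The de Rham differential. -/
def d (p : ℕ) : I.Form p →+ I.Form (p + 1) :=
  QuotientAddGroup.map _ _ (deRham k A p).toAddMonoidHom fun ω hω => I.deRham_mem ω hω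

/-- The contraction `ι_P : Ω^m → Ω^r` with a polyvector `P` of degree `p`, where `p + r = m`. -/
def ι {p r m : ℕ} (h : p + r = m) (P : Polyvector k A A p) : I.Form m →ₗ[A] I.Form r :=
  Submodule.mapQ _ _ (contract h P) fun ω hω => I.contract_mem h P ω hω

/-- `η ∈ Ω^n` is a volume form: the contraction `P ↦ ι_P η` is an isomorphism from `𝔛^•(A)` to
`Ω^(n-•)`. In particular there are no polyvectors and no forms of degree greater than `n`. -/
structure IsVolumeForm {n : ℕ} (η : I.Form n) : Prop where
  bijective : ∀ {p r : ℕ} (h : p + r = n),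
    Function.Bijective fun P : Polyvector k A A p => I.ι h P η
  polyvector_eq_zero : ∀ {p : ℕ}, n < p → ∀ P : Polyvector k A A p, P = 0
  form_eq_zero : ∀ {r : ℕ}, n < r → ∀ ω : I.Form r, ω = 0

variable {I}

/-- The divergence `Div : 𝔛^(p+1)(A) → 𝔛^p(A)` with respect to a volume form `η`, characterized by
`ι_(Div P) η = d (ι_P η)` (see `ι_divergence`). It vanishes on `𝔛^(p+1)(A) = 0` for `p + 1 > n`. -/
def IsVolumeForm.divergence {n : ℕ} {η : I.Form n} (hη : I.IsVolumeForm η) {p : ℕ}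
    (P : Polyvector k A A (p + 1)) : Polyvector k A A p :=
  if h : p + 1 ≤ n then
    ((hη.bijective (p := p) (r := n - (p + 1) + 1) (by omega)).surjective
      (I.d _ (I.ι (r := n - (p + 1)) (by omega) P η))).choose
  else 0

theorem IsVolumeForm.ι_divergence {n : ℕ} {η : I.Form n} (hη : I.IsVolumeForm η) {p r : ℕ}
    (h : (p + 1) + r = n) (P : Polyvector k A A (p + 1)) :
    I.ι (by omega : p + (r + 1) = n) (hη.divergence P) η = I.d r (I.ι h P η) := by
  obtain rfl : r = n - (p + 1) := by omega
  rw [divergence, dif_pos (by omega : p + 1 ≤ n)]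
  exact ((hη.bijective (p := p) (r := n - (p + 1) + 1) (by omega)).surjective
      (I.d _ (I.ι (r := n - (p + 1)) (by omega) P η))).choose_spec

/-- The modular vector `ν = -Div(π) ∈ 𝔛^1(A)` of the Poisson structure `π` with respect to the
volume form `η`. -/
def IsVolumeForm.modularVector {n : ℕ} {η : I.Form n} (hη : I.IsVolumeForm η)
    (π : PoissonStructure k A) : Polyvector k A A 1 :=
  -hη.divergence π.bivector

end FormRelations

/-- A polyvector of degree `1`, as a `k`-linear endomorphism of `A`. -/
def Polyvector.toEnd (X : Polyvector k A A 1) : Module.End k A :=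
  firstSlot X.1 ![]

/-- An endomorphism of a vector space is diagonalizable (semisimple): the space is spanned by
eigenvectors. -/
def IsDiagonalizable {V : Type*} [AddCommGroup V] [Module k V] (T : Module.End k V) : Prop :=
  ⨆ c : k, T.eigenspace c = ⊤

end Volume

end PoissonBV

end

/-!
# The Batalin–Vilkovisky structure on Poisson cohomology

Polyvectors `P` act on the space `Ω^• = ⨁ Ω^m` of all forms by contraction `ι_P`. Cartan calculus
translates the operations on polyvectors into operators: `ι_(P ∧ Q) = ι_P ι_Q` (`iOp_wedge`), the
contractions commute in the graded sense (`iOp_comm`), and `ι_[P, Q] = [[ι_P, d], ι_Q]`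
(`iOp_schouten`). These are proved by induction on forms, since `Ω^•` is generated from `1` by the
multiplications by functions `a` and exact forms `da`; the input on polyvectors is how the wedge
product, the Schouten bracket and the Poisson differential behave when the first argument is fixed.
In particular `δ = [π, -]` (`delta_eq_schouten`).

Let `L_P = [ι_P, d]`. The volume form `η` makes `P ↦ ι_P η` an isomorphism to forms. As
`L_π η = ι_ν η`, it turns `δ` into the differential `D = L_π - ι_ν` of forms (`poissonOp`,
`poissonOp_contraction_volume`, `poissonOp_sq`), and `Div` into `d` by definition. The two
differentials need not anticommute: `d D + D d = -L_ν` (`modularLieOp_eq`), where `L_ν` is the Lie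
derivative along the modular vector.

If `ν` is semisimple, then so is `L_ν` on forms, by the Leibniz rule (`isDiagonalizable_lieOp`).
Hence `Ω^•` is the sum of the kernel and the range of `L_ν`, and the projection `Π` to the kernel commutes
with `d` and `D`. On the range, `L_ν` is invertible and `d` gives a homotopy that contracts `D`
(`exists_poissonOp_eq_sub`), so every class has an invariant representative. On the kernel, `d` and
`D` anticommute, so that `P ↦ -dΠ(ι_P η)` defines an operator `Δ` of degree `-1` on cohomology
(`exists_bvOperator`).

For invariant representatives, products are again invariant, and the identities for `Δ` can be
checked on `η`, where `dη = 0`. There the second order identity says that the contraction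
`[[ι_P, d], ι_Q]` commutes with a third contraction (`dOp_mul_mul`), and the generated bracket
is `[[ι_P, d], ι_Q]` itself (`brE_apply_of_dOp_eq_zero`). As the derived bracket is compatible with
`δ` (`brE_deltaE_left`, `brE_deltaE_right`), the generated bracket agrees with the Schouten bracket
for arbitrary representatives (`represents_br`).

Classes are compared through the relation `Represents`: a class is determined by the value on `η`
of the contraction with a representative, modulo the range of `D` (`Represents.eq_of_sub_eq`).
-/

noncomputable section

namespace PoissonBV

/-! ### The shuffle product and insertion of the first argument -/

section Shuffle

/-- Sorting the permutations `τ` of `{0, …, m}` by the place `j = τ⁻¹ 0` that the first entry is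
moved to. -/
theorem sum_perm_vecCons {A N : Type*} [AddCommGroup N] {m : ℕ} (G : (Fin (m + 1) → A) → N) (a : A)
    (f : Fin m → A) :
    ∑ τ : Equiv.Perm (Fin (m + 1)), (Equiv.Perm.sign τ : ℤ) • G (Matrix.vecCons a f ∘ τ) =
      ∑ j : Fin (m + 1), (-1 : ℤ) ^ (j : ℕ) • ∑ ρ : Equiv.Perm (Fin m),
        (Equiv.Perm.sign ρ : ℤ) • G (j.insertNth a (f ∘ ρ)) := by
  -- The permutation that belongs to the place `j` and the permutation `ρ` of the other entries.
  let E : Fin (m + 1) × Equiv.Perm (Fin m) → Equiv.Perm (Fin (m + 1)) := fun x =>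
    Equiv.Perm.decomposeFin.symm (0, x.2) * x.1.cycleRange
  have hE : Function.Bijective E := by
    rw [Fintype.bijective_iff_injective_and_card]
    refine ⟨?_, ?_⟩
    · rintro ⟨j, ρ⟩ ⟨j', ρ'⟩ h
      have h0 : ∀ (j : Fin (m + 1)) (ρ : Equiv.Perm (Fin m)), (E (j, ρ)).symm 0 = j := by
        intro j ρ
        rw [Equiv.symm_apply_eq]
        simp [E]
      have hj : j = j' := by rw [← h0 j ρ, ← h0 j' ρ', h]
      subst hj
      have := mul_right_cancel h
      simpa using this
    · simp [Fintype.card_perm, Nat.factorial_succ]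
  rw [← (Equiv.ofBijective E hE).sum_comp, Fintype.sum_prod_type]
  refine Finset.sum_congr rfl fun j _ => ?_
  rw [Finset.smul_sum]
  refine Finset.sum_congr rfl fun ρ _ => ?_
  have h1 : Matrix.vecCons a f ∘ E (j, ρ) = j.insertNth a (f ∘ ρ) := by
    rw [← Fin.cons_comp_cycleRange]
    ext i
    simp only [E, Equiv.Perm.coe_mul, Function.comp_apply]
    refine Fin.cases ?_ (fun l => ?_) (j.cycleRange i)
    · simp
    · simp [Equiv.Perm.decomposeFin_symm_apply_succ]
  rw [Equiv.ofBijective_apply, h1, smul_smul]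
  congr 1
  simp [E, Equiv.Perm.decomposeFin.symm_sign, mul_comm]

theorem insertNth_castAdd {A : Type*} {p q m : ℕ} (h : p + 1 + q = m + 1) (h' : p + q = m)
    (j : Fin (p + 1)) (a : A) (g : Fin m → A) :
    (fun i => (Fin.cast h (Fin.castAdd q j)).insertNth (α := fun _ => A) a g
      (Fin.cast h (Fin.castAdd q i))) =
      j.insertNth (α := fun _ => A) a (fun i => g (Fin.cast h' (Fin.castAdd q i))) := by
  ext i
  refine j.succAboveCases ?_ (fun i => ?_) i
  · simp
  · have : Fin.cast h (Fin.castAdd q (j.succAbove i)) =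
        (Fin.cast h (Fin.castAdd q j)).succAbove (Fin.cast h' (Fin.castAdd q i)) := by
      ext
      simp only [Fin.succAbove, Fin.lt_def]
      simp only [Fin.val_cast, Fin.val_castAdd, Fin.val_castSucc]
      split_ifs <;> simp
    rw [this, Fin.insertNth_apply_succAbove, Fin.insertNth_apply_succAbove]

theorem insertNth_castAdd_natAdd {A : Type*} {p q m : ℕ} (h : p + 1 + q = m + 1) (h' : p + q = m)
    (j : Fin (p + 1)) (a : A) (g : Fin m → A) :
    (fun i => (Fin.cast h (Fin.castAdd q j)).insertNth (α := fun _ => A) a g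
      (Fin.cast h (Fin.natAdd (p + 1) i))) =
      (fun i => g (Fin.cast h' (Fin.natAdd p i))) := by
  ext i
  have : Fin.cast h (Fin.natAdd (p + 1) i) =
      (Fin.cast h (Fin.castAdd q j)).succAbove (Fin.cast h' (Fin.natAdd p i)) := by
    ext
    simp only [Fin.succAbove, Fin.lt_def]
    simp only [Fin.val_cast, Fin.val_castAdd, Fin.val_castSucc, Fin.val_natAdd]
    split_ifs
    · have := j.2
      omega
    · simp; omega
  rw [this, Fin.insertNth_apply_succAbove]

theorem insertNth_natAdd {A : Type*} {p q m : ℕ} (h : p + (q + 1) = m + 1) (h' : p + q = m)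
    (j : Fin (q + 1)) (a : A) (g : Fin m → A) :
    (fun i => (Fin.cast h (Fin.natAdd p j)).insertNth (α := fun _ => A) a g
      (Fin.cast h (Fin.natAdd p i))) =
      j.insertNth (α := fun _ => A) a (fun i => g (Fin.cast h' (Fin.natAdd p i))) := by
  ext i
  refine j.succAboveCases ?_ (fun i => ?_) i
  · simp
  · have : Fin.cast h (Fin.natAdd p (j.succAbove i)) =
        (Fin.cast h (Fin.natAdd p j)).succAbove (Fin.cast h' (Fin.natAdd p i)) := by
      ext
      simp only [Fin.succAbove, Fin.lt_def]
      simp only [Fin.val_cast, Fin.val_natAdd, Fin.val_castSucc]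
      split_ifs <;> simp <;> omega
    rw [this, Fin.insertNth_apply_succAbove, Fin.insertNth_apply_succAbove]

theorem insertNth_natAdd_castAdd {A : Type*} {p q m : ℕ} (h : p + (q + 1) = m + 1) (h' : p + q = m)
    (j : Fin (q + 1)) (a : A) (g : Fin m → A) :
    (fun i => (Fin.cast h (Fin.natAdd p j)).insertNth (α := fun _ => A) a g
      (Fin.cast h (Fin.castAdd (q + 1) i))) =
      (fun i => g (Fin.cast h' (Fin.castAdd q i))) := by
  ext i
  have : Fin.cast h (Fin.castAdd (q + 1) i) =
      (Fin.cast h (Fin.natAdd p j)).succAbove (Fin.cast h' (Fin.castAdd q i)) := by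
    ext
    simp only [Fin.succAbove, Fin.lt_def]
    simp only [Fin.val_cast, Fin.val_castAdd, Fin.val_castSucc, Fin.val_natAdd]
    split_ifs
    · simp
    · have := i.2
      omega
  rw [this, Fin.insertNth_apply_succAbove]

variable {k A : Type*} [Field k] [CommRing A] [Algebra k A]
  {N₁ N₂ N₃ : Type*} [AddCommGroup N₁] [Module k N₁] [AddCommGroup N₂] [Module k N₂]
  [AddCommGroup N₃] [Module k N₃]

/-- The sum over all permutations, of which the shuffle product is the part over the shuffles.
Unlike the shuffles, the permutations are easily sorted by the place of the first entry. -/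
def permSum (B : N₁ →ₗ[k] N₂ →ₗ[k] N₃) {p q m : ℕ} (h : p + q = m)
    (φ : A [⋀^Fin p]→ₗ[k] N₁) (ψ : A [⋀^Fin q]→ₗ[k] N₂) (w : Fin m → A) : N₃ :=
  ∑ τ : Equiv.Perm (Fin m), (Equiv.Perm.sign τ : ℤ) •
    B (φ fun i => w (τ (Fin.cast h (Fin.castAdd q i))))
      (ψ fun i => w (τ (Fin.cast h (Fin.natAdd p i))))

/-- The shuffles represent the cosets of the permutations of the two blocks of arguments. -/
theorem factorial_smul_shuffleProd (B : N₁ →ₗ[k] N₂ →ₗ[k] N₃) {p q m : ℕ} (h : p + q = m)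
    (φ : A [⋀^Fin p]→ₗ[k] N₁) (ψ : A [⋀^Fin q]→ₗ[k] N₂) (w : Fin m → A) :
    (p.factorial * q.factorial) • shuffleProd B h φ ψ w = permSum B h φ ψ w := by
  set e := finSumFinEquiv.trans (finCongr h) with he
  have h1 := congrArg (fun F => TensorProduct.lift B (F (fun x => w (e x))))
    (MultilinearMap.domCoprod_alternization_eq φ ψ)
  simp only [Fintype.card_fin, AlternatingMap.smul_apply, map_nsmul] at h1
  refine h1.symm.trans ?_
  rw [MultilinearMap.alternatization_apply, map_sum, permSum,
    ← (Equiv.permCongr e).sum_comp]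
  refine Finset.sum_congr rfl fun σ _ => ?_
  rw [Units.smul_def, map_zsmul, Equiv.Perm.sign_permCongr]
  congr 1
  simp only [MultilinearMap.domDomCongr_apply, MultilinearMap.domCoprod_apply,
    TensorProduct.lift.tmul]
  have hl : ∀ i : Fin p, e.symm (Fin.cast h (Fin.castAdd q i)) = Sum.inl i := by
    intro i; rw [Equiv.symm_apply_eq]; rfl
  have hr : ∀ i : Fin q, e.symm (Fin.cast h (Fin.natAdd p i)) = Sum.inr i := by
    intro i; rw [Equiv.symm_apply_eq]; rfl
  simp [Equiv.permCongr_apply, hl, hr]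

/-- The permutations that move the first entry to the `j`-th argument of `φ` together contribute
the same for each `j`. -/
theorem sum_insertNth_left (B : N₁ →ₗ[k] N₂ →ₗ[k] N₃) {p q m : ℕ} (h : p + 1 + q = m + 1)
    (h' : p + q = m) (φ : A [⋀^Fin (p + 1)]→ₗ[k] N₁) (ψ : A [⋀^Fin q]→ₗ[k] N₂) (a : A)
    (f : Fin m → A) (j : Fin (p + 1)) :
    (-1 : ℤ) ^ (j : ℕ) • ∑ ρ : Equiv.Perm (Fin m), (Equiv.Perm.sign ρ : ℤ) •
      B (φ fun i => (Fin.cast h (Fin.castAdd q j)).insertNth (α := fun _ => A) a (f ∘ ρ)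
          (Fin.cast h (Fin.castAdd q i)))
        (ψ fun i => (Fin.cast h (Fin.castAdd q j)).insertNth (α := fun _ => A) a (f ∘ ρ)
          (Fin.cast h (Fin.natAdd (p + 1) i))) =
      permSum B h' (φ.curryLeft a) ψ f := by
  rw [permSum, Finset.smul_sum]
  refine Finset.sum_congr rfl fun ρ _ => ?_
  rw [insertNth_castAdd h h', insertNth_castAdd_natAdd h h', AlternatingMap.map_insertNth,
    map_zsmul, LinearMap.smul_apply, smul_comm, smul_smul ((-1 : ℤ) ^ _), ← mul_pow]
  simp

theorem sum_insertNth_right (B : N₁ →ₗ[k] N₂ →ₗ[k] N₃) {p q m : ℕ} (h : p + (q + 1) = m + 1)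
    (h' : p + q = m) (φ : A [⋀^Fin p]→ₗ[k] N₁) (ψ : A [⋀^Fin (q + 1)]→ₗ[k] N₂) (a : A)
    (f : Fin m → A) (j : Fin (q + 1)) :
    (-1 : ℤ) ^ (p + (j : ℕ)) • ∑ ρ : Equiv.Perm (Fin m), (Equiv.Perm.sign ρ : ℤ) •
      B (φ fun i => (Fin.cast h (Fin.natAdd p j)).insertNth (α := fun _ => A) a (f ∘ ρ)
          (Fin.cast h (Fin.castAdd (q + 1) i)))
        (ψ fun i => (Fin.cast h (Fin.natAdd p j)).insertNth (α := fun _ => A) a (f ∘ ρ)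
          (Fin.cast h (Fin.natAdd p i))) =
      (-1 : ℤ) ^ p • permSum B h' φ (ψ.curryLeft a) f := by
  rw [permSum, Finset.smul_sum, Finset.smul_sum]
  refine Finset.sum_congr rfl fun ρ _ => ?_
  rw [insertNth_natAdd h h', insertNth_natAdd_castAdd h h', AlternatingMap.map_insertNth,
    map_zsmul, smul_comm _ ((-1 : ℤ) ^ (j : ℕ)), smul_smul, pow_add, mul_assoc, ← mul_pow]
  simp

theorem permSum_vecCons (B : N₁ →ₗ[k] N₂ →ₗ[k] N₃) {p q m : ℕ} (h : p + q = m + 1)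
    (φ : A [⋀^Fin p]→ₗ[k] N₁) (ψ : A [⋀^Fin q]→ₗ[k] N₂) (a : A) (f : Fin m → A) :
    permSum B h φ ψ (Matrix.vecCons a f) =
      ∑ i : Fin p ⊕ Fin q, (-1 : ℤ) ^ ((finSumFinEquiv.trans (finCongr h) i : Fin (m + 1)) : ℕ) •
        ∑ ρ : Equiv.Perm (Fin m), (Equiv.Perm.sign ρ : ℤ) •
      B (φ fun l => (finSumFinEquiv.trans (finCongr h) i).insertNth (α := fun _ => A) a (f ∘ ρ)
          (Fin.cast h (Fin.castAdd q l)))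
        (ψ fun l => (finSumFinEquiv.trans (finCongr h) i).insertNth (α := fun _ => A) a (f ∘ ρ)
          (Fin.cast h (Fin.natAdd p l))) := by
  rw [(finSumFinEquiv.trans (finCongr h)).sum_comp (fun j : Fin (m + 1) => (-1 : ℤ) ^ (j : ℕ) •
        ∑ ρ : Equiv.Perm (Fin m), (Equiv.Perm.sign ρ : ℤ) •
      B (φ fun l => j.insertNth (α := fun _ => A) a (f ∘ ρ) (Fin.cast h (Fin.castAdd q l)))
        (ψ fun l => j.insertNth (α := fun _ => A) a (f ∘ ρ) (Fin.cast h (Fin.natAdd p l))))]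
  exact sum_perm_vecCons (fun w => B (φ fun i => w (Fin.cast h (Fin.castAdd q i)))
      (ψ fun i => w (Fin.cast h (Fin.natAdd p i)))) a f

theorem permSum_vecCons_succ_succ (B : N₁ →ₗ[k] N₂ →ₗ[k] N₃) {p q m : ℕ}
    (h : p + 1 + (q + 1) = m + 1) (φ : A [⋀^Fin (p + 1)]→ₗ[k] N₁)
    (ψ : A [⋀^Fin (q + 1)]→ₗ[k] N₂) (a : A) (f : Fin m → A) :
    permSum B h φ ψ (Matrix.vecCons a f) =
      (p + 1) • permSum B (by omega) (φ.curryLeft a) ψ f +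
        (q + 1) • (-1 : ℤ) ^ (p + 1) • permSum B (by omega) φ (ψ.curryLeft a) f := by
  rw [permSum_vecCons, Fintype.sum_sum_type]
  congr 1
  · refine (Finset.sum_congr rfl fun j _ =>
      sum_insertNth_left B h (by omega) φ ψ a f j).trans ?_
    simp
  · refine (Finset.sum_congr rfl fun j _ =>
      sum_insertNth_right B h (by omega) φ ψ a f j).trans ?_
    simp

theorem permSum_vecCons_succ_zero (B : N₁ →ₗ[k] N₂ →ₗ[k] N₃) {p m : ℕ}
    (h : p + 1 + 0 = m + 1) (φ : A [⋀^Fin (p + 1)]→ₗ[k] N₁)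
    (ψ : A [⋀^Fin 0]→ₗ[k] N₂) (a : A) (f : Fin m → A) :
    permSum B h φ ψ (Matrix.vecCons a f) =
      (p + 1) • permSum B (by omega) (φ.curryLeft a) ψ f := by
  rw [permSum_vecCons, Fintype.sum_sum_type, Finset.univ_eq_empty (α := Fin 0), Finset.sum_empty,
    add_zero]
  refine (Finset.sum_congr rfl fun j _ =>
    sum_insertNth_left B h (by omega) φ ψ a f j).trans ?_
  simp

theorem permSum_vecCons_zero_succ (B : N₁ →ₗ[k] N₂ →ₗ[k] N₃) {q m : ℕ}
    (h : 0 + (q + 1) = m + 1) (φ : A [⋀^Fin 0]→ₗ[k] N₁)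
    (ψ : A [⋀^Fin (q + 1)]→ₗ[k] N₂) (a : A) (f : Fin m → A) :
    permSum B h φ ψ (Matrix.vecCons a f) =
      (q + 1) • permSum B (by omega) φ (ψ.curryLeft a) f := by
  rw [permSum_vecCons, Fintype.sum_sum_type, Finset.univ_eq_empty (α := Fin 0), Finset.sum_empty,
    zero_add]
  refine (Finset.sum_congr rfl fun j _ =>
    sum_insertNth_right B h (by omega) φ ψ a f j).trans ?_
  simp

/-- The factor `p! q!` between the sums over permutations and over shuffles can be cancelled in
characteristic `0`. -/
theorem eq_of_factorial_smul_eq (k : Type*) [Field k] [CharZero k] [Module k N₃] {p q : ℕ}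
    {x y : N₃}
    (h : (p.factorial * q.factorial) • x = (p.factorial * q.factorial) • y) : x = y := by
  have hk : ((p.factorial * q.factorial : ℕ) : k) ≠ 0 :=
    Nat.cast_ne_zero.mpr (Nat.mul_ne_zero p.factorial_ne_zero q.factorial_ne_zero)
  rw [← Nat.cast_smul_eq_nsmul k, ← Nat.cast_smul_eq_nsmul k] at h
  exact smul_right_injective N₃ hk h

theorem shuffleProd_zero_zero (B : N₁ →ₗ[k] N₂ →ₗ[k] N₃) (h : 0 + 0 = 0)
    (φ : A [⋀^Fin 0]→ₗ[k] N₁) (ψ : A [⋀^Fin 0]→ₗ[k] N₂) (w : Fin 0 → A) :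
    shuffleProd B h φ ψ w = B (φ ![]) (ψ ![]) := by
  have := factorial_smul_shuffleProd B h φ ψ w
  simp only [Nat.factorial_zero, mul_one, one_smul] at this
  rw [this, permSum]
  simp
  congr 2 <;> congr 1 <;> exact Subsingleton.elim _ _

variable [CharZero k]

/-- In a shuffle, the first entry becomes the first argument of either `φ` or `ψ`. -/
theorem shuffleProd_vecCons_succ_succ (B : N₁ →ₗ[k] N₂ →ₗ[k] N₃) {p q m : ℕ}
    (h : p + 1 + (q + 1) = m + 1) (φ : A [⋀^Fin (p + 1)]→ₗ[k] N₁)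
    (ψ : A [⋀^Fin (q + 1)]→ₗ[k] N₂) (a : A) (f : Fin m → A) :
    shuffleProd B h φ ψ (Matrix.vecCons a f) =
      shuffleProd B (by omega) (φ.curryLeft a) ψ f +
        (-1 : ℤ) ^ (p + 1) • shuffleProd B (by omega) φ (ψ.curryLeft a) f := by
  refine eq_of_factorial_smul_eq k (p := p + 1) (q := q + 1) ?_
  rw [factorial_smul_shuffleProd, permSum_vecCons_succ_succ, smul_add,
    ← factorial_smul_shuffleProd, ← factorial_smul_shuffleProd, smul_smul]
  congr 1
  · rw [Nat.factorial_succ p, mul_assoc]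
  · rw [Nat.factorial_succ q, smul_comm _ ((-1 : ℤ) ^ _), smul_comm _ ((-1 : ℤ) ^ _), smul_smul]
    congr 2
    ring

theorem shuffleProd_vecCons_succ_zero (B : N₁ →ₗ[k] N₂ →ₗ[k] N₃) {p m : ℕ}
    (h : p + 1 + 0 = m + 1) (φ : A [⋀^Fin (p + 1)]→ₗ[k] N₁)
    (ψ : A [⋀^Fin 0]→ₗ[k] N₂) (a : A) (f : Fin m → A) :
    shuffleProd B h φ ψ (Matrix.vecCons a f) =
      shuffleProd B (by omega) (φ.curryLeft a) ψ f := by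
  refine eq_of_factorial_smul_eq k (p := p + 1) (q := 0) ?_
  rw [factorial_smul_shuffleProd, permSum_vecCons_succ_zero,
    ← factorial_smul_shuffleProd, smul_smul, Nat.factorial_succ p, mul_assoc]

theorem shuffleProd_vecCons_zero_succ (B : N₁ →ₗ[k] N₂ →ₗ[k] N₃) {q m : ℕ}
    (h : 0 + (q + 1) = m + 1) (φ : A [⋀^Fin 0]→ₗ[k] N₁)
    (ψ : A [⋀^Fin (q + 1)]→ₗ[k] N₂) (a : A) (f : Fin m → A) :
    shuffleProd B h φ ψ (Matrix.vecCons a f) =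
      shuffleProd B (by omega) φ (ψ.curryLeft a) f := by
  refine eq_of_factorial_smul_eq k (p := 0) (q := q + 1) ?_
  rw [factorial_smul_shuffleProd, permSum_vecCons_zero_succ,
    ← factorial_smul_shuffleProd, smul_smul, Nat.factorial_succ q]
  congr 1
  ring

end Shuffle

/-! ### Recursion formulas for the wedge product and the Schouten bracket -/

section Recursion

variable {k A N : Type*} [Field k] [CommRing A] [Algebra k A]
  [AddCommGroup N] [Module k N]

theorem map_vecCons_swap {p : ℕ} (P : A [⋀^Fin (p + 2)]→ₗ[k] N) (a b : A) (f : Fin p → A) :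
    P (Matrix.vecCons a (Matrix.vecCons b f)) = -P (Matrix.vecCons b (Matrix.vecCons a f)) := by
  rw [← P.map_swap _ (i := 0) (j := 1) (by simp)]
  congr 1
  ext i
  refine Fin.cases ?_ (fun i => Fin.cases ?_ (fun i => ?_) i) i
  · simp
  · simp
  · have h1 : i.succ.succ ≠ (1 : Fin (p + 2)) := fun h =>
      Fin.succ_ne_zero i (Fin.succ_injective _ h)
    rw [Function.comp_apply, Equiv.swap_apply_of_ne_of_ne (Fin.succ_ne_zero _) h1]
    simp

theorem forall_vecCons {A : Type*} {p : ℕ} {C : (Fin (p + 1) → A) → Prop}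
    (h : ∀ a f, C (Matrix.vecCons a f)) (f : Fin (p + 1) → A) : C f := by
  have := h (f 0) (Fin.tail f)
  rwa [show Matrix.vecCons (f 0) (Fin.tail f) = f from Fin.cons_self_tail f] at this

theorem shuffleProd_neg_right {N₁ N₂ N₃ : Type*} [AddCommGroup N₁] [Module k N₁]
    [AddCommGroup N₂] [Module k N₂] [AddCommGroup N₃] [Module k N₃] (B : N₁ →ₗ[k] N₂ →ₗ[k] N₃)
    {p q m : ℕ} (h : p + q = m) (φ : A [⋀^Fin p]→ₗ[k] N₁) (ψ : A [⋀^Fin q]→ₗ[k] N₂) :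
    shuffleProd B h φ (-ψ) = -shuffleProd B h φ ψ := by
  ext f
  simp only [shuffleProd, ← AlternatingMap.domCoprod'_apply, TensorProduct.tmul_neg, map_neg]
  simp

theorem firstSlot_curryLeft {p : ℕ} (P : A [⋀^Fin (p + 2)]→ₗ[k] A) (a : A) :
    (firstSlot P).curryLeft a = -firstSlot (P.curryLeft a) := by
  ext f g
  exact map_vecCons_swap P g a f

/-- An alternating map of degree at least `2` is a multiderivation as soon as it becomes one when
its first argument is fixed. -/
theorem mem_polyvector_of_curryLeft [Module A N] [IsScalarTower k A N] {p : ℕ}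
    (P : A [⋀^Fin (p + 2)]→ₗ[k] N) (h : ∀ a, P.curryLeft a ∈ Polyvector k A N (p + 1)) :
    P ∈ Polyvector k A N (p + 2) := by
  intro f i a b
  induction f using forall_vecCons with | _ c f
  refine Fin.cases ?_ (fun i => ?_) i
  · induction f using forall_vecCons with | _ d f
    have h1 : ∀ x, Function.update (Matrix.vecCons c (Matrix.vecCons d f)) 0 x =
        Matrix.vecCons x (Matrix.vecCons d f) := fun x => Fin.update_cons_zero _ _ _
    have h2 : ∀ x, Function.update (Matrix.vecCons c f) 0 x =
        Matrix.vecCons x f := fun x => Fin.update_cons_zero _ _ _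
    have h3 := h d (Matrix.vecCons c f) 0 a b
    simp only [h2, AlternatingMap.curryLeft_apply_apply] at h3
    simp only [h1, map_vecCons_swap P _ d, h3, smul_neg, neg_add]
  · have h1 : ∀ x, Function.update (Matrix.vecCons c f) i.succ x =
        Matrix.vecCons c (Function.update f i x) := fun x => (Fin.cons_update _ _ _ _).symm
    have h3 := h c f i a b
    simp only [AlternatingMap.curryLeft_apply_apply] at h3
    simp only [h1, h3]

section

variable [CharZero k]

theorem insertion_vecCons_succ_succ {p q m : ℕ} (h : p + 1 + (q + 1) = m + 1 + 1)
    (P : A [⋀^Fin (p + 1)]→ₗ[k] A) (Q : A [⋀^Fin (q + 1)]→ₗ[k] A) (a : A) (f : Fin m → A) :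
    insertion h P Q (Matrix.vecCons a f) =
      insertion (by omega) P (Q.curryLeft a) f +
        (-1 : ℤ) ^ q • insertion (by omega) (P.curryLeft a) Q f := by
  rcases p with _ | p
  · simp only [insertion, shuffleProd_vecCons_succ_zero]
    simp
  · simp only [insertion, shuffleProd_vecCons_succ_succ, firstSlot_curryLeft,
      shuffleProd_neg_right, AlternatingMap.neg_apply, pow_succ]
    simp

theorem insertion_vecCons_zero_right {p m : ℕ} (h : p + 2 + 0 = m + 1 + 1)
    (P : A [⋀^Fin (p + 2)]→ₗ[k] A) (Q : A [⋀^Fin 0]→ₗ[k] A) (a : A) (f : Fin m → A) :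
    insertion h P Q (Matrix.vecCons a f) = -insertion (by omega) (P.curryLeft a) Q f := by
  simp only [insertion, shuffleProd_vecCons_zero_succ, firstSlot_curryLeft,
      shuffleProd_neg_right, AlternatingMap.neg_apply]

theorem insertion_zero_right {p : ℕ} (h : p + 1 + 0 = p + 1)
    (P : A [⋀^Fin (p + 1)]→ₗ[k] A) (Q : A [⋀^Fin 0]→ₗ[k] A) (f : Fin p → A) :
    insertion h P Q f = P (Matrix.vecCons (Q ![]) f) := by
  induction p with
  | zero =>
    simp only [insertion, shuffleProd_zero_zero]
    obtain rfl : f = ![] := Subsingleton.elim _ _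
    rfl
  | succ p ih =>
    induction f using forall_vecCons with | _ a f
    rw [insertion_vecCons_zero_right, ih, AlternatingMap.curryLeft_apply_apply,
      map_vecCons_swap, neg_neg]

theorem insertion_one_left {q : ℕ} (h : 1 + q = q + 1)
    (X : A [⋀^Fin 1]→ₗ[k] A) (Q : A [⋀^Fin q]→ₗ[k] A) (f : Fin q → A) :
    insertion h X Q f = X ![Q f] := by
  induction q with
  | zero =>
    obtain rfl : f = ![] := Subsingleton.elim _ _
    exact insertion_zero_right (p := 0) h X Q ![]
  | succ q ih =>
    induction f using forall_vecCons with | _ a f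
    rw [insertion_vecCons_succ_succ (p := 0), ih]
    simp [insertion]

theorem insertion_one_right {p : ℕ} (h : p + 1 + 1 = p + 1 + 1)
    (P : A [⋀^Fin (p + 1)]→ₗ[k] A) (X : A [⋀^Fin 1]→ₗ[k] A) (f : Fin (p + 1) → A) :
    insertion h P X f =
      ∑ j : Fin (p + 1), (-1 : ℤ) ^ (j : ℕ) • P (Matrix.vecCons (X ![f j]) (j.removeNth f)) := by
  induction p with
  | zero =>
    induction f using forall_vecCons with | _ b f
    obtain rfl : f = ![] := Subsingleton.elim _ _
    rw [insertion_vecCons_succ_succ (q := 0), insertion_zero_right]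
    have h1 : (0 : Fin 1).removeNth ![b] = ![] := Subsingleton.elim _ _
    simp [insertion, h1]
  | succ p ih =>
    induction f using forall_vecCons with | _ b f
    rw [insertion_vecCons_succ_succ (q := 0), insertion_zero_right, ih,
      Fin.sum_univ_succ (n := p + 1)]
    congr 1
    · have h1 : (0 : Fin (p + 2)).removeNth (Matrix.vecCons b f) = f := by
        ext i; simp [Fin.removeNth]
      simp [h1]
    · rw [pow_zero, one_smul]
      refine Finset.sum_congr rfl fun j _ => ?_
      have h1 : j.succ.removeNth (Matrix.vecCons b f) = Matrix.vecCons b (j.removeNth f) := by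
        ext i
        refine Fin.cases ?_ (fun i => ?_) i <;> simp [Fin.removeNth]
      rw [h1, AlternatingMap.curryLeft_apply_apply, map_vecCons_swap P b]
      simp [pow_succ]

/-- The contraction of the first argument is a graded derivation of the Schouten bracket. Together
with `schouten_zero_left` and `schouten_zero_right`, this determines the bracket. -/
theorem schouten_curryLeft_succ_succ {p q m : ℕ} (h : p + 1 + (q + 1) = m + 1 + 1)
    (P : A [⋀^Fin (p + 1)]→ₗ[k] A) (Q : A [⋀^Fin (q + 1)]→ₗ[k] A) (a : A) :
    (schouten h P Q).curryLeft a =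
      schouten (by omega) (P.curryLeft a) Q +
        (-1 : ℤ) ^ p • schouten (by omega) P (Q.curryLeft a) := by
  ext f
  simp only [schouten, AlternatingMap.curryLeft_apply_apply, AlternatingMap.sub_apply,
    AlternatingMap.smul_apply, AlternatingMap.add_apply, insertion_vecCons_succ_succ]
  rcases Nat.even_or_odd p with hp | hp <;> rcases Nat.even_or_odd q with hq | hq <;>
    simp [pow_mul, pow_succ, hp.neg_one_pow, hq.neg_one_pow] <;> abel

theorem schouten_zero_left {q : ℕ} (h : 0 + (q + 1) = q + 1) (P : A [⋀^Fin 0]→ₗ[k] A)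
    (Q : A [⋀^Fin (q + 1)]→ₗ[k] A) :
    schouten h P Q = -Q.curryLeft (P ![]) := by
  ext f
  rw [schouten, AlternatingMap.sub_apply, insertion_zero_right]
  simp [insertion]

theorem schouten_zero_right {p : ℕ} (h : p + 1 + 0 = p + 1) (P : A [⋀^Fin (p + 1)]→ₗ[k] A)
    (Q : A [⋀^Fin 0]→ₗ[k] A) :
    schouten h P Q = (-1 : ℤ) ^ p • P.curryLeft (Q ![]) := by
  ext f
  rw [schouten, AlternatingMap.sub_apply, AlternatingMap.smul_apply, insertion_zero_right]
  simp [insertion, pow_succ]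

theorem schouten_mem {p q m : ℕ} (h : p + q = m + 1) {P : A [⋀^Fin p]→ₗ[k] A}
    {Q : A [⋀^Fin q]→ₗ[k] A} (hP : P ∈ Polyvector k A A p) (hQ : Q ∈ Polyvector k A A q) :
    schouten h P Q ∈ Polyvector k A A m := by
  induction m generalizing p q with
  | zero => exact fun f i => i.elim0
  | succ m ih =>
    rcases p with _ | p
    · obtain rfl : q = m + 1 + 1 := by omega
      rw [schouten_zero_left]
      exact neg_mem (curryLeft_mem ⟨Q, hQ⟩ _)
    rcases q with _ | q
    · obtain rfl : p = m + 1 := by omega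
      rw [schouten_zero_right]
      exact zsmul_mem (curryLeft_mem ⟨P, hP⟩ _) _
    rcases m with _ | m
    -- The commutator of two derivations is a derivation.
    · obtain rfl : p = 0 := by omega
      obtain rfl : q = 0 := by omega
      have hX : ∀ X ∈ Polyvector k A A 1, ∀ a b, X ![a * b] = a * X ![b] + b * X ![a] := by
        intro X hX a b
        have h1 : ∀ x : A, Function.update ![(0 : A)] 0 x = ![x] := by
          intro x; ext i; rw [Subsingleton.elim i 0]; simp
        have := hX ![0] 0 a b
        simpa only [h1, smul_eq_mul] using this
      intro f i a b
      have h1 : ∀ x, Function.update f i x = ![x] := by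
        intro x; ext j; rw [show j = i from Subsingleton.elim (α := Fin 1) j i]; simp
      have h2 : ∀ (X : A [⋀^Fin 1]→ₗ[k] A) (x y : A), X ![x + y] = X ![x] + X ![y] :=
        fun X x y => X.map_vecCons_add ![] x y
      simp only [h1, schouten, AlternatingMap.sub_apply, AlternatingMap.smul_apply,
        insertion_one_left, hX P hP, hX Q hQ, h2, smul_eq_mul]
      simp
      ring
    · refine mem_polyvector_of_curryLeft _ fun a => ?_
      rw [schouten_curryLeft_succ_succ]
      exact add_mem (ih _ (curryLeft_mem ⟨P, hP⟩ _) hQ)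
        (zsmul_mem (ih _ hP (curryLeft_mem ⟨Q, hQ⟩ _)) _)

end

end Recursion

section Wedge

variable {k A N : Type*} [Field k] [CommRing A] [Algebra k A]
  [AddCommGroup N] [Module k N] [Module A N] [IsScalarTower k A N]

theorem wedge_zero_zero (P : Polyvector k A A 0) (Q : Polyvector k A N 0) (f : Fin 0 → A) :
    (wedge (rfl : 0 + 0 = 0) P Q).1 f = P.1 ![] • Q.1 ![] :=
  shuffleProd_zero_zero _ _ _ _ f

variable [CharZero k]

theorem curryFirst_wedge_succ_succ {p q m : ℕ} (h : p + 1 + (q + 1) = m + 1)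
    (P : Polyvector k A A (p + 1)) (Q : Polyvector k A N (q + 1)) (a : A) :
    curryFirst (wedge h P Q) a = wedge (by omega) (curryFirst P a) Q +
      (-1 : ℤ) ^ (p + 1) • wedge (by omega) P (curryFirst Q a) := by
  ext f
  exact shuffleProd_vecCons_succ_succ _ h P.1 Q.1 a f

theorem curryFirst_wedge_succ_zero {p m : ℕ} (h : p + 1 + 0 = m + 1)
    (P : Polyvector k A A (p + 1)) (Q : Polyvector k A N 0) (a : A) :
    curryFirst (wedge h P Q) a = wedge (by omega) (curryFirst P a) Q := by
  ext f
  exact shuffleProd_vecCons_succ_zero _ h P.1 Q.1 a f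

theorem curryFirst_wedge_zero_succ {q m : ℕ} (h : 0 + (q + 1) = m + 1)
    (P : Polyvector k A A 0) (Q : Polyvector k A N (q + 1)) (a : A) :
    curryFirst (wedge h P Q) a = wedge (by omega) P (curryFirst Q a) := by
  ext f
  exact shuffleProd_vecCons_zero_succ _ h P.1 Q.1 a f

end Wedge

section Delta

variable {k A : Type*} [Field k] [CommRing A] [Algebra k A] (π : PoissonStructure k A)

namespace PoissonStructure

theorem succ_removeNth_vecCons {A : Type*} {p : ℕ} (a : A) (f : Fin (p + 1) → A) (i : Fin (p + 1)) :
    i.succ.removeNth (Matrix.vecCons a f) = Matrix.vecCons a (i.removeNth f) := by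
  ext j
  refine Fin.cases ?_ (fun j => ?_) j <;> simp [Fin.removeNth]

/-- The sum over the pairs `i < j`, split into the pairs with `i = 0` and the others. -/
theorem deltaBracketSum_vecCons {p : ℕ} (P : A [⋀^Fin (p + 1)]→ₗ[k] A) (a : A)
    (f : Fin (p + 1) → A) :
    π.deltaBracketSum P (Matrix.vecCons a f) =
      -∑ j : Fin (p + 1), (-1 : ℤ) ^ (j : ℕ) •
          P (Matrix.vecCons (π.bracket a (f j)) (j.removeNth f)) -
        π.deltaBracketSum (P.curryLeft a) f := by
  have h0 : ∀ j : Fin (p + 1), (if (0 : Fin (p + 1)).castSucc < j.succ then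
        (-1 : A) ^ (((0 : Fin (p + 1)) : ℕ) + (j.succ : ℕ)) *
          P (Matrix.vecCons (π.bracket (Matrix.vecCons a f (0 : Fin (p + 1)).castSucc)
              (Matrix.vecCons a f j.succ))
            (fun l : Fin p => Matrix.vecCons a f (j.succ.succAbove
              ((0 : Fin (p + 1)).succAbove l)))) else 0) =
      -((-1 : ℤ) ^ (j : ℕ) • P (Matrix.vecCons (π.bracket a (f j)) (j.removeNth f))) := by
    intro j
    have h1 : (fun l : Fin p => Matrix.vecCons a f (j.succ.succAbove
              ((0 : Fin (p + 1)).succAbove l))) = j.removeNth f := by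
      ext l; simp [Fin.removeNth]
    rw [if_pos (by simp), h1, zsmul_eq_mul]
    simp [pow_succ]
  rw [deltaBracketSum, Fin.sum_univ_succ]
  have hz : ∑ i : Fin (p + 1), (if i.castSucc < (0 : Fin (p + 2)) then
        (-1 : A) ^ ((i : ℕ) + ((0 : Fin (p + 2)) : ℕ)) *
          P (Matrix.vecCons (π.bracket (Matrix.vecCons a f i.castSucc) (Matrix.vecCons a f 0))
            (fun l : Fin p => Matrix.vecCons a f ((0 : Fin (p + 2)).succAbove (i.succAbove l))))
      else 0) = 0 :=
    Finset.sum_eq_zero fun i _ => if_neg (by simp)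
  rw [hz, zero_add]
  rcases p with _ | p
  · simp only [Fin.sum_univ_succ (n := 0), Finset.univ_eq_empty (α := Fin 0), Finset.sum_empty,
      add_zero]
    rw [h0]
    simp [deltaBracketSum]
  · simp only [Fin.sum_univ_succ (n := p + 1) (f := fun i : Fin (p + 2) => ite _ _ _)]
    rw [Finset.sum_add_distrib, Finset.sum_congr rfl fun j _ => h0 j, Finset.sum_neg_distrib,
      sub_eq_add_neg]
    congr 1
    rw [deltaBracketSum, ← Finset.sum_neg_distrib]
    refine Finset.sum_congr rfl fun j _ => ?_
    rw [← Finset.sum_neg_distrib]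
    refine Finset.sum_congr rfl fun i _ => ?_
    by_cases hij : i.castSucc < j
    · have h1 : (fun l : Fin (p + 1) =>
            Matrix.vecCons a f (j.succ.succAbove (i.succ.succAbove l))) =
          Matrix.vecCons a (fun l => f (j.succAbove (i.succAbove l))) := by
        ext l
        refine Fin.cases ?_ (fun l => ?_) l <;> simp
      rw [if_pos hij, if_pos (by simpa [Fin.lt_def] using hij), h1, map_vecCons_swap]
      simp [pow_succ, pow_add]
    · rw [if_neg hij, if_neg (by simpa [Fin.lt_def] using hij), neg_zero]

theorem delta_vecCons {p : ℕ} (P : A [⋀^Fin (p + 1)]→ₗ[k] A) (a : A) (f : Fin (p + 1) → A) :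
    π.delta P (Matrix.vecCons a f) = π.bracket a (P f) -
      ∑ j : Fin (p + 1), (-1 : ℤ) ^ (j : ℕ) •
        P (Matrix.vecCons (π.bracket a (f j)) (j.removeNth f)) - π.delta (P.curryLeft a) f := by
  rw [delta, deltaBracketSum_vecCons, Fin.sum_univ_succ, delta]
  have h1 : (0 : Fin (p + 2)).removeNth (Matrix.vecCons a f) = f := by
    ext i; simp [Fin.removeNth]
  simp only [h1, succ_removeNth_vecCons, AlternatingMap.curryLeft_apply_apply]
  simp only [Fin.val_zero, pow_zero, one_mul, Matrix.cons_val_zero, Matrix.cons_val_succ,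
    Fin.val_succ, pow_succ, mul_neg, mul_one, neg_mul, Finset.sum_neg_distrib]
  abel

/-- The Poisson differential is the Schouten bracket with the Poisson bivector. -/
theorem delta_eq_schouten [CharZero k] {p : ℕ} (h : 2 + p = p + 1 + 1) (P : A [⋀^Fin p]→ₗ[k] A) :
    π.delta P = schouten h π.bivector.1 P := by
  induction p with
  | zero =>
    ext f
    induction f using forall_vecCons with | _ a f
    obtain rfl : f = ![] := Subsingleton.elim _ _
    have h2 := map_vecCons_swap π.bivector.1 (P ![]) a ![]
    rw [schouten_zero_right]
    simp [delta, deltaBracketSum, bracket, h2]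
  | succ p ih =>
    ext f
    induction f using forall_vecCons with | _ a f
    have h1 := congrArg (fun R => R f)
      (schouten_curryLeft_succ_succ (p := 1) (m := p + 1) (by omega) π.bivector.1 P a)
    simp only [AlternatingMap.curryLeft_apply_apply] at h1
    rw [delta_vecCons, h1, ih (by omega), schouten, schouten]
    simp only [AlternatingMap.add_apply, AlternatingMap.sub_apply, AlternatingMap.smul_apply]
    rw [insertion_one_left (by omega), insertion_one_right (by omega)]
    simp [pow_mul, bracket]
    abel

/-- The value of `[π, π]` on three functions is twice the Jacobiator. -/
theorem schouten_bivector_self [CharZero k] (h : 2 + 2 = 3 + 1) :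
    schouten h π.bivector.1 π.bivector.1 = 0 := by
  ext f
  rw [← delta_eq_schouten]
  induction f using forall_vecCons with | _ a f
  induction f using forall_vecCons with | _ b f
  induction f using forall_vecCons with | _ c f
  obtain rfl : f = ![] := Subsingleton.elim _ _
  have hs : ∀ x y : A, π.bivector.1 ![x, y] = -π.bivector.1 ![y, x] :=
    fun x y => map_vecCons_swap π.bivector.1 x y ![]
  have hn : ∀ x y : A, π.bivector.1 ![x, -y] = -π.bivector.1 ![x, y] := by
    intro x y
    have := π.bracket_smul (-1) x y
    simpa [bracket] using this
  have hj := π.jacobi a b c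
  rw [delta_vecCons, delta_vecCons]
  have h1 : Fin.removeNth (1 : Fin 2) ![b, c] = ![b] := by
    ext i; rw [Subsingleton.elim i 0]; rfl
  simp only [delta, deltaBracketSum, bracket]
  simp [h1]
  rw [hs (π.bivector.1 ![a, b]) c, hs (π.bivector.1 ![a, c]) b]
  rw [hs c a] at hj
  rw [hn] at hj
  linear_combination 2 * hj

end PoissonStructure

end Delta

/-! ### Contraction and the de Rham differential on Kähler forms -/

section Kaehler

variable {k A : Type*} [Field k] [CommRing A] [Algebra k A]

theorem span_range_dForm (m : ℕ) :
    Submodule.span A (Set.range (dForm (k := k) (A := A) (p := m))) = ⊤ := by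
  apply Submodule.map_injective_of_injective (Submodule.injective_subtype _)
  rw [Submodule.map_span, Submodule.map_top, Submodule.range_subtype]
  refine Eq.trans ?_ (exteriorPower.ιMulti_span_fixedDegree_of_span_eq_top A m Ω[A⁄k]
      (KaehlerDifferential.span_range_derivation k A))
  congr 1
  ext x
  constructor
  · rintro ⟨_, ⟨f, rfl⟩, rfl⟩
    exact ⟨fun i => KaehlerDifferential.D k A (f i), by rintro _ ⟨i, rfl⟩; exact ⟨f i, rfl⟩, rfl⟩
  · rintro ⟨g, hg, rfl⟩
    choose f hf using fun i => hg (Set.mem_range_self i)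
    refine ⟨dForm f, ⟨f, rfl⟩, ?_⟩
    simp [dForm, hf]

theorem kForm_induction {m : ℕ} {C : KForm k A m → Prop} (ω : KForm k A m) (zero : C 0)
    (add : ∀ x y, C x → C y → C (x + y)) (smul : ∀ (a : A) (f : Fin m → A), C (a • dForm f)) :
    C ω := by
  have h : ω ∈ Submodule.span A (Set.range (dForm (k := k) (A := A) (p := m))) := by
    rw [span_range_dForm]; trivial
  obtain ⟨c, rfl⟩ := Finsupp.mem_span_range_iff_exists_finsupp.mp h
  exact Finset.sum_induction _ C add zero fun f _ => smul _ _

theorem kForm_hom_ext {m : ℕ} {M : Type*} [AddCommGroup M] [Module A M]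
    {F G : KForm k A m →ₗ[A] M} (h : ∀ f, F (dForm f) = G (dForm f)) : F = G :=
  LinearMap.ext_on_range (span_range_dForm m) h

/-- Postcomposition with an `A`-linear map commutes with wedge products. -/
theorem wedge_comp_apply [CharZero k] {N N' : Type*} [AddCommGroup N] [Module k N] [Module A N]
    [IsScalarTower k A N] [AddCommGroup N'] [Module k N'] [Module A N'] [IsScalarTower k A N']
    (L : N →ₗ[A] N') {p q m : ℕ} (h : p + q = m) (P : Polyvector k A A p) (Q : Polyvector k A N q)
    (Q' : Polyvector k A N' q) (hQ : ∀ f, Q'.1 f = L (Q.1 f)) (f : Fin m → A) :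
    (wedge h P Q').1 f = L ((wedge h P Q).1 f) := by
  refine eq_of_factorial_smul_eq k (p := p) (q := q) ?_
  rw [← map_nsmul L]
  simp only [wedge]
  rw [factorial_smul_shuffleProd, factorial_smul_shuffleProd, permSum, permSum, map_sum]
  refine Finset.sum_congr rfl fun τ _ => ?_
  rw [map_zsmul, hQ]
  congr 1
  exact (map_smul L _ _).symm

theorem wedge_zero_left [CharZero k] {N : Type*} [AddCommGroup N] [Module k N] [Module A N]
    [IsScalarTower k A N] {q : ℕ} (h : 0 + q = q) (P : Polyvector k A A 0) (Q : Polyvector k A N q)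
    (f : Fin q → A) : (wedge h P Q).1 f = P.1 ![] • Q.1 f := by
  induction q with
  | zero =>
    obtain rfl : f = ![] := Subsingleton.elim _ _
    exact wedge_zero_zero P Q ![]
  | succ q ih =>
    induction f using forall_vecCons with | _ a f
    have h1 := curryFirst_wedge_zero_succ (m := q) h P Q a
    exact (congrArg (fun R => R.1 f) h1).trans (ih (by omega) (curryFirst Q a) f)

variable [CharZero k]

theorem contract_zero {r : ℕ} (h : 0 + r = r) (P : Polyvector k A A 0) (ω : KForm k A r) :
    contract h P ω = P.1 ![] • ω := by
  suffices contract h P = P.1 ![] • LinearMap.id by rw [this]; rfl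
  refine kForm_hom_ext fun f => ?_
  rw [contract_dForm, wedge_zero_left]
  simp
  rfl

/-- The graded commutator of the contraction with `P` and the multiplication by `db` is the
contraction with `P(b, -)`, up to sign. -/
theorem contract_wedgeLeft_succ {p r m : ℕ} (h : p + 1 + (r + 1) = m + 1)
    (P : Polyvector k A A (p + 1)) (b : A) (ω : KForm k A m) :
    contract h P (wedgeLeft m (KaehlerDifferential.D k A b) ω) =
      (-1 : ℤ) ^ (p + 1) • (wedgeLeft r (KaehlerDifferential.D k A b) (contract (by omega) P ω) -
        contract (by omega) (curryFirst P b) ω) := by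
  suffices contract h P ∘ₗ wedgeLeft m (KaehlerDifferential.D k A b) =
      (-1 : ℤ) ^ (p + 1) • (wedgeLeft r (KaehlerDifferential.D k A b) ∘ₗ contract (by omega) P -
        contract (by omega) (curryFirst P b)) from congrArg (fun F => F ω) this
  refine kForm_hom_ext fun f => ?_
  simp only [LinearMap.comp_apply, LinearMap.smul_apply, LinearMap.sub_apply, wedgeLeft_dForm,
    contract_dForm]
  have h1 := congrArg (fun R => R.1 f)
    (curryFirst_wedge_succ_succ h P (dFormPolyvector k A (r + 1)) b)
  have h2 := wedge_comp_apply (wedgeLeft r (KaehlerDifferential.D k A b))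
    (by omega : p + 1 + r = m) P (dFormPolyvector k A r)
    (curryFirst (dFormPolyvector k A (r + 1)) b) (fun g => (wedgeLeft_dForm b g).symm) f
  have h3 : (wedge h P (dFormPolyvector k A (r + 1))).1 (Matrix.vecCons b f) =
      (wedge (by omega) (curryFirst P b) (dFormPolyvector k A (r + 1))).1 f +
      (-1 : ℤ) ^ (p + 1) • wedgeLeft r (KaehlerDifferential.D k A b)
        ((wedge (by omega) P (dFormPolyvector k A r)).1 f) := by
    rw [← h2]; exact h1
  have h4 : (p + 1).choose 2 = p + p.choose 2 := by
    rw [Nat.choose_succ_succ, Nat.choose_one_right]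
  rw [h3, map_smul, h4]
  rcases Nat.even_or_odd p with hp | hp <;> rcases Nat.even_or_odd (p.choose 2) with hq | hq <;>
    simp [pow_add, hp.neg_one_pow, hq.neg_one_pow] <;> module

/-- The case of `contract_wedgeLeft_succ` where the form has too low a degree to be contracted
with `P`. -/
theorem contract_wedgeLeft_top {p m : ℕ} (h : p + 1 + 0 = m + 1)
    (P : Polyvector k A A (p + 1)) (b : A) (ω : KForm k A m) :
    contract h P (wedgeLeft m (KaehlerDifferential.D k A b) ω) =
      -(-1 : ℤ) ^ (p + 1) • contract (by omega) (curryFirst P b) ω := by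
  suffices contract h P ∘ₗ wedgeLeft m (KaehlerDifferential.D k A b) =
      -(-1 : ℤ) ^ (p + 1) • contract (by omega) (curryFirst P b) from congrArg (fun F => F ω) this
  refine kForm_hom_ext fun f => ?_
  simp only [LinearMap.comp_apply, LinearMap.smul_apply, wedgeLeft_dForm, contract_dForm]
  have h3 : (wedge h P (dFormPolyvector k A 0)).1 (Matrix.vecCons b f) =
      (wedge (by omega) (curryFirst P b) (dFormPolyvector k A 0)).1 f :=
    congrArg (fun R => R.1 f) (curryFirst_wedge_succ_zero h P (dFormPolyvector k A 0) b)
  have h4 : (p + 1).choose 2 = p + p.choose 2 := by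
    rw [Nat.choose_succ_succ, Nat.choose_one_right]
  rw [h3, h4]
  rcases Nat.even_or_odd p with hp | hp <;> rcases Nat.even_or_odd (p.choose 2) with hq | hq <;>
    simp [pow_add, hp.neg_one_pow, hq.neg_one_pow] <;> module

theorem contract_add {p r m : ℕ} (h : p + r = m) (P Q : Polyvector k A A p) :
    contract h (P + Q) = contract h P + contract h Q := by
  refine kForm_hom_ext fun f => ?_
  rw [LinearMap.add_apply, contract_dForm, contract_dForm, contract_dForm, ← smul_add]
  congr 1
  refine eq_of_factorial_smul_eq k (p := p) (q := r) ?_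
  simp only [wedge, smul_add]
  rw [factorial_smul_shuffleProd, factorial_smul_shuffleProd, factorial_smul_shuffleProd, permSum,
    permSum, permSum, ← Finset.sum_add_distrib]
  refine Finset.sum_congr rfl fun τ _ => ?_
  simp

theorem contract_smul {p r m : ℕ} (h : p + r = m) (c : A) (P : Polyvector k A A p) :
    contract h (c • P) = c • contract h P := by
  refine kForm_hom_ext fun f => ?_
  rw [LinearMap.smul_apply, contract_dForm, contract_dForm, smul_comm c]
  congr 1
  refine eq_of_factorial_smul_eq k (p := p) (q := r) ?_
  rw [smul_comm _ c]
  simp only [wedge]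
  rw [factorial_smul_shuffleProd, factorial_smul_shuffleProd, permSum,
    permSum, Finset.smul_sum]
  refine Finset.sum_congr rfl fun τ _ => ?_
  rw [smul_comm c]
  simp

theorem jet_fst {p : ℕ} (ω : KForm k A p) : (jet k A p ω).1 = ω := by
  induction ω using kForm_induction with
  | zero => rw [map_zero]; rfl
  | add x y hx hy => rw [map_add, JetForm.add_fst, hx, hy]
  | smul a f => rw [map_smul, JetForm.smul_fst, jet_dForm_fst]

theorem deRham_smul {p : ℕ} (a : A) (ω : KForm k A p) :
    deRham k A p (a • ω) =
      a • deRham k A p ω + wedgeLeft p (KaehlerDifferential.D k A a) ω := by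
  change (jet k A p (a • ω)).2 = a • (jet k A p ω).2 + _
  rw [map_smul, JetForm.smul_snd, jet_fst]

theorem deRham_dForm {p : ℕ} (f : Fin p → A) : deRham k A p (dForm f) = 0 :=
  jet_dForm_snd f

theorem deRham_deRham {p : ℕ} (ω : KForm k A p) : deRham k A (p + 1) (deRham k A p ω) = 0 := by
  induction ω using kForm_induction with
  | zero => simp
  | add x y hx hy => rw [map_add, map_add, hx, hy, add_zero]
  | smul a f => rw [deRham_smul_dForm, deRham_dForm]

end Kaehler

/-! ### Operators on the total space of forms -/

section Total

variable {k A : Type*} [Field k] [CharZero k] [CommRing A] [Algebra k A] (I : FormRelations k A)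

namespace FormRelations

/-- The forms of degree `m`, with the instances sealed off: those of a quotient of an exterior
power are too large for the direct sum. -/
def DegreeForm (m : ℕ) : Type _ := I.Form m

instance (m : ℕ) : AddCommGroup (I.DegreeForm m) := inferInstanceAs (AddCommGroup (I.Form m))

instance (m : ℕ) : Module k (I.DegreeForm m) := inferInstanceAs (Module k (I.Form m))

instance (m : ℕ) : Module A (I.DegreeForm m) := inferInstanceAs (Module A (I.Form m))

instance (m : ℕ) : IsScalarTower k A (I.DegreeForm m) :=
  inferInstanceAs (IsScalarTower k A (I.Form m))

/-- The total space `Ω^• = ⨁_m Ω^m` of forms. -/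
def TotalForm : Type _ := DirectSum ℕ I.DegreeForm

instance : AddCommGroup I.TotalForm := inferInstanceAs (AddCommGroup (DirectSum ℕ I.DegreeForm))

instance : Module k I.TotalForm := inferInstanceAs (Module k (DirectSum ℕ I.DegreeForm))

instance : Module A I.TotalForm := inferInstanceAs (Module A (DirectSum ℕ I.DegreeForm))

instance : IsScalarTower k A I.TotalForm :=
  inferInstanceAs (IsScalarTower k A (DirectSum ℕ I.DegreeForm))

/-- A form of degree `m`, as an element of `Ω^•`. -/
def of (m : ℕ) : I.Form m →ₗ[k] I.TotalForm := DirectSum.lof k ℕ I.DegreeForm m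

/-- The linear map on `Ω^•` that is given by `F m` in degree `m`. -/
def lift {M : Type*} [AddCommGroup M] [Module k M] (F : ∀ m, I.Form m →ₗ[k] M) :
    I.TotalForm →ₗ[k] M := DirectSum.toModule k ℕ M (φ := fun m => (F m : I.DegreeForm m →ₗ[k] M))

theorem lift_of {M : Type*} [AddCommGroup M] [Module k M] (F : ∀ m, I.Form m →ₗ[k] M) (m : ℕ)
    (x : I.Form m) : I.lift F (I.of m x) = F m x :=
  DirectSum.toModule_lof (M := I.DegreeForm) k m x

theorem totalForm_add_induction {C : I.TotalForm → Prop} (x : I.TotalForm) (zero : C 0)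
    (add : ∀ x y, C x → C y → C (x + y)) (of : ∀ (m : ℕ) (x : I.Form m), C (I.of m x)) : C x :=
  DirectSum.induction_on (β := I.DegreeForm) x zero (fun m x => of m x) (fun x y => add x y)

/-- The form `1 ∈ Ω^0`. -/
def one : I.TotalForm := I.of 0 (Submodule.Quotient.mk (dForm ![]))

theorem d_mk {m : ℕ} (ω : KForm k A m) :
    I.d m (Submodule.Quotient.mk ω) = Submodule.Quotient.mk (deRham k A m ω) := rfl

theorem ι_mk {p r m : ℕ} (h : p + r = m) (P : Polyvector k A A p) (ω : KForm k A m) :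
    I.ι h P (Submodule.Quotient.mk ω) = Submodule.Quotient.mk (contract h P ω) := rfl

/-- The de Rham differential as a `k`-linear map. -/
def dLinear (m : ℕ) : I.Form m →ₗ[k] I.Form (m + 1) :=
  { I.d m with
    map_smul' := by
      intro c x
      induction x using Submodule.Quotient.induction_on with | _ ω
      exact congrArg Submodule.Quotient.mk ((deRham k A m).map_smul c ω) }

/-- The de Rham differential on `Ω^•`. -/
def dOp : Module.End k I.TotalForm :=
  I.lift fun m => I.of (m + 1) ∘ₗ I.dLinear m

/-- Multiplication by a function. -/
def mulOp (a : A) : Module.End k I.TotalForm := Algebra.lsmul k k I.TotalForm a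

/-- Left multiplication by the `1`-form `da`, as the commutator of `d` and `a`. -/
def eOp (a : A) : Module.End k I.TotalForm := I.dOp * I.mulOp a - I.mulOp a * I.dOp

/-- The contraction with a polyvector of degree `p`, as an operator on `Ω^•`; it is `0` on the forms
of degree less than `p`. -/
def iOp {p : ℕ} (P : Polyvector k A A p) : Module.End k I.TotalForm :=
  I.lift fun m =>
    if h : p ≤ m then I.of (m - p) ∘ₗ
      (I.ι (by omega : p + (m - p) = m) P).restrictScalars k else 0

theorem dOp_of {m : ℕ} (ω : I.Form m) : I.dOp (I.of m ω) = I.of (m + 1) (I.d m ω) := by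
  rw [dOp, lift_of]
  rfl

theorem mulOp_apply (a : A) (x : I.TotalForm) : I.mulOp a x = a • x := rfl

theorem mulOp_of (a : A) {m : ℕ} (ω : I.Form m) : I.mulOp a (I.of m ω) = I.of m (a • ω) :=
  ((DirectSum.lof A ℕ I.DegreeForm m).map_smul a ω).symm

theorem iOp_of {p r m : ℕ} (h : p + r = m) (P : Polyvector k A A p) (ω : I.Form m) :
    I.iOp P (I.of m ω) = I.of r (I.ι h P ω) := by
  subst h
  rw [iOp, lift_of, dif_pos (by omega)]
  have : ∀ (s : ℕ) (hs : s = r), I.of s (I.ι (by omega : p + s = p + r) P ω) =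
      I.of r (I.ι rfl P ω) := by
    rintro s rfl; rfl
  exact this _ (by omega)

theorem iOp_of_lt {p m : ℕ} (h : m < p) (P : Polyvector k A A p) (ω : I.Form m) :
    I.iOp P (I.of m ω) = 0 := by
  rw [iOp, lift_of, dif_neg (by omega)]
  rfl

theorem eOp_of (a : A) {m : ℕ} (ω : KForm k A m) :
    I.eOp a (I.of m (Submodule.Quotient.mk ω)) =
      I.of (m + 1) (Submodule.Quotient.mk (wedgeLeft m (KaehlerDifferential.D k A a) ω)) := by
  rw [eOp, LinearMap.sub_apply, Module.End.mul_apply, Module.End.mul_apply, mulOp_of, dOp_of,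
    dOp_of, mulOp_of, ← map_sub]
  congr 1
  rw [← Submodule.Quotient.mk_smul, d_mk, d_mk, ← Submodule.Quotient.mk_smul,
    ← Submodule.Quotient.mk_sub, deRham_smul, add_sub_cancel_left]

theorem totalForm_ext {F G : Module.End k I.TotalForm}
    (h : ∀ (m : ℕ) (ω : KForm k A m), F (I.of m (Submodule.Quotient.mk ω)) =
      G (I.of m (Submodule.Quotient.mk ω))) : F = G := by
  ext1 x
  refine I.totalForm_add_induction (C := fun x => F x = G x) x (by rw [map_zero, map_zero])
    (fun x y hx hy => by rw [map_add, map_add, hx, hy]) fun m x => ?_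
  induction x using Submodule.Quotient.induction_on with | _ ω
  exact h m ω

/-- `Ω^•` is generated by `1` under the multiplications by functions and exact `1`-forms. -/
theorem totalForm_induction {C : I.TotalForm → Prop} (x : I.TotalForm) (zero : C 0)
    (add : ∀ x y, C x → C y → C (x + y)) (one : C I.one) (mul : ∀ a x, C x → C (I.mulOp a x))
    (e : ∀ a x, C x → C (I.eOp a x)) : C x := by
  have h1 : ∀ (m : ℕ) (f : Fin m → A), C (I.of m (Submodule.Quotient.mk (dForm f))) := by
    intro m
    induction m with
    | zero =>
      intro f
      obtain rfl : f = ![] := Subsingleton.elim _ _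
      exact one
    | succ m ih =>
      intro f
      induction f using forall_vecCons with | _ a f
      rw [← wedgeLeft_dForm, ← eOp_of]
      exact e a _ (ih f)
  refine I.totalForm_add_induction x zero add fun m x => ?_
  induction x using Submodule.Quotient.induction_on with | _ ω
  induction ω using kForm_induction with
  | zero => rwa [Submodule.Quotient.mk_zero, map_zero]
  | add x y hx hy => rw [Submodule.Quotient.mk_add, map_add]; exact add _ _ hx hy
  | smul a f => rw [Submodule.Quotient.mk_smul, ← mulOp_of]; exact mul a _ (h1 m f)

theorem mulOp_iOp {p : ℕ} (a : A) (P : Polyvector k A A p) (x : I.TotalForm) :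
    I.iOp P (I.mulOp a x) = I.mulOp a (I.iOp P x) := by
  suffices I.iOp P * I.mulOp a = I.mulOp a * I.iOp P from LinearMap.congr_fun this x
  refine I.totalForm_ext fun m ω => ?_
  rw [Module.End.mul_apply, Module.End.mul_apply, mulOp_of]
  by_cases h : p ≤ m
  · have h' : p + (m - p) = m := by omega
    rw [iOp_of I h', iOp_of I h', mulOp_of, map_smul]
  · rw [iOp_of_lt I (by omega), iOp_of_lt I (by omega), map_zero]

theorem mulOp_eOp (a b : A) (x : I.TotalForm) :
    I.eOp b (I.mulOp a x) = I.mulOp a (I.eOp b x) := by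
  suffices I.eOp b * I.mulOp a = I.mulOp a * I.eOp b from LinearMap.congr_fun this x
  refine I.totalForm_ext fun m ω => ?_
  rw [Module.End.mul_apply, Module.End.mul_apply, mulOp_of, ← Submodule.Quotient.mk_smul, eOp_of,
    eOp_of, mulOp_of, ← Submodule.Quotient.mk_smul, map_smul]

theorem mulOp_mulOp (a b : A) (x : I.TotalForm) :
    I.mulOp a (I.mulOp b x) = I.mulOp b (I.mulOp a x) := by
  simp only [mulOp_apply, smul_comm a b]

theorem dOp_mulOp (a : A) (x : I.TotalForm) :
    I.dOp (I.mulOp a x) = I.mulOp a (I.dOp x) + I.eOp a x := by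
  simp [eOp]

theorem dOp_dOp (x : I.TotalForm) : I.dOp (I.dOp x) = 0 := by
  suffices I.dOp * I.dOp = 0 from LinearMap.congr_fun this x
  refine I.totalForm_ext fun m ω => ?_
  rw [Module.End.mul_apply, dOp_of, d_mk, dOp_of, d_mk, deRham_deRham, Submodule.Quotient.mk_zero,
    map_zero]
  rfl

theorem dOp_eOp (a : A) (x : I.TotalForm) : I.dOp (I.eOp a x) = -I.eOp a (I.dOp x) := by
  simp [eOp, dOp_dOp]

theorem dOp_one : I.dOp I.one = 0 := by
  rw [one, dOp_of, d_mk, deRham_dForm, Submodule.Quotient.mk_zero, map_zero]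

theorem iOp_zero_deg (P : Polyvector k A A 0) : I.iOp P = I.mulOp (P.1 ![]) := by
  refine I.totalForm_ext fun m ω => ?_
  rw [iOp_of I (zero_add m), ι_mk, contract_zero, mulOp_of]
  rfl

theorem iOp_one {p : ℕ} (P : Polyvector k A A (p + 1)) : I.iOp P I.one = 0 :=
  I.iOp_of_lt (by omega) P _

/-- The contraction with `P(a, -)`; it is `0` when `P` has degree `0`. -/
def innerOp (a : A) : {p : ℕ} → Polyvector k A A p → Module.End k I.TotalForm
  | 0, _ => 0
  | _ + 1, P => I.iOp (curryFirst P a)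

/-- The graded commutator of `da ∧ -` and `ι_P` is the contraction with `P(a, -)`, up to sign. -/
theorem iOp_eOp {p : ℕ} (P : Polyvector k A A p) (a : A) (x : I.TotalForm) :
    I.iOp P (I.eOp a x) = (-1 : ℤ) ^ p • (I.eOp a (I.iOp P x) - I.innerOp a P x) := by
  suffices I.iOp P * I.eOp a = (-1 : ℤ) ^ p • (I.eOp a * I.iOp P - I.innerOp a P) from
    LinearMap.congr_fun this x
  rcases p with _ | p
  · rw [iOp_zero_deg, pow_zero, one_smul, innerOp, sub_zero]
    ext1 x
    exact (I.mulOp_eOp _ _ _).symm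
  refine I.totalForm_ext fun m ω => ?_
  simp only [Module.End.mul_apply, LinearMap.smul_apply, LinearMap.sub_apply, innerOp]
  rw [eOp_of]
  by_cases h : p + 1 ≤ m
  · obtain ⟨r, rfl⟩ := Nat.exists_eq_add_of_le h
    rw [iOp_of I (r := r + 1) (by omega), iOp_of I (r := r) (by omega),
      iOp_of I (r := r + 1) (by omega), ι_mk, ι_mk, ι_mk, eOp_of, contract_wedgeLeft_succ,
      ← map_sub, ← map_zsmul]
    rfl
  · rw [iOp_of_lt I (p := p + 1) (m := m) (by omega), map_zero, zero_sub]
    by_cases h' : p = m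
    · subst h'
      rw [iOp_of I (r := 0) (by omega), iOp_of I (r := 0) (by omega), ι_mk, ι_mk,
        contract_wedgeLeft_top, neg_smul, smul_neg, ← map_zsmul (I.of 0), ← map_neg]
      rfl
    · rw [iOp_of_lt I (by omega), iOp_of_lt I (by omega), neg_zero, smul_zero]

theorem iOp_add {p : ℕ} (P Q : Polyvector k A A p) : I.iOp (P + Q) = I.iOp P + I.iOp Q := by
  refine I.totalForm_ext fun m ω => ?_
  rw [LinearMap.add_apply]
  by_cases h : p ≤ m
  · have h' : p + (m - p) = m := by omega
    rw [iOp_of I h', iOp_of I h', iOp_of I h', ι_mk, ι_mk, ι_mk, contract_add, ← map_add]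
    rfl
  · rw [iOp_of_lt I (by omega), iOp_of_lt I (by omega), iOp_of_lt I (by omega), add_zero]

theorem iOp_smul {p : ℕ} (c : A) (P : Polyvector k A A p) (x : I.TotalForm) :
    I.iOp (c • P) x = I.mulOp c (I.iOp P x) := by
  suffices I.iOp (c • P) = I.mulOp c * I.iOp P from LinearMap.congr_fun this x
  refine I.totalForm_ext fun m ω => ?_
  rw [Module.End.mul_apply]
  by_cases h : p ≤ m
  · have h' : p + (m - p) = m := by omega
    rw [iOp_of I h', iOp_of I h', ι_mk, ι_mk, contract_smul, mulOp_of]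
    rfl
  · rw [iOp_of_lt I (by omega), iOp_of_lt I (by omega), map_zero]

end FormRelations

end Total

/-! ### Cartan calculus -/

section Cartan

theorem curryFirst_curryFirst {k A : Type*} [Field k] [CommRing A] [Algebra k A] {p : ℕ}
    (P : Polyvector k A A (p + 2)) (a b : A) :
    curryFirst (curryFirst P a) b = -curryFirst (curryFirst P b) a := by
  ext f
  exact map_vecCons_swap P.1 a b f

variable {k A : Type*} [Field k] [CharZero k] [CommRing A] [Algebra k A] (I : FormRelations k A)

/-- The Schouten bracket of polyvectors, as a polyvector. -/
def schoutenPolyvector {p q m : ℕ} (h : p + q = m + 1) (P : Polyvector k A A p)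
    (Q : Polyvector k A A q) : Polyvector k A A m :=
  ⟨schouten h P.1 Q.1, schouten_mem h P.2 Q.2⟩

theorem curryFirst_zsmul {k A : Type*} [Field k] [CommRing A] [Algebra k A] {p : ℕ} (c : ℤ)
    (P : Polyvector k A A (p + 1)) (a : A) : curryFirst (c • P) a = c • curryFirst P a := rfl

theorem curryFirst_neg {k A : Type*} [Field k] [CommRing A] [Algebra k A] {p : ℕ}
    (P : Polyvector k A A (p + 1)) (a : A) : curryFirst (-P) a = -curryFirst P a := rfl

namespace FormRelations

theorem iOp_neg {p : ℕ} (P : Polyvector k A A p) : I.iOp (-P) = -I.iOp P :=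
  map_neg (AddMonoidHom.mk' (fun P : Polyvector k A A p => I.iOp P) fun P Q => I.iOp_add P Q) P

theorem iOp_zsmul {p : ℕ} (c : ℤ) (P : Polyvector k A A p) : I.iOp (c • P) = c • I.iOp P :=
  map_zsmul (AddMonoidHom.mk' (fun P : Polyvector k A A p => I.iOp P) fun P Q => I.iOp_add P Q) c P

/-- The contraction with a wedge product is the composition of the contractions: both sides have the
same commutation relations with the multiplications by functions and by exact `1`-forms, which
generate all forms from `1`. -/
theorem iOp_wedge {p q m : ℕ} (h : p + q = m) (P : Polyvector k A A p) (Q : Polyvector k A A q)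
    (x : I.TotalForm) : I.iOp (wedge h P Q) x = I.iOp P (I.iOp Q x) := by
  induction x using totalForm_induction generalizing p q m with
  | zero => simp only [map_zero]
  | add x y hx hy => simp only [map_add, hx, hy]
  | one =>
    rcases q with _ | q
    · rcases p with _ | p
      · obtain rfl : m = 0 := by omega
        rw [iOp_zero_deg, iOp_zero_deg, iOp_zero_deg, wedge_zero_zero]
        simp only [mulOp_apply, smul_eq_mul, mul_smul]
      · obtain rfl : m = p + 1 := by omega
        rw [iOp_zero_deg I Q, mulOp_iOp, iOp_one, iOp_one, map_zero]
    · obtain rfl : m = p + q + 1 := by omega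
      rw [iOp_one, iOp_one, map_zero]
  | mul a x ih => rw [mulOp_iOp, mulOp_iOp, mulOp_iOp, ih]
  | e a x ih =>
    have hc : I.innerOp a (wedge h P Q) x =
        I.innerOp a P (I.iOp Q x) + (-1 : ℤ) ^ p • I.iOp P (I.innerOp a Q x) := by
      rcases p with _ | p <;> rcases q with _ | q
      · obtain rfl : m = 0 := by omega
        simp [innerOp]
      · obtain rfl : m = q + 1 := by omega
        simp only [innerOp, curryFirst_wedge_zero_succ, ih]
        simp
      · obtain rfl : m = p + 1 := by omega
        simp only [innerOp, curryFirst_wedge_succ_zero, ih]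
        simp
      · obtain rfl : m = p + q + 1 + 1 := by omega
        simp only [innerOp, curryFirst_wedge_succ_succ, iOp_add, iOp_zsmul, LinearMap.add_apply,
          LinearMap.smul_apply, ih]
    subst h
    simp only [iOp_eOp, ih, hc, map_zsmul, map_sub]
    rcases Nat.even_or_odd p with hp | hp <;> rcases Nat.even_or_odd q with hq | hq <;>
      simp only [pow_add, hp.neg_one_pow, hq.neg_one_pow] <;> module

theorem iOp_comm {p q : ℕ} (P : Polyvector k A A p) (Q : Polyvector k A A q)
    (x : I.TotalForm) : I.iOp P (I.iOp Q x) = (-1 : ℤ) ^ (p * q) • I.iOp Q (I.iOp P x) := by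
  induction x using totalForm_induction generalizing p q with
  | zero => simp only [map_zero, smul_zero]
  | add x y hx hy => simp only [map_add, smul_add]; rw [hx, hy]
  | one =>
    rcases q with _ | q <;> rcases p with _ | p
    · rw [iOp_zero_deg, iOp_zero_deg, mulOp_mulOp]
      simp
    · rw [iOp_zero_deg, mulOp_iOp]
      simp [iOp_one]
    · rw [iOp_zero_deg, mulOp_iOp]
      simp [iOp_one]
    · simp [iOp_one]
  | mul a x ih => rw [mulOp_iOp, mulOp_iOp, mulOp_iOp, mulOp_iOp, ih, map_zsmul]
  | e a x ih =>
    have hP : I.innerOp a P (I.iOp Q x) = (-1 : ℤ) ^ (p * q + q) • I.iOp Q (I.innerOp a P x) := by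
      rcases p with _ | p
      · simp [innerOp]
      · simp only [innerOp]
        rw [ih, show (p + 1) * q + q = p * q + 2 * q by ring, pow_add, pow_mul (-1 : ℤ) 2]
        simp
    have hQ : I.iOp P (I.innerOp a Q x) = (-1 : ℤ) ^ (p * q + p) • I.innerOp a Q (I.iOp P x) := by
      rcases q with _ | q
      · simp [innerOp]
      · simp only [innerOp]
        rw [ih, show p * (q + 1) + p = p * q + 2 * p by ring, pow_add, pow_mul (-1 : ℤ) 2]
        simp
    simp only [iOp_eOp, map_zsmul, map_sub, hP, hQ]
    rw [ih]
    rcases Nat.even_or_odd p with hp | hp <;> rcases Nat.even_or_odd q with hq | hq <;>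
      simp only [pow_add, pow_mul, hp.neg_one_pow, hq.neg_one_pow, map_zsmul, one_pow] <;> module

theorem innerOp_iOp {p q : ℕ} (a : A) (P : Polyvector k A A p) (Q : Polyvector k A A q)
    (x : I.TotalForm) :
    I.innerOp a P (I.iOp Q x) = (-1 : ℤ) ^ (p * q + q) • I.iOp Q (I.innerOp a P x) := by
  rcases p with _ | p
  · simp [innerOp]
  · simp only [innerOp]
    rw [iOp_comm, show (p + 1) * q + q = p * q + 2 * q by ring, pow_add, pow_mul (-1 : ℤ) 2]
    simp

/-- The Lie derivative `[ι_P, d]` of forms along a polyvector (a graded commutator). -/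
def lieOp {p : ℕ} (P : Polyvector k A A p) : Module.End k I.TotalForm :=
  I.iOp P * I.dOp - (-1 : ℤ) ^ p • (I.dOp * I.iOp P)

theorem lieOp_apply {p : ℕ} (P : Polyvector k A A p) (x : I.TotalForm) :
    I.lieOp P x = I.iOp P (I.dOp x) - (-1 : ℤ) ^ p • I.dOp (I.iOp P x) := rfl

theorem lieOp_mulOp {p : ℕ} (P : Polyvector k A A p) (a : A) (x : I.TotalForm) :
    I.lieOp P (I.mulOp a x) = I.mulOp a (I.lieOp P x) - (-1 : ℤ) ^ p • I.innerOp a P x := by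
  simp only [lieOp_apply, dOp_mulOp, map_add, mulOp_iOp, iOp_eOp, map_sub, map_zsmul]
  module

/-- The Lie derivative along `P(a, -)`; it is `0` when `P` has degree `0`. -/
def lieInnerOp {p : ℕ} (a : A) (P : Polyvector k A A p) : Module.End k I.TotalForm :=
  I.innerOp a P * I.dOp + (-1 : ℤ) ^ p • (I.dOp * I.innerOp a P)

theorem lieInnerOp_apply {p : ℕ} (a : A) (P : Polyvector k A A p) (x : I.TotalForm) :
    I.lieInnerOp a P x = I.innerOp a P (I.dOp x) + (-1 : ℤ) ^ p • I.dOp (I.innerOp a P x) := rfl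

theorem lieInnerOp_zero (a : A) (P : Polyvector k A A 0) : I.lieInnerOp a P = 0 := by
  simp [lieInnerOp, innerOp]

theorem lieInnerOp_succ {p : ℕ} (a : A) (P : Polyvector k A A (p + 1)) :
    I.lieInnerOp a P = I.lieOp (curryFirst P a) := by
  ext1 x
  rw [lieInnerOp_apply, lieOp_apply, innerOp, pow_succ]
  module

theorem lieOp_eOp {p : ℕ} (P : Polyvector k A A p) (a : A) (x : I.TotalForm) :
    I.lieOp P (I.eOp a x) = (-1 : ℤ) ^ p • (I.lieInnerOp a P x - I.eOp a (I.lieOp P x)) := by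
  simp only [lieOp_apply, lieInnerOp_apply, iOp_eOp, map_sub, map_zsmul, dOp_eOp, map_neg]
  rcases Nat.even_or_odd p with hp | hp <;> simp only [hp.neg_one_pow] <;> module

theorem lieOp_one {p : ℕ} (P : Polyvector k A A (p + 1)) : I.lieOp P I.one = 0 := by
  rw [lieOp_apply, dOp_one, iOp_one, map_zero, map_zero, smul_zero, sub_zero]

/-- The graded commutator of a Lie derivative and a contraction. -/
def lieBracketOp {p q : ℕ} (P : Polyvector k A A p) (Q : Polyvector k A A q) :
    Module.End k I.TotalForm :=
  I.lieOp P * I.iOp Q - (-1 : ℤ) ^ ((p + 1) * q) • (I.iOp Q * I.lieOp P)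

theorem lieBracketOp_apply {p q : ℕ} (P : Polyvector k A A p) (Q : Polyvector k A A q)
    (x : I.TotalForm) : I.lieBracketOp P Q x =
      I.lieOp P (I.iOp Q x) - (-1 : ℤ) ^ ((p + 1) * q) • I.iOp Q (I.lieOp P x) := rfl

theorem lieOp_zero_deg (P : Polyvector k A A 0) (x : I.TotalForm) :
    I.lieOp P x = -I.eOp (P.1 ![]) x := by
  rw [lieOp_apply, iOp_zero_deg, dOp_mulOp]
  simp

theorem lieBracketOp_zero_zero (P Q : Polyvector k A A 0) (x : I.TotalForm) :
    I.lieBracketOp P Q x = 0 := by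
  simp [lieBracketOp_apply, lieOp_zero_deg, iOp_zero_deg, mulOp_eOp]

/-- The Cartan formula `[[ι_P, d], ι_Q] = ι_[P, Q]`. As for `iOp_wedge`, it is enough to compare the
commutation relations of both sides with the multiplications by functions and exact `1`-forms. -/
theorem iOp_schouten {p q m : ℕ} (h : p + q = m + 1) (P : Polyvector k A A p)
    (Q : Polyvector k A A q) (x : I.TotalForm) :
    I.iOp (schoutenPolyvector h P Q) x = I.lieBracketOp P Q x := by
  have h0l : ∀ {q : ℕ} (h : 0 + (q + 1) = q + 1) (P : Polyvector k A A 0)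
      (Q : Polyvector k A A (q + 1)), schoutenPolyvector h P Q = -curryFirst Q (P.1 ![]) := by
    intro q h P Q; ext1; exact schouten_zero_left h P.1 Q.1
  have h0r : ∀ {p : ℕ} (h : (p + 1) + 0 = p + 1) (P : Polyvector k A A (p + 1))
      (Q : Polyvector k A A 0),
      schoutenPolyvector h P Q = (-1 : ℤ) ^ p • curryFirst P (Q.1 ![]) := by
    intro p h P Q; ext1; exact schouten_zero_right h P.1 Q.1
  induction x using totalForm_induction generalizing p q m with
  | zero => simp only [map_zero]
  | add x y hx hy => simp only [map_add, hx, hy]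
  | one =>
    rcases p with _ | p <;> rcases q with _ | q
    · omega
    · obtain rfl : m = q := by omega
      rw [h0l, lieBracketOp_apply, iOp_one, map_zero, lieOp_zero_deg, map_neg, iOp_eOp,
        iOp_one, iOp_neg]
      rcases Nat.even_or_odd m with hm | hm <;> simp [pow_succ, hm.neg_one_pow, innerOp]
    · obtain rfl : m = p := by omega
      rw [h0r, lieBracketOp_apply, lieOp_one, iOp_zero_deg I Q, lieOp_mulOp, lieOp_one, iOp_zsmul]
      rw [LinearMap.smul_apply]
      simp [pow_succ, innerOp]
    · obtain rfl : m = p + q + 1 := by omega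
      rw [iOp_one, lieBracketOp_apply, iOp_one, lieOp_one]
      simp
  | mul a x ih =>
    rw [mulOp_iOp, ih, lieBracketOp_apply, lieBracketOp_apply, mulOp_iOp, lieOp_mulOp,
      lieOp_mulOp, innerOp_iOp]
    simp only [map_sub, map_zsmul, mulOp_iOp]
    rcases Nat.even_or_odd p with hp | hp <;> rcases Nat.even_or_odd q with hq | hq <;>
      simp only [pow_add, pow_mul, hp.neg_one_pow, hq.neg_one_pow, one_pow, pow_succ,
        mul_neg, neg_neg, mul_one] <;> module
  | e a x ih =>
    -- Contraction with `a` is a derivation of the bracket, so the induction hypothesis applies.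
    have hc : I.innerOp a (schoutenPolyvector h P Q) x =
        (I.lieInnerOp a P (I.iOp Q x) - (-1 : ℤ) ^ (p * q) • I.iOp Q (I.lieInnerOp a P x)) -
        (-1 : ℤ) ^ p • (I.lieOp P (I.innerOp a Q x) +
          (-1 : ℤ) ^ (p * q + p + q) • I.innerOp a Q (I.lieOp P x)) := by
      rcases p with _ | p <;> rcases q with _ | q
      · omega
      · obtain rfl : m = q := by omega
        have h1 := I.lieBracketOp_zero_zero P
        rcases m with _ | m
        · have h2 := h1 (curryFirst Q a) x
          rw [lieBracketOp_apply] at h2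
          simp only [innerOp, lieInnerOp_zero]
          linear_combination (norm := skip) h2
          simp
          abel
        · have h2 := ih (by omega : 0 + (m + 1) = m + 1) P (curryFirst Q a)
          rw [h0l, lieBracketOp_apply, curryFirst_curryFirst, iOp_neg, iOp_neg] at h2
          rw [h0l]
          simp only [innerOp, lieInnerOp_zero, curryFirst_neg, iOp_neg]
          linear_combination (norm := skip) -h2
          rcases Nat.even_or_odd m with hm | hm
          · simp [pow_succ, hm.neg_one_pow]
          · simp [pow_succ, hm.neg_one_pow]
            module
      · obtain rfl : m = p := by omega
        rcases m with _ | m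
        · have h2 := I.lieBracketOp_zero_zero (curryFirst P a) Q x
          rw [lieBracketOp_apply] at h2
          simp only [innerOp, lieInnerOp_succ]
          linear_combination (norm := skip) -h2
          simp
        · have h2 := ih (by omega : m + 1 + 0 = m + 1) (curryFirst P a) Q
          rw [h0r, lieBracketOp_apply, curryFirst_curryFirst, iOp_zsmul, iOp_neg] at h2
          rw [h0r]
          simp only [innerOp, lieInnerOp_succ, curryFirst_zsmul, iOp_zsmul]
          linear_combination (norm := skip) h2
          rcases Nat.even_or_odd m with hm | hm <;>
            (simp [pow_succ, hm.neg_one_pow]; module)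
      · obtain rfl : m = p + q + 1 := by omega
        have h1 : curryFirst (schoutenPolyvector h P Q) a =
            schoutenPolyvector (by omega) (curryFirst P a) Q +
              (-1 : ℤ) ^ p • schoutenPolyvector (by omega) P (curryFirst Q a) := by
          ext1
          exact schouten_curryLeft_succ_succ h P.1 Q.1 a
        simp only [innerOp, lieInnerOp_succ, h1, iOp_add, iOp_zsmul, LinearMap.add_apply,
          LinearMap.smul_apply, ih, lieBracketOp_apply]
        rcases Nat.even_or_odd p with hp | hp <;> rcases Nat.even_or_odd q with hq | hq <;>
          simp only [pow_add, pow_mul, hp.neg_one_pow, hq.neg_one_pow, one_pow, pow_one,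
            mul_neg, neg_neg, mul_one] <;> module
    have hm : (-1 : ℤ) ^ m = -(-1) ^ (p + q) := by rw [h, pow_succ]; simp
    simp only [lieBracketOp_apply, iOp_eOp, lieOp_eOp, ih, hc, map_zsmul, map_sub, hm]
    rcases Nat.even_or_odd p with hp | hp <;> rcases Nat.even_or_odd q with hq | hq <;>
      simp only [pow_add, pow_mul, hp.neg_one_pow, hq.neg_one_pow, one_pow, pow_one,
        mul_neg, neg_neg, mul_one] <;> module

end FormRelations

end Cartan

/-! ### Graded families of contractions -/

section Graded

theorem negOnePow_mul_of_even {i : ℤ} (hi : Even i) (j : ℤ) : (i * j).negOnePow = 1 :=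
  Int.negOnePow_even _ (hi.mul_right j)

theorem negOnePow_mul_of_odd {i : ℤ} (hi : Odd i) (j : ℤ) : (i * j).negOnePow = j.negOnePow := by
  obtain ⟨l, rfl⟩ := hi
  rw [show (2 * l + 1) * j = 2 * (l * j) + j by ring, Int.negOnePow_add, Int.negOnePow_two_mul,
    one_mul]

theorem natCast_negOnePow_smul {M : Type*} [AddCommGroup M] (p : ℕ) (x : M) :
    (p : ℤ).negOnePow • x = (-1 : ℤ) ^ p • x := by
  rcases Nat.even_or_odd p with hp | hp
  · rw [Int.negOnePow_even _ (by exact_mod_cast hp), hp.neg_one_pow, one_smul, one_smul]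
  · rw [Int.negOnePow_odd _ (by exact_mod_cast hp), hp.neg_one_pow, Units.neg_smul, neg_smul,
      one_smul, one_smul]

variable {k A : Type*} [Field k] [CharZero k] [CommRing A] [Algebra k A] (I : FormRelations k A)

namespace FormRelations

/-- The contractions with polyvectors of degree `p`, as a `k`-linear map. -/
def iOpLinear (p : ℕ) : Polyvector k A A p →ₗ[k] Module.End k I.TotalForm where
  toFun P := I.iOp P
  map_add' := I.iOp_add
  map_smul' c P := by
    ext1 x
    rw [← algebraMap_smul A c P, iOp_smul, mulOp_apply, algebraMap_smul]
    rfl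

/-- The space of contractions with polyvectors of degree `i`; it is `0` for `i < 0`. -/
def contractions : ℤ → Submodule k (Module.End k I.TotalForm)
  | Int.ofNat p => LinearMap.range (I.iOpLinear p)
  | Int.negSucc _ => ⊥

theorem iOp_mem {p : ℕ} (P : Polyvector k A A p) : I.iOp P ∈ I.contractions p :=
  LinearMap.mem_range_self (I.iOpLinear p) P

variable {I}

theorem exists_of_mem_contractions {i : ℤ} {X : Module.End k I.TotalForm}
    (hX : X ∈ I.contractions i) :
    (∃ (p : ℕ) (P : Polyvector k A A p), i = p ∧ X = I.iOp P) ∨ X = 0 := by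
  rcases i with p | p
  · obtain ⟨P, rfl⟩ := hX
    exact Or.inl ⟨p, P, rfl, rfl⟩
  · exact Or.inr hX

theorem mul_mem_contractions {i j : ℤ} {X Y : Module.End k I.TotalForm}
    (hX : X ∈ I.contractions i) (hY : Y ∈ I.contractions j) : X * Y ∈ I.contractions (i + j) := by
  rcases exists_of_mem_contractions hX with ⟨p, P, rfl, rfl⟩ | rfl
  · rcases exists_of_mem_contractions hY with ⟨q, Q, rfl, rfl⟩ | rfl
    · have h : I.iOp P * I.iOp Q = I.iOp (wedge rfl P Q) := by
        ext1 x; exact (I.iOp_wedge rfl P Q x).symm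
      rw [h]
      exact I.iOp_mem _
    · rw [mul_zero]; exact zero_mem _
  · rw [zero_mul]; exact zero_mem _

theorem contractions_comm {i j : ℤ} {X Y : Module.End k I.TotalForm}
    (hX : X ∈ I.contractions i) (hY : Y ∈ I.contractions j) (x : I.TotalForm) :
    X (Y x) = (i * j).negOnePow • Y (X x) := by
  rcases exists_of_mem_contractions hX with ⟨p, P, rfl, rfl⟩ | rfl
  · rcases exists_of_mem_contractions hY with ⟨q, Q, rfl, rfl⟩ | rfl
    · rw [I.iOp_comm, ← Nat.cast_mul, natCast_negOnePow_smul]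
    · simp
  · simp

variable (I) in
/-- The graded commutator `[X, d]` for an operator `X` of degree `i`. -/
def lieE (i : ℤ) (X : Module.End k I.TotalForm) : Module.End k I.TotalForm :=
  X * I.dOp - i.negOnePow • (I.dOp * X)

theorem lieE_apply (i : ℤ) (X : Module.End k I.TotalForm) (x : I.TotalForm) :
    I.lieE i X x = X (I.dOp x) - i.negOnePow • I.dOp (X x) := rfl

variable (I) in
/-- The derived bracket `[[X, d], Y]` of operators `X`, `Y` of degrees `i`, `j`. -/
def brE (i j : ℤ) (X Y : Module.End k I.TotalForm) : Module.End k I.TotalForm :=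
  I.lieE i X * Y - ((i + 1) * j).negOnePow • (Y * I.lieE i X)

theorem brE_apply (i j : ℤ) (X Y : Module.End k I.TotalForm) (x : I.TotalForm) :
    I.brE i j X Y x = I.lieE i X (Y x) - ((i + 1) * j).negOnePow • Y (I.lieE i X x) := rfl

theorem lieE_iOp {p : ℕ} (P : Polyvector k A A p) : I.lieE p (I.iOp P) = I.lieOp P := by
  rw [lieE, lieOp, natCast_negOnePow_smul]

theorem brE_iOp {p q : ℕ} (P : Polyvector k A A p) (Q : Polyvector k A A q) :
    I.brE p q (I.iOp P) (I.iOp Q) = I.lieBracketOp P Q := by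
  rw [brE, lieBracketOp, lieE_iOp]
  rw [show ((p : ℤ) + 1) * q = (((p + 1) * q : ℕ) : ℤ) by push_cast; ring,
    natCast_negOnePow_smul]

theorem brE_iOp_eq_schouten {p q m : ℕ} (h : p + q = m + 1) (P : Polyvector k A A p)
    (Q : Polyvector k A A q) :
    I.brE p q (I.iOp P) (I.iOp Q) = I.iOp (schoutenPolyvector h P Q) := by
  ext1 x
  rw [brE_iOp, iOp_schouten]

theorem brE_mem {i j : ℤ} {X Y : Module.End k I.TotalForm}
    (hX : X ∈ I.contractions i) (hY : Y ∈ I.contractions j) :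
    I.brE i j X Y ∈ I.contractions (i + j - 1) := by
  rcases exists_of_mem_contractions hX with ⟨p, P, rfl, rfl⟩ | rfl
  · rcases exists_of_mem_contractions hY with ⟨q, Q, rfl, rfl⟩ | rfl
    · rcases Nat.eq_zero_or_pos (p + q) with h | h
      · obtain rfl : p = 0 := by omega
        obtain rfl : q = 0 := by omega
        have : I.brE (0 : ℕ) (0 : ℕ) (I.iOp P) (I.iOp Q) = 0 := by
          ext1 x
          rw [brE_iOp, lieBracketOp_zero_zero]
          rfl
        rw [this]
        exact zero_mem _
      · have h' : p + q = (p + q - 1) + 1 := by omega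
        rw [brE_iOp_eq_schouten h', show ((p : ℤ) + q - 1) = ((p + q - 1 : ℕ) : ℤ) by omega]
        exact I.iOp_mem _
    · simp [brE]
  · simp [brE, lieE]

end FormRelations

end Graded

/-! ### The complex of forms that computes Poisson cohomology -/

section Volume

variable {k A : Type*} [Field k] [CharZero k] [CommRing A] [Algebra k A] {I : FormRelations k A}
  {n : ℕ} {η : I.Form n} (hη : I.IsVolumeForm η) (π : PoissonStructure k A)

namespace FormRelations

theorem of_injective (m : ℕ) : Function.Injective (I.of m) :=
  DirectSum.of_injective (β := I.DegreeForm) m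

namespace IsVolumeForm

section

include hη

theorem eq_zero_of_iOp_eq_zero {p : ℕ} (P : Polyvector k A A p) (h : I.iOp P (I.of n η) = 0) :
    P = 0 := by
  by_cases hp : p ≤ n
  · have h' : p + (n - p) = n := by omega
    rw [iOp_of I h', ← map_zero (I.of _)] at h
    refine (hη.bijective h').injective ?_
    refine (of_injective _ h).trans ?_
    have h0 := I.iOp_of h' (0 : Polyvector k A A p) η
    rw [show I.iOp (0 : Polyvector k A A p) = 0 from map_zero (I.iOpLinear p)] at h0
    exact of_injective _ ((map_zero _).trans h0)
  · exact hη.polyvector_eq_zero (by omega) P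

/-- Contractions are determined by their value on the volume form. -/
theorem contractions_ext {i : ℤ} {X Y : Module.End k I.TotalForm} (hX : X ∈ I.contractions i)
    (hY : Y ∈ I.contractions i) (h : X (I.of n η) = Y (I.of n η)) : X = Y := by
  rw [← sub_eq_zero]
  have h1 : (X - Y) (I.of n η) = 0 := by rw [LinearMap.sub_apply, h, sub_self]
  rcases exists_of_mem_contractions (sub_mem hX hY) with ⟨p, P, rfl, hP⟩ | h0
  · rw [hP] at h1 ⊢
    rw [hη.eq_zero_of_iOp_eq_zero P h1]
    exact map_zero (I.iOpLinear p)
  · exact h0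

/-- Every form of degree `r` is the contraction of the volume form with a polyvector of degree
`n - r`. -/
theorem exists_contraction {r : ℕ} (ω : I.Form r) :
    ∃ X ∈ I.contractions (n - r), X (I.of n η) = I.of r ω := by
  by_cases hr : r ≤ n
  · have h' : (n - r) + r = n := by omega
    obtain ⟨P, hP⟩ := (hη.bijective h').surjective ω
    refine ⟨I.iOp P, ?_, ?_⟩
    · rw [show ((n : ℤ) - r) = ((n - r : ℕ) : ℤ) by omega]
      exact I.iOp_mem P
    · rw [iOp_of I h']
      exact congrArg _ hP
  · refine ⟨0, zero_mem _, ?_⟩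
    rw [hη.form_eq_zero (by omega) ω, map_zero]
    rfl

theorem dOp_volume : I.dOp (I.of n η) = 0 := by
  rw [dOp_of, hη.form_eq_zero (by omega) (I.d n η), map_zero]

/-- The contraction of the volume form with a polyvector of degree `i` has degree `n - i`. -/
theorem exists_form {i : ℤ} {X : Module.End k I.TotalForm} (hX : X ∈ I.contractions i) :
    (∃ (r : ℕ) (ω : I.Form r), (r : ℤ) = n - i ∧ X (I.of n η) = I.of r ω) ∨ X = 0 := by
  rcases exists_of_mem_contractions hX with ⟨p, P, rfl, rfl⟩ | h0
  · by_cases hp : p ≤ n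
    · exact Or.inl ⟨n - p, _, by omega, iOp_of I (by omega : p + (n - p) = n) P η⟩
    · right
      rw [hη.polyvector_eq_zero (by omega) P]
      exact map_zero (I.iOpLinear p)
  · exact Or.inr h0

/-- The divergence of a polyvector, as an operator. -/
theorem exists_divergence {i : ℤ} {X : Module.End k I.TotalForm} (hX : X ∈ I.contractions i) :
    ∃ Y ∈ I.contractions (i - 1), Y (I.of n η) = I.dOp (X (I.of n η)) := by
  rcases hη.exists_form hX with ⟨r, ω, hr, h⟩ | rfl
  · obtain ⟨Y, hY, hY'⟩ := hη.exists_contraction (I.d r ω)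
    refine ⟨Y, ?_, by rw [hY', h, dOp_of]⟩
    rwa [show i - 1 = n - ((r + 1 : ℕ) : ℤ) by push_cast; omega]
  · exact ⟨0, zero_mem _, by simp⟩

end

/-- The contraction with the modular vector. -/
def modularOp : Module.End k I.TotalForm := I.iOp (hη.modularVector π)

theorem modularOp_mem : hη.modularOp π ∈ I.contractions 1 := I.iOp_mem _

variable (I) in
/-- The Lie derivative of forms along the Poisson bivector. -/
def _root_.PoissonBV.FormRelations.bivectorLieOp : Module.End k I.TotalForm := I.lieOp π.bivector

theorem bivector_mem : I.iOp π.bivector ∈ I.contractions 2 := I.iOp_mem _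

theorem lieE_bivector : I.lieE 2 (I.iOp π.bivector) = I.bivectorLieOp π := lieE_iOp _

/-- Here the divergence of `π` enters: `L_π η = -d ι_π η = ι_ν η`. -/
theorem bivectorLieOp_volume : I.bivectorLieOp π (I.of n η) = hη.modularOp π (I.of n η) := by
  rw [bivectorLieOp, lieOp_apply, hη.dOp_volume, modularOp, modularVector, iOp_neg]
  by_cases h : 2 ≤ n
  · have h1 := hη.ι_divergence (by omega : (1 + 1) + (n - 2) = n) π.bivector
    rw [iOp_of I (by omega : 2 + (n - 2) = n), dOp_of, LinearMap.neg_apply,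
      iOp_of I (by omega : 1 + (n - 2 + 1) = n)]
    erw [h1]
    simp
  -- For `n < 2` there is no bivector other than `0`, and `divergence` is `0` by definition.
  · rw [divergence, dif_neg h, iOp_of_lt I (by omega)]
    simp [show I.iOp (0 : Polyvector k A A 1) = 0 from map_zero (I.iOpLinear 1)]

/-- The differential on forms that corresponds to the Poisson differential of polyvectors. -/
def poissonOp : Module.End k I.TotalForm := I.bivectorLieOp π - hη.modularOp π

theorem poissonOp_apply (x : I.TotalForm) :
    hη.poissonOp π x = I.bivectorLieOp π x - hη.modularOp π x := rfl

theorem poissonOp_volume : hη.poissonOp π (I.of n η) = 0 := by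
  rw [poissonOp_apply, bivectorLieOp_volume hη, sub_self]

/-- The Poisson differential `[L_π, X]` of the operator `X` of degree `i`. -/
def _root_.PoissonBV.FormRelations.deltaE (I : FormRelations k A) (π : PoissonStructure k A)
    (i : ℤ) (X : Module.End k I.TotalForm) : Module.End k I.TotalForm :=
  I.brE 2 i (I.iOp π.bivector) X

theorem deltaE_apply (i : ℤ) (X : Module.End k I.TotalForm) (x : I.TotalForm) :
    I.deltaE π i X x =
      I.bivectorLieOp π (X x) - i.negOnePow • X (I.bivectorLieOp π x) := by
  rw [deltaE, brE_apply, lieE_bivector, negOnePow_mul_of_odd (by decide)]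

theorem deltaE_mem {i : ℤ} {X : Module.End k I.TotalForm} (hX : X ∈ I.contractions i) :
    I.deltaE π i X ∈ I.contractions (i + 1) := by
  have := brE_mem (bivector_mem (I := I) π) hX
  rwa [show 2 + i - 1 = i + 1 by ring] at this

/-- A twisted Leibniz rule: `deltaE` is the graded commutator of `poissonOp` with contractions. -/
theorem poissonOp_contraction {i : ℤ} {X : Module.End k I.TotalForm}
    (hX : X ∈ I.contractions i) (x : I.TotalForm) :
    hη.poissonOp π (X x) = I.deltaE π i X x + i.negOnePow • X (hη.poissonOp π x) := by
  have h := contractions_comm (hη.modularOp_mem π) hX x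
  rw [one_mul] at h
  rw [poissonOp_apply, poissonOp_apply, deltaE_apply, h, map_sub, smul_sub]
  abel

/-- Under `P ↦ ι_P η`, the Poisson differential becomes `poissonOp`. -/
theorem poissonOp_contraction_volume {i : ℤ} {X : Module.End k I.TotalForm}
    (hX : X ∈ I.contractions i) :
    hη.poissonOp π (X (I.of n η)) = I.deltaE π i X (I.of n η) := by
  rw [poissonOp_contraction hη π hX, poissonOp_volume, map_zero, smul_zero, add_zero]

theorem dOp_bivectorLieOp (x : I.TotalForm) :
    I.dOp (I.bivectorLieOp π x) = -I.bivectorLieOp π (I.dOp x) := by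
  simp [bivectorLieOp, lieOp_apply, dOp_dOp]

/-- The Lie derivative along `π` has square `0`: it commutes with `ι_π` because `[π, π] = 0`, and it
anticommutes with `d`. -/
theorem bivectorLieOp_sq (x : I.TotalForm) :
    I.bivectorLieOp π (I.bivectorLieOp π x) = 0 := by
  have h : ∀ x, I.bivectorLieOp π (I.iOp π.bivector x) =
      I.iOp π.bivector (I.bivectorLieOp π x) := by
    intro x
    have h1 := I.iOp_schouten (by omega : 2 + 2 = 3 + 1) π.bivector π.bivector x
    have h2 : schoutenPolyvector (by omega : 2 + 2 = 3 + 1) π.bivector π.bivector = 0 := by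
      ext1
      exact π.schouten_bivector_self _
    rw [h2, show I.iOp (0 : Polyvector k A A 3) = 0 from map_zero (I.iOpLinear 3),
      lieBracketOp_apply] at h1
    rw [← sub_eq_zero]
    simpa [bivectorLieOp] using h1.symm
  have h3 : I.bivectorLieOp π (I.bivectorLieOp π x) = -I.bivectorLieOp π (I.bivectorLieOp π x) := by
    conv_lhs => rw [bivectorLieOp, lieOp_apply I π.bivector x, ← bivectorLieOp]
    rw [map_sub, h, map_zsmul]
    have h4 := dOp_bivectorLieOp (I := I) π (I.iOp π.bivector x)
    have h5 := dOp_bivectorLieOp (I := I) π x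
    rw [h] at h4
    conv_rhs => rw [bivectorLieOp, lieOp_apply I π.bivector, ← bivectorLieOp]
    rw [h4, h5, map_neg]
    module
  have h4 : (2 : k) • I.bivectorLieOp π (I.bivectorLieOp π x) = 0 := by
    rw [two_smul]
    nth_rewrite 2 [h3]
    exact add_neg_cancel _
  exact (smul_eq_zero.mp h4).resolve_left two_ne_zero

/-- The square of `poissonOp` is minus the contraction with `[π, ν]`, which vanishes because it
kills the volume form. -/
theorem poissonOp_sq (x : I.TotalForm) : hη.poissonOp π (hη.poissonOp π x) = 0 := by
  have hν : ∀ x, hη.modularOp π (hη.modularOp π x) = 0 := by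
    intro x
    have h := contractions_comm (hη.modularOp_mem π) (hη.modularOp_mem π) x
    rw [one_mul, Int.negOnePow_one, Units.neg_smul, one_smul] at h
    have h4 : (2 : k) • hη.modularOp π (hη.modularOp π x) = 0 := by
      rw [two_smul]
      nth_rewrite 2 [h]
      exact add_neg_cancel _
    exact (smul_eq_zero.mp h4).resolve_left two_ne_zero
  have h1 : ∀ x, hη.poissonOp π (hη.poissonOp π x) = -I.deltaE π 1 (hη.modularOp π) x := by
    intro x
    rw [deltaE_apply, poissonOp_apply, poissonOp_apply, map_sub, map_sub, bivectorLieOp_sq, hν]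
    simp
    abel
  have h2 : I.deltaE π 1 (hη.modularOp π) = 0 := by
    refine hη.contractions_ext (deltaE_mem π (hη.modularOp_mem π)) (zero_mem _) ?_
    have h := h1 (I.of n η)
    rw [poissonOp_volume, map_zero] at h
    exact neg_eq_zero.mp h.symm
  rw [h1, h2]
  simp

/-- The Lie derivative of forms along the modular vector. -/
def modularLieOp : Module.End k I.TotalForm := I.lieOp (hη.modularVector π)

theorem modularLieOp_apply (x : I.TotalForm) : hη.modularLieOp π x =
    hη.modularOp π (I.dOp x) + I.dOp (hη.modularOp π x) := by
  simp [modularLieOp, lieOp_apply, modularOp]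

/-- The de Rham differential is a homotopy that kills the Lie derivative along the modular
vector. -/
theorem modularLieOp_eq (x : I.TotalForm) : hη.modularLieOp π x =
    -(I.dOp (hη.poissonOp π x) + hη.poissonOp π (I.dOp x)) := by
  rw [modularLieOp_apply, poissonOp_apply, poissonOp_apply, map_sub, dOp_bivectorLieOp]
  abel

theorem modularLieOp_dOp (x : I.TotalForm) :
    hη.modularLieOp π (I.dOp x) = I.dOp (hη.modularLieOp π x) := by
  simp [modularLieOp_apply, dOp_dOp]

theorem modularLieOp_poissonOp (x : I.TotalForm) :
    hη.modularLieOp π (hη.poissonOp π x) = hη.poissonOp π (hη.modularLieOp π x) := by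
  simp [modularLieOp_eq, poissonOp_sq]

theorem modularLieOp_volume : hη.modularLieOp π (I.of n η) = 0 := by
  rw [modularLieOp_eq, poissonOp_volume, hη.dOp_volume]
  simp

theorem modularLieOp_contraction {i : ℤ} (X : Module.End k I.TotalForm) (x : I.TotalForm) :
    hη.modularLieOp π (X x) = I.brE 1 i (hη.modularOp π) X x + X (hη.modularLieOp π x) := by
  have h : I.lieE 1 (hη.modularOp π) = hη.modularLieOp π := lieE_iOp (p := 1) _
  rw [brE_apply, h, negOnePow_mul_of_even (by decide)]
  simp

end IsVolumeForm

end FormRelations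

end Volume

/-! ### Diagonalizable operators -/

section Diagonalizable

variable {k U V : Type*} [Field k] [AddCommGroup U] [Module k U] [AddCommGroup V] [Module k V]

/-- If `T` acts on the values of a bilinear map `B` by the Leibniz rule, then `B` maps sums of
eigenvectors to sums of eigenvectors: eigenvalues add up. -/
theorem mem_iSup_eigenspace_of_leibniz {S : Module.End k U} {T : Module.End k V}
    (B : U →ₗ[k] V →ₗ[k] V) (hB : ∀ a x, T (B a x) = B (S a) x + B a (T x)) {a : U} {x : V}
    (ha : a ∈ ⨆ c : k, S.eigenspace c) (hx : x ∈ ⨆ c : k, T.eigenspace c) :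
    B a x ∈ ⨆ c : k, T.eigenspace c := by
  induction ha using Submodule.iSup_induction' with
  | zero => rw [map_zero]; exact zero_mem _
  | add a b _ _ ha hb => rw [map_add]; exact add_mem ha hb
  | mem c a ha =>
    induction hx using Submodule.iSup_induction' with
    | zero => rw [map_zero]; exact zero_mem _
    | add x y _ _ hx hy => rw [map_add]; exact add_mem hx hy
    | mem c' x hx =>
      refine Submodule.mem_iSup_of_mem (c + c') ?_
      rw [Module.End.mem_eigenspace_iff] at *
      rw [hB, ha, hx, map_smul, map_smul, LinearMap.smul_apply, add_smul]

variable {T : Module.End k V}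

theorem IsDiagonalizable.isCompl (hT : IsDiagonalizable T) :
    IsCompl (LinearMap.ker T) (LinearMap.range T) := by
  constructor
  · have h := Module.End.eigenspaces_iSupIndep T 0
    rw [Module.End.eigenspace_zero] at h
    refine h.mono_right ?_
    rintro _ ⟨x, rfl⟩
    have hx : x ∈ ⨆ c : k, T.eigenspace c := hT ▸ Submodule.mem_top
    induction hx using Submodule.iSup_induction' with
    | zero => rw [map_zero]; exact zero_mem _
    | add x y _ _ hx hy => rw [map_add]; exact add_mem hx hy
    | mem c x hx =>
      rw [Module.End.mem_eigenspace_iff] at hx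
      by_cases hc : c = 0
      · rw [hx, hc, zero_smul]
        exact zero_mem _
      · rw [hx]
        refine Submodule.smul_mem _ _ (Submodule.mem_iSup_of_mem c
          (Submodule.mem_iSup_of_mem hc ?_))
        exact Module.End.mem_eigenspace_iff.mpr hx
  · rw [codisjoint_iff, eq_top_iff, ← hT, iSup_le_iff]
    intro c x hx
    rw [Module.End.mem_eigenspace_iff] at hx
    by_cases hc : c = 0
    · refine Submodule.mem_sup_left ?_
      rw [LinearMap.mem_ker, hx, hc, zero_smul]
    · refine Submodule.mem_sup_right ⟨c⁻¹ • x, ?_⟩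
      rw [map_smul, hx, smul_smul, inv_mul_cancel₀ hc, one_smul]

/-- The projection to the kernel of a diagonalizable operator along its range. -/
def IsDiagonalizable.kerProjection (hT : IsDiagonalizable T) : Module.End k V :=
  (LinearMap.ker T).projection (LinearMap.range T) hT.isCompl

namespace IsDiagonalizable

variable (hT : IsDiagonalizable T)

theorem map_kerProjection (x : V) : T (hT.kerProjection x) = 0 :=
  (Submodule.projection_apply_mem hT.isCompl x : _ ∈ LinearMap.ker T)

theorem kerProjection_of_map_eq_zero {x : V} (hx : T x = 0) : hT.kerProjection x = x :=
  Submodule.projection_apply_left hT.isCompl (⟨x, hx⟩ : LinearMap.ker T)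

theorem exists_sub_kerProjection (x : V) : ∃ y, x - hT.kerProjection x = T y := by
  obtain ⟨y, hy⟩ := Submodule.sub_projection_mem hT.isCompl x
  exact ⟨y, hy.symm⟩

theorem kerProjection_map (x : V) : hT.kerProjection (T x) = 0 :=
  Submodule.projection_apply_eq_zero_iff hT.isCompl |>.mpr (LinearMap.mem_range_self T x)

theorem kerProjection_comm {S : Module.End k V} (hS : ∀ x, T (S x) = S (T x)) (x : V) :
    hT.kerProjection (S x) = S (hT.kerProjection x) := by
  obtain ⟨y, hy⟩ := hT.exists_sub_kerProjection x
  rw [sub_eq_iff_eq_add'] at hy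
  nth_rewrite 1 [hy]
  rw [map_add, map_add, ← hS, kerProjection_map, add_zero, kerProjection_of_map_eq_zero]
  rw [hS, map_kerProjection, map_zero]

end IsDiagonalizable

end Diagonalizable

/-! ### The Lie derivative along a semisimple modular vector -/

section Modular

variable {k A : Type*} [Field k] [CharZero k] [CommRing A] [Algebra k A] {I : FormRelations k A}
  {n : ℕ} {η : I.Form n} (hη : I.IsVolumeForm η) (π : PoissonStructure k A)

namespace FormRelations

theorem innerOp_vector (X : Polyvector k A A 1) (a : A) :
    I.innerOp a X = I.mulOp (Polyvector.toEnd X a) := by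
  rw [innerOp, iOp_zero_deg]
  rfl

theorem lieOp_vector_mulOp (X : Polyvector k A A 1) (a : A) (x : I.TotalForm) :
    I.lieOp X (I.mulOp a x) = I.mulOp (Polyvector.toEnd X a) x + I.mulOp a (I.lieOp X x) := by
  rw [lieOp_mulOp, innerOp_vector]
  module

theorem lieOp_vector_eOp (X : Polyvector k A A 1) (a : A) (x : I.TotalForm) :
    I.lieOp X (I.eOp a x) = I.eOp (Polyvector.toEnd X a) x + I.eOp a (I.lieOp X x) := by
  rw [lieOp_eOp, lieInnerOp_apply, innerOp_vector, dOp_mulOp]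
  module

/-- The Lie derivative of forms along a diagonalizable vector field is diagonalizable. -/
theorem isDiagonalizable_lieOp {X : Polyvector k A A 1}
    (hX : IsDiagonalizable (Polyvector.toEnd X)) :
    IsDiagonalizable (I.lieOp X) := by
  have hA : ∀ a : A, a ∈ ⨆ c : k, (Polyvector.toEnd X).eigenspace c :=
    fun a => hX ▸ Submodule.mem_top
  let M : A →ₗ[k] Module.End k I.TotalForm := (Algebra.lsmul k k I.TotalForm).toLinearMap
  let E : A →ₗ[k] Module.End k I.TotalForm :=
    (LinearMap.mulLeft k I.dOp - LinearMap.mulRight k I.dOp) ∘ₗ M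
  rw [IsDiagonalizable, eq_top_iff]
  intro x _
  induction x using I.totalForm_induction with
  | zero => exact zero_mem _
  | add x y hx hy => exact add_mem (hx trivial) (hy trivial)
  | one =>
    refine Submodule.mem_iSup_of_mem 0 ?_
    rw [Module.End.mem_eigenspace_iff, lieOp_one, zero_smul]
  | mul a x hx =>
    exact mem_iSup_eigenspace_of_leibniz M (lieOp_vector_mulOp X) (hA a) (hx trivial)
  | e a x hx =>
    exact mem_iSup_eigenspace_of_leibniz E (lieOp_vector_eOp X) (hA a) (hx trivial)

namespace IsVolumeForm

theorem isDiagonalizable_modularLieOp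
    (hν : IsDiagonalizable (Polyvector.toEnd (hη.modularVector π))) :
    IsDiagonalizable (hη.modularLieOp π) := isDiagonalizable_lieOp hν

/-- A `poissonOp`-closed form is cohomologous to its projection to the invariant forms. -/
theorem exists_poissonOp_eq_sub (hL : IsDiagonalizable (hη.modularLieOp π)) {x : I.TotalForm}
    (hx : hη.poissonOp π x = 0) : ∃ z, x - hL.kerProjection x = hη.poissonOp π z := by
  obtain ⟨y, hy⟩ := hL.exists_sub_kerProjection x
  obtain ⟨u, hu⟩ := hL.exists_sub_kerProjection y
  have h1 : hη.modularLieOp π (y - hL.kerProjection y) = x - hL.kerProjection x := by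
    rw [map_sub, hL.map_kerProjection, sub_zero, hy]
  -- The form `D (y - Π y)` is both invariant and in the range of the Lie derivative.
  have h2 : hη.poissonOp π (y - hL.kerProjection y) = 0 := by
    have h3 : hη.modularLieOp π (hη.poissonOp π (y - hL.kerProjection y)) = 0 := by
      rw [modularLieOp_poissonOp, h1, map_sub, hx,
        ← hL.kerProjection_comm (modularLieOp_poissonOp hη π), hx, map_zero, sub_zero]
    rw [← hL.kerProjection_of_map_eq_zero h3, hu, ← modularLieOp_poissonOp,
      hL.kerProjection_map]
  refine ⟨-I.dOp (y - hL.kerProjection y), ?_⟩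
  rw [← h1, modularLieOp_eq, h2, map_zero, zero_add, map_neg]

variable (I) in
/-- The projection to the forms of degree `n - i`. -/
def _root_.PoissonBV.FormRelations.proj (n : ℕ) (i : ℤ) : Module.End k I.TotalForm :=
  I.lift fun r => if (r : ℤ) = n - i then I.of r else 0

section

include hη

theorem proj_contraction {i j : ℤ} {X : Module.End k I.TotalForm} (hX : X ∈ I.contractions j) :
    I.proj n i (X (I.of n η)) = if i = j then X (I.of n η) else 0 := by
  rcases hη.exists_form hX with ⟨r, ω, hr, h⟩ | rfl
  · rw [h, proj, lift_of]
    by_cases hij : i = j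
    · rw [if_pos (by omega), if_pos hij]
    · rw [if_neg (by omega), if_neg hij]
      rfl
  · simp

theorem proj_contraction_self {i : ℤ} {X : Module.End k I.TotalForm}
    (hX : X ∈ I.contractions i) : I.proj n i (X (I.of n η)) = X (I.of n η) := by
  rw [proj_contraction hη hX, if_pos rfl]

theorem contraction_induction {C : I.TotalForm → Prop} (x : I.TotalForm) (zero : C 0)
    (add : ∀ x y, C x → C y → C (x + y))
    (contraction : ∀ (i : ℤ), ∀ X ∈ I.contractions i, C (X (I.of n η))) : C x := by
  refine I.totalForm_add_induction x zero add fun m ω => ?_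
  obtain ⟨X, hX, h⟩ := hη.exists_contraction ω
  exact h ▸ contraction _ X hX

theorem exists_proj (i : ℤ) (x : I.TotalForm) :
    ∃ X ∈ I.contractions i, I.proj n i x = X (I.of n η) := by
  induction x using contraction_induction hη with
  | zero => exact ⟨0, zero_mem _, by simp⟩
  | add x y hx hy =>
    obtain ⟨X, hX, h⟩ := hx
    obtain ⟨Y, hY, h'⟩ := hy
    exact ⟨X + Y, add_mem hX hY, by rw [map_add, h, h', LinearMap.add_apply]⟩
  | contraction j X hX =>
    rw [proj_contraction hη hX]
    by_cases hij : i = j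
    · subst hij
      exact ⟨X, hX, if_pos rfl⟩
    · exact ⟨0, zero_mem _, if_neg hij⟩

/-- An operator of degree `s` on the contractions of the volume form respects the grading. -/
theorem proj_comm {T : Module.End k I.TotalForm} (s : ℤ)
    (hT : ∀ (i : ℤ), ∀ X ∈ I.contractions i, ∃ Y ∈ I.contractions (i + s),
      T (X (I.of n η)) = Y (I.of n η)) (i : ℤ) (x : I.TotalForm) :
    T (I.proj n i x) = I.proj n (i + s) (T x) := by
  induction x using contraction_induction hη with
  | zero => simp
  | add x y hx hy => simp only [map_add, hx, hy]
  | contraction j X hX =>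
    obtain ⟨Y, hY, h⟩ := hT j X hX
    rw [h, proj_contraction hη hX, proj_contraction hη hY]
    by_cases hij : i = j
    · rw [if_pos hij, if_pos (by omega), h]
    · rw [if_neg hij, if_neg (by omega), map_zero]

end

theorem poissonOp_proj (i : ℤ) (x : I.TotalForm) :
    hη.poissonOp π (I.proj n i x) = I.proj n (i + 1) (hη.poissonOp π x) :=
  proj_comm hη 1 (fun _ _ hX => ⟨_, deltaE_mem π hX, poissonOp_contraction_volume hη π hX⟩) i x

theorem modularLieOp_contraction_volume {i : ℤ} (X : Module.End k I.TotalForm) :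
    hη.modularLieOp π (X (I.of n η)) = I.brE 1 i (hη.modularOp π) X (I.of n η) := by
  rw [modularLieOp_contraction, modularLieOp_volume, map_zero, add_zero]

theorem brE_modularOp_mem {i : ℤ} {X : Module.End k I.TotalForm} (hX : X ∈ I.contractions i) :
    I.brE 1 i (hη.modularOp π) X ∈ I.contractions i := by
  have h := brE_mem (hη.modularOp_mem π) hX
  rwa [add_sub_cancel_left] at h

theorem modularLieOp_proj (i : ℤ) (x : I.TotalForm) :
    hη.modularLieOp π (I.proj n i x) = I.proj n i (hη.modularLieOp π x) := by
  have h := proj_comm hη (T := hη.modularLieOp π) 0 (fun j X hX =>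
    ⟨I.brE 1 j (hη.modularOp π) X, by rw [add_zero]; exact brE_modularOp_mem hη π hX,
      modularLieOp_contraction_volume hη π X⟩) i x
  rwa [add_zero] at h

/-- A polyvector whose contraction with the volume form is invariant under the modular vector
commutes with the Lie derivative. -/
theorem modularLieOp_comm {i : ℤ} {X : Module.End k I.TotalForm} (hX : X ∈ I.contractions i)
    (h : hη.modularLieOp π (X (I.of n η)) = 0) (x : I.TotalForm) :
    hη.modularLieOp π (X x) = X (hη.modularLieOp π x) := by
  have h0 : I.brE 1 i (hη.modularOp π) X = 0 :=
    hη.contractions_ext (brE_modularOp_mem hη π hX) (zero_mem _)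
      (by rw [← modularLieOp_contraction_volume, h]; rfl)
  rw [modularLieOp_contraction (i := i), h0, LinearMap.zero_apply, zero_add]

/-- A polyvector whose contraction with the volume form is `poissonOp`-exact is a Poisson
coboundary. -/
theorem exists_deltaE_eq {i : ℤ} {X : Module.End k I.TotalForm} (hX : X ∈ I.contractions i)
    {z : I.TotalForm} (h : X (I.of n η) = hη.poissonOp π z) :
    ∃ Y ∈ I.contractions (i - 1), X = I.deltaE π (i - 1) Y := by
  obtain ⟨Y, hY, h'⟩ := exists_proj hη (i - 1) z
  refine ⟨Y, hY, hη.contractions_ext hX ?_ ?_⟩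
  · have := deltaE_mem π hY
    rwa [sub_add_cancel] at this
  · rw [← poissonOp_contraction_volume hη π hY, ← h', poissonOp_proj, ← h, sub_add_cancel,
      proj_contraction_self hη hX]

/-- The projection to the invariant forms, on polyvectors. -/
theorem exists_invariant (hL : IsDiagonalizable (hη.modularLieOp π)) {i : ℤ}
    {X : Module.End k I.TotalForm} (hX : X ∈ I.contractions i) :
    ∃ Y ∈ I.contractions i, Y (I.of n η) = hL.kerProjection (X (I.of n η)) := by
  obtain ⟨Y, hY, h⟩ := exists_proj hη i (hL.kerProjection (X (I.of n η)))
  refine ⟨Y, hY, ?_⟩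
  rw [← h, ← hL.kerProjection_comm (modularLieOp_proj hη π i), proj_contraction_self hη hX]

end IsVolumeForm

end FormRelations

end Modular

/-! ### Cohomology classes represented by operators on forms -/

/-- The linear map on `Z / (B ∩ Z)` induced by a linear map on `Z`. -/
def Subquotient.lift {k M N : Type*} [Ring k] [AddCommGroup M] [Module k M] [AddCommGroup N]
    [Module k N] {Z B : Submodule k M} (F : Z →ₗ[k] N) (hF : ∀ z : Z, z.1 ∈ B → F z = 0) :
    Subquotient Z B →ₗ[k] N :=
  (B.submoduleOf Z).liftQ F fun z hz => hF z hz

namespace PoissonStructure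

section Classes

variable {k A : Type*} [Field k] [CommRing A] [Algebra k A] (π : PoissonStructure k A)

variable {π} in
theorem hp_induction {C : π.HP → Prop} (x : π.HP) (zero : C 0)
    (add : ∀ x y, C x → C y → C (x + y)) (cls : ∀ (p : ℕ) (P : π.cocycles p), C (π.cls p P)) :
    C x := by
  refine DirectSum.induction_on x zero (fun p u => ?_) add
  obtain ⟨P, rfl⟩ := Submodule.mkQ_surjective _ u
  exact cls p P

theorem cls_eq_zero {p : ℕ} {P : π.cocycles p} (hP : P.1 ∈ π.coboundaries p) :
    π.cls p P = 0 := by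
  have h : Subquotient.mk (π.cocycles p) (π.coboundaries p) P = 0 :=
    (Submodule.Quotient.mk_eq_zero _).mpr hP
  rw [cls, LinearMap.comp_apply, h, map_zero]

/-- A linear map on Poisson cohomology, from linear maps on cocycles that vanish on
coboundaries. -/
theorem exists_lift {M : Type*} [AddCommGroup M] [Module k M]
    (F : ∀ p, π.cocycles p →ₗ[k] M) (hF : ∀ p P, P.1 ∈ π.coboundaries p → F p P = 0) :
    ∃ G : π.HP →ₗ[k] M, ∀ p P, G (π.cls p P) = F p P := by
  refine ⟨DirectSum.toModule k ℕ M fun p => Subquotient.lift (F p) (hF p), fun p P => ?_⟩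
  rw [cls, LinearMap.comp_apply, DirectSum.toModule_lof]
  rfl

/-- A linear relation between cocycles and the elements of `M`, defined on all cocycles, for which
only `0` corresponds to coboundaries, induces a linear map on Poisson cohomology. -/
theorem exists_lift_of_rel {M : Type*} [AddCommGroup M] [Module k M]
    (R : ∀ p, π.cocycles p → M → Prop) (ex : ∀ p P, ∃ x, R p P x)
    (add : ∀ p P Q x y, R p P x → R p Q y → R p (P + Q) (x + y))
    (smul : ∀ p (c : k) P x, R p P x → R p (c • P) (c • x))
    (zero : ∀ p P x, P.1 ∈ π.coboundaries p → R p P x → x = 0) :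
    ∃ G : π.HP →ₗ[k] M, ∀ p P, R p P (G (π.cls p P)) := by
  have uniq : ∀ p P x y, R p P x → R p P y → x = y := by
    intro p P x y hx hy
    rw [← sub_eq_zero]
    refine zero p 0 _ (zero_mem _) ?_
    have := add p _ _ _ _ hx (smul p (-1) _ _ hy)
    rwa [neg_one_smul, neg_one_smul k P, add_neg_cancel, ← sub_eq_add_neg] at this
  choose f hf using ex
  obtain ⟨G, hG⟩ := π.exists_lift
    (fun p =>
      { toFun := f p
        map_add' := fun P Q => uniq p _ _ _ (hf p _) (add p _ _ _ _ (hf p P) (hf p Q))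
        map_smul' := fun c P => uniq p _ _ _ (hf p _) (smul p c _ _ (hf p P)) })
    (fun p P hP => zero p P _ hP (hf p P))
  exact ⟨G, fun p P => hG p P ▸ hf p P⟩

theorem iSup_grading : ⨆ i, π.grading i = ⊤ := by
  rw [eq_top_iff]
  intro x _
  induction x using hp_induction with
  | zero => exact zero_mem _
  | add x y hx hy => exact add_mem (hx trivial) (hy trivial)
  | cls p P => exact Submodule.mem_iSup_of_mem (p : ℤ) (LinearMap.mem_range_self (π.cls p) P)

theorem iSupIndep_grading : iSupIndep π.grading := by
  rintro (p | p)
  · rw [Submodule.disjoint_def]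
    rintro _ ⟨P, rfl⟩ h
    have h1 : (⨆ (j : ℤ) (_ : j ≠ Int.ofNat p), π.grading j) ≤
        LinearMap.ker (DirectSum.component k ℕ π.HPdeg p) := by
      refine iSup₂_le fun j hj => ?_
      rcases j with q | q
      · rintro _ ⟨Q, rfl⟩
        rw [LinearMap.mem_ker, cls, LinearMap.comp_apply, DirectSum.component.of, dif_neg]
        rintro rfl
        exact hj rfl
      · exact bot_le
    have h2 := h1 h
    rw [LinearMap.mem_ker, cls, LinearMap.comp_apply, DirectSum.component.lof_self] at h2
    rw [cls, LinearMap.comp_apply, h2, map_zero]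
  · exact disjoint_bot_left

theorem isInternal_grading : DirectSum.IsInternal π.grading :=
  DirectSum.isInternal_submodule_iff_iSupIndep_and_iSup_eq_top _ |>.mpr
    ⟨π.iSupIndep_grading, π.iSup_grading⟩

end Classes

section Represents

variable {k A : Type*} [Field k] [CharZero k] [CommRing A] [Algebra k A]
  (I : FormRelations k A) {π : PoissonStructure k A}

/-- The class `x` of degree `i` is the class of a Poisson cocycle whose contraction of forms is the
operator `X`. The second alternative is there for negative degrees, where `X = 0` and `x = 0`. -/
def Represents (i : ℤ) (X : Module.End k I.TotalForm) (x : π.HP) : Prop :=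
  (∃ (p : ℕ) (P : π.cocycles p), i = p ∧ X = I.iOp (toPolyvector P) ∧ x = π.cls p P) ∨
    (X = 0 ∧ x = 0)

theorem iOp_toPolyvector_zero (p : ℕ) :
    I.iOp (toPolyvector (0 : π.cocycles p)) = 0 := map_zero (I.iOpLinear p)

theorem iOp_toPolyvector_smul {p : ℕ} (c : k) (P : π.cocycles p) :
    I.iOp (toPolyvector (c • P)) = c • I.iOp (toPolyvector P) :=
  (I.iOpLinear p).map_smul c (toPolyvector P)

theorem iOp_toPolyvector_add {p : ℕ} (P Q : π.cocycles p) :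
    I.iOp (toPolyvector (P + Q)) = I.iOp (toPolyvector P) + I.iOp (toPolyvector Q) :=
  (I.iOpLinear p).map_add (toPolyvector P) (toPolyvector Q)

/-- The operator `deltaE` realizes the Poisson differential of polyvectors. -/
theorem exists_deltaE_iOp {p : ℕ} (P : Polyvector k A A p) :
    ∃ R : Polyvector k A A (p + 1), ⇑R.1 = π.delta P.1 ∧ I.deltaE π p (I.iOp P) = I.iOp R := by
  have h : 2 + p = p + 1 + 1 := by omega
  refine ⟨schoutenPolyvector h π.bivector P, (π.delta_eq_schouten h P.1).symm, ?_⟩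
  exact FormRelations.brE_iOp_eq_schouten (p := 2) h π.bivector P

variable {I}

theorem represents_cls {p : ℕ} (P : π.cocycles p) :
    Represents I p (I.iOp (toPolyvector P)) (π.cls p P) := Or.inl ⟨p, P, rfl, rfl, rfl⟩

theorem represents_zero (i : ℤ) : Represents I i 0 (0 : π.HP) := Or.inr ⟨rfl, rfl⟩

namespace Represents

variable {i j : ℤ} {X Y : Module.End k I.TotalForm} {x y : π.HP}

theorem add (hX : Represents I i X x) (hY : Represents I i Y y) :
    Represents I i (X + Y) (x + y) := by
  rcases hX with ⟨p, P, rfl, rfl, rfl⟩ | ⟨rfl, rfl⟩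
  · rcases hY with ⟨q, Q, hpq, rfl, rfl⟩ | ⟨rfl, rfl⟩
    · obtain rfl : p = q := by exact_mod_cast hpq
      rw [← iOp_toPolyvector_add, ← map_add]
      exact represents_cls _
    · rw [add_zero, add_zero]
      exact represents_cls _
  · rwa [zero_add, zero_add]

theorem smul (c : k) (hX : Represents I i X x) : Represents I i (c • X) (c • x) := by
  rcases hX with ⟨p, P, rfl, rfl, rfl⟩ | ⟨rfl, rfl⟩
  · rw [← iOp_toPolyvector_smul, ← map_smul]
    exact represents_cls _
  · rw [smul_zero, smul_zero (A := π.HP) c]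
    exact represents_zero i

theorem zsmul (c : ℤ) (hX : Represents I i X x) : Represents I i (c • X) (c • x) := by
  rw [← Int.cast_smul_eq_zsmul k, ← Int.cast_smul_eq_zsmul k]
  exact hX.smul _

theorem units_smul (c : ℤˣ) (hX : Represents I i X x) : Represents I i (c • X) (c • x) :=
  hX.zsmul c

theorem neg (hX : Represents I i X x) : Represents I i (-X) (-x) := by
  rw [← neg_one_zsmul, ← neg_one_zsmul x]
  exact hX.zsmul (-1)

theorem sub (hX : Represents I i X x) (hY : Represents I i Y y) :
    Represents I i (X - Y) (x - y) := by
  rw [sub_eq_add_neg, sub_eq_add_neg]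
  exact hX.add hY.neg

theorem mem_contractions (hX : Represents I i X x) : X ∈ I.contractions i := by
  rcases hX with ⟨p, P, rfl, rfl, rfl⟩ | ⟨rfl, rfl⟩
  · exact I.iOp_mem _
  · exact zero_mem _

theorem mem_grading (hX : Represents I i X x) : x ∈ π.grading i := by
  rcases hX with ⟨p, P, rfl, rfl, rfl⟩ | ⟨rfl, rfl⟩
  · exact LinearMap.mem_range_self (π.cls p) P
  · exact zero_mem _

theorem deltaE_eq_zero (hX : Represents I i X x) : I.deltaE π i X = 0 := by
  rcases hX with ⟨p, P, rfl, rfl, rfl⟩ | ⟨rfl, rfl⟩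
  · obtain ⟨R, hR, h⟩ := exists_deltaE_iOp I (π := π) (toPolyvector P)
    rw [h]
    obtain rfl : R = 0 := by
      ext1
      refine AlternatingMap.coe_injective ?_
      rw [hR]
      exact P.2.2
    exact map_zero (I.iOpLinear (p + 1))
  · simp [FormRelations.deltaE, FormRelations.brE]

end Represents

theorem exists_represents_of_mem_grading {i : ℤ} {x : π.HP} (hx : x ∈ π.grading i) :
    ∃ X, Represents I i X x := by
  rcases i with p | p
  · obtain ⟨P, rfl⟩ := hx
    exact ⟨_, represents_cls P⟩
  · obtain rfl : x = 0 := hx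
    exact ⟨0, represents_zero _⟩

variable {n : ℕ} {η : I.Form n} (hη : I.IsVolumeForm η)

include hη

theorem iOp_injective {p : ℕ} {P Q : Polyvector k A A p} (h : I.iOp P = I.iOp Q) : P = Q := by
  rw [← sub_eq_zero]
  refine hη.eq_zero_of_iOp_eq_zero _ ?_
  rw [show I.iOp (P - Q) = I.iOp P - I.iOp Q from map_sub (I.iOpLinear p) P Q, h, sub_self]
  rfl

theorem exists_represents {i : ℤ} {X : Module.End k I.TotalForm} (hX : X ∈ I.contractions i)
    (h : I.deltaE π i X = 0) : ∃ x : π.HP, Represents I i X x := by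
  rcases FormRelations.exists_of_mem_contractions hX with ⟨p, P, rfl, rfl⟩ | rfl
  · obtain ⟨R, hR, h'⟩ := exists_deltaE_iOp I (π := π) P
    rw [h', ← map_zero (I.iOpLinear (p + 1))] at h
    have h0 : R = 0 := iOp_injective hη h
    refine ⟨_, represents_cls (π := π) ⟨P.1, P.2, ?_⟩⟩
    rw [← hR, h0]
    rfl
  · exact ⟨0, represents_zero i⟩

theorem Represents.eq_zero_of_eq_deltaE {i : ℤ} {X Y : Module.End k I.TotalForm} {x : π.HP}
    (hX : Represents I i X x) (hY : Y ∈ I.contractions (i - 1))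
    (h : X = I.deltaE π (i - 1) Y) : x = 0 := by
  rcases hX with ⟨p, P, rfl, rfl, rfl⟩ | ⟨rfl, rfl⟩
  · refine π.cls_eq_zero ?_
    rcases FormRelations.exists_of_mem_contractions hY with ⟨q, Q, hq, rfl⟩ | rfl
    · obtain rfl : p = q + 1 := by omega
      obtain ⟨R, hR, h'⟩ := exists_deltaE_iOp I (π := π) Q
      rw [hq, h'] at h
      refine ⟨Q.1, Q.2, ?_⟩
      rw [← hR, ← iOp_injective hη h]
      rfl
    · have h0 : toPolyvector P = 0 := by
        refine hη.eq_zero_of_iOp_eq_zero _ ?_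
        rw [h]
        simp [FormRelations.deltaE, FormRelations.brE]
      have h1 : P.1 = 0 := congrArg Subtype.val h0
      rw [h1]
      exact zero_mem _
  · rfl

theorem Represents.eq_of_sub_eq {i i' : ℤ} {X Y : Module.End k I.TotalForm} {x y : π.HP}
    (hX : Represents I i X x) (hY : Represents I i' Y y) (hi : i = i') {z : I.TotalForm}
    (h : X (I.of n η) - Y (I.of n η) = hη.poissonOp π z) : x = y := by
  subst hi
  rw [← sub_eq_zero]
  have h1 := hX.sub hY
  obtain ⟨Z, hZ, h2⟩ := hη.exists_deltaE_eq π h1.mem_contractions h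
  exact h1.eq_zero_of_eq_deltaE hη hZ h2

/-- A cohomology class is determined by the value of a representative on the volume form. -/
theorem Represents.eq {i i' : ℤ} {X Y : Module.End k I.TotalForm} {x y : π.HP}
    (hX : Represents I i X x) (hY : Represents I i' Y y) (hi : i = i')
    (h : X (I.of n η) = Y (I.of n η)) : x = y :=
  hX.eq_of_sub_eq hη hY hi (z := 0) (by rw [h, sub_self, map_zero])

end Represents

end PoissonStructure

/-! ### The product and the operator on Poisson cohomology -/

namespace PoissonStructure

section Operations

variable {k A : Type*} [Field k] [CharZero k] [CommRing A] [Algebra k A]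
  {I : FormRelations k A} {π : PoissonStructure k A} {n : ℕ} {η : I.Form n}
  (hη : I.IsVolumeForm η)

theorem exists_deltaE_of_mem_coboundaries (I : FormRelations k A) {p : ℕ} {P : π.cocycles p}
    (hP : P.1 ∈ π.coboundaries p) :
    ∃ Y ∈ I.contractions ((p : ℤ) - 1), I.iOp (toPolyvector P) = I.deltaE π ((p : ℤ) - 1) Y := by
  rcases p with _ | p
  · have h : toPolyvector P = 0 := Subtype.ext hP
    refine ⟨0, zero_mem _, ?_⟩
    rw [h]
    rw [show I.iOp (0 : Polyvector k A A 0) = 0 from map_zero (I.iOpLinear 0)]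
    simp [FormRelations.deltaE, FormRelations.brE]
  · obtain ⟨Q, hQ, h⟩ := hP
    obtain ⟨R, hR, h'⟩ := exists_deltaE_iOp I (π := π) ⟨Q, hQ⟩
    rw [Nat.cast_succ, add_sub_cancel_right]
    refine ⟨I.iOp ⟨Q, hQ⟩, I.iOp_mem _, ?_⟩
    rw [h']
    congr 1
    ext1
    exact AlternatingMap.coe_injective (h.trans hR.symm)

variable {i j : ℤ} {X Y : Module.End k I.TotalForm} {x y : π.HP}

include hη

theorem Represents.poissonOp_comm (hX : Represents I i X x) (w : I.TotalForm) :
    hη.poissonOp π (X w) = i.negOnePow • X (hη.poissonOp π w) := by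
  rw [hη.poissonOp_contraction π hX.mem_contractions, hX.deltaE_eq_zero, LinearMap.zero_apply,
    zero_add]

theorem Represents.poissonOp_volume (hX : Represents I i X x) :
    hη.poissonOp π (X (I.of n η)) = 0 := by
  rw [hX.poissonOp_comm hη, hη.poissonOp_volume, map_zero, smul_zero]

theorem exists_represents_of_poissonOp {X : Module.End k I.TotalForm} (hX : X ∈ I.contractions i)
    (h : hη.poissonOp π (X (I.of n η)) = 0) : ∃ x : π.HP, Represents I i X x := by
  refine exists_represents hη hX (hη.contractions_ext (FormRelations.IsVolumeForm.deltaE_mem π hX)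
    (zero_mem _) ?_)
  rw [← hη.poissonOp_contraction_volume π hX, h]
  rfl

theorem Represents.exists_mul (hX : Represents I i X x) (hY : Represents I j Y y) :
    ∃ z : π.HP, Represents I (i + j) (X * Y) z := by
  refine exists_represents_of_poissonOp hη
    (FormRelations.mul_mem_contractions hX.mem_contractions hY.mem_contractions) ?_
  rw [Module.End.mul_apply, hX.poissonOp_comm hη, hY.poissonOp_volume hη, map_zero, smul_zero]

/-- The product of Poisson cohomology corresponds to the composition of contractions. -/
theorem exists_cup : ∃ cup : π.HP →ₗ[k] π.HP →ₗ[k] π.HP,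
    ∀ {i j : ℤ} {X Y : Module.End k I.TotalForm} {x y : π.HP}, Represents I i X x →
      Represents I j Y y → Represents I (i + j) (X * Y) (cup x y) := by
  -- Left multiplication by the class represented by `X`.
  have h1 : ∀ (i : ℤ) (X : Module.End k I.TotalForm) (x : π.HP), Represents I i X x →
      ∃ G : π.HP →ₗ[k] π.HP, ∀ q (Q : π.cocycles q),
        Represents I (i + q) (X * I.iOp (toPolyvector Q)) (G (π.cls q Q)) := by
    intro i X x hX
    refine π.exists_lift_of_rel
      (fun q Q z => Represents I (i + q) (X * I.iOp (toPolyvector Q)) z)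
      (fun q Q => hX.exists_mul hη (represents_cls Q)) ?_ ?_ ?_
    · intro q Q Q' z z' hz hz'
      rw [iOp_toPolyvector_add, mul_add]
      exact hz.add hz'
    · intro q c Q z hz
      rw [iOp_toPolyvector_smul, mul_smul_comm]
      exact hz.smul c
    · intro q Q z hQ hz
      obtain ⟨Z, hZ, hQZ⟩ := exists_deltaE_of_mem_coboundaries I hQ
      refine hz.eq_of_sub_eq hη (represents_zero _) rfl
        (z := i.negOnePow • X (Z (I.of n η))) ?_
      rw [LinearMap.zero_apply, sub_zero, Module.End.mul_apply, hQZ,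
        ← hη.poissonOp_contraction_volume π hZ, map_zsmul_unit, hX.poissonOp_comm hη, smul_smul,
        Int.units_mul_self, one_smul]
  have h2 : ∃ cup : π.HP →ₗ[k] π.HP →ₗ[k] π.HP, ∀ p (P : π.cocycles p), ∀ q (Q : π.cocycles q),
      Represents I (p + q) (I.iOp (toPolyvector P) * I.iOp (toPolyvector Q))
        (cup (π.cls p P) (π.cls q Q)) := by
    refine π.exists_lift_of_rel (fun p P (G : π.HP →ₗ[k] π.HP) => ∀ q (Q : π.cocycles q),
      Represents I (p + q) (I.iOp (toPolyvector P) * I.iOp (toPolyvector Q)) (G (π.cls q Q)))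
      (fun p P => h1 p _ _ (represents_cls P)) ?_ ?_ ?_
    · intro p P P' G G' hG hG' q Q
      rw [iOp_toPolyvector_add, add_mul]
      exact (hG q Q).add (hG' q Q)
    · intro p c P G hG q Q
      rw [iOp_toPolyvector_smul, smul_mul_assoc]
      exact (hG q Q).smul c
    · intro p P G hP hG
      obtain ⟨Z, hZ, hPZ⟩ := exists_deltaE_of_mem_coboundaries I hP
      refine LinearMap.ext fun y => ?_
      induction y using hp_induction with
      | zero => rw [map_zero, map_zero]
      | add y y' hy hy' => rw [map_add, map_add, hy, hy']
      | cls q Q =>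
        refine (hG q Q).eq_of_sub_eq hη (represents_zero _) rfl
          (z := Z (I.iOp (toPolyvector Q) (I.of n η))) ?_
        rw [LinearMap.zero_apply, sub_zero, Module.End.mul_apply, hPZ,
          hη.poissonOp_contraction π hZ, (represents_cls Q).poissonOp_volume hη, map_zero,
          smul_zero, add_zero]
  obtain ⟨cup, hcup⟩ := h2
  refine ⟨cup, ?_⟩
  intro i j X Y x y hX hY
  rcases hX with ⟨p, P, rfl, rfl, rfl⟩ | ⟨rfl, rfl⟩
  · rcases hY with ⟨q, Q, rfl, rfl, rfl⟩ | ⟨rfl, rfl⟩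
    · exact hcup p P q Q
    · rw [mul_zero, map_zero]
      exact represents_zero _
  · rw [zero_mul, map_zero, LinearMap.zero_apply]
    exact represents_zero _

/-- The operator on Poisson cohomology is minus the divergence of representatives that are
invariant under the modular vector; the projection to the invariant forms chooses them. -/
theorem exists_bvOperator (hL : IsDiagonalizable (hη.modularLieOp π)) :
    ∃ Δ : π.HP →ₗ[k] π.HP, ∀ {i : ℤ} {X : Module.End k I.TotalForm} {x : π.HP},
      Represents I i X x → ∃ Z, Represents I (i - 1) Z (Δ x) ∧
        Z (I.of n η) = -I.dOp (hL.kerProjection (X (I.of n η))) := by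
  -- On invariant forms, `poissonOp` anticommutes with `d`.
  have hP : ∀ w, hη.poissonOp π (I.dOp (hL.kerProjection w)) =
      -I.dOp (hL.kerProjection (hη.poissonOp π w)) := by
    intro w
    have h := hη.modularLieOp_eq π (hL.kerProjection w)
    rw [hL.map_kerProjection, ← hL.kerProjection_comm (hη.modularLieOp_poissonOp π),
      eq_comm, neg_eq_zero] at h
    exact eq_neg_of_add_eq_zero_right h
  have h : ∃ Δ : π.HP →ₗ[k] π.HP, ∀ p (P : π.cocycles p), ∃ Z,
      Represents I ((p : ℤ) - 1) Z (Δ (π.cls p P)) ∧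
        Z (I.of n η) = -I.dOp (hL.kerProjection (I.iOp (toPolyvector P) (I.of n η))) := by
    refine π.exists_lift_of_rel (fun p P z => ∃ Z, Represents I ((p : ℤ) - 1) Z z ∧
      Z (I.of n η) = -I.dOp (hL.kerProjection (I.iOp (toPolyvector P) (I.of n η)))) ?_ ?_ ?_ ?_
    · intro p P
      obtain ⟨Y, hY, h1⟩ := hη.exists_invariant π hL (represents_cls P).mem_contractions
      obtain ⟨Z, hZ, h2⟩ := hη.exists_divergence hY
      have h3 : (-Z) (I.of n η) =
          -I.dOp (hL.kerProjection (I.iOp (toPolyvector P) (I.of n η))) := by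
        rw [LinearMap.neg_apply, h2, h1]
      obtain ⟨z, hz⟩ := exists_represents_of_poissonOp hη (neg_mem hZ) (π := π) (by
        rw [h3, map_neg, hP, (represents_cls P).poissonOp_volume hη]
        simp)
      exact ⟨z, -Z, hz, h3⟩
    · rintro p P P' z z' ⟨Z, hZ, h1⟩ ⟨Z', hZ', h2⟩
      refine ⟨Z + Z', hZ.add hZ', ?_⟩
      rw [iOp_toPolyvector_add, LinearMap.add_apply, LinearMap.add_apply, map_add, map_add, h1, h2]
      abel
    · rintro p c P z ⟨Z, hZ, h1⟩
      refine ⟨c • Z, hZ.smul c, ?_⟩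
      rw [iOp_toPolyvector_smul, LinearMap.smul_apply, LinearMap.smul_apply, map_smul, map_smul,
        h1, smul_neg]
    · rintro p P z hz ⟨Z, hZ, h1⟩
      obtain ⟨Y, hY, h2⟩ := exists_deltaE_of_mem_coboundaries I hz
      refine hZ.eq_of_sub_eq hη (represents_zero _) rfl
        (z := I.dOp (hL.kerProjection (Y (I.of n η)))) ?_
      rw [LinearMap.zero_apply, sub_zero, h1, h2, ← hη.poissonOp_contraction_volume π hY, hP]
  obtain ⟨Δ, hΔ⟩ := h
  refine ⟨Δ, ?_⟩
  intro i X x hX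
  rcases hX with ⟨p, P, rfl, rfl, rfl⟩ | ⟨rfl, rfl⟩
  · exact hΔ p P
  · exact ⟨0, by rw [map_zero]; exact represents_zero _, by simp⟩

/-- Every class has a representative that is invariant under the modular vector. -/
theorem Represents.exists_invariant (hL : IsDiagonalizable (hη.modularLieOp π))
    (hX : Represents I i X x) : ∃ X₀, Represents I i X₀ x ∧
      hη.modularLieOp π (X₀ (I.of n η)) = 0 ∧
      ∃ Y ∈ I.contractions (i - 1), X = X₀ + I.deltaE π (i - 1) Y := by
  obtain ⟨X₀, hX₀, h⟩ := hη.exists_invariant π hL hX.mem_contractions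
  have h1 : hη.poissonOp π (X₀ (I.of n η)) = 0 := by
    rw [h, ← hL.kerProjection_comm (hη.modularLieOp_poissonOp π), hX.poissonOp_volume hη, map_zero]
  obtain ⟨x₀, hx₀⟩ := exists_represents_of_poissonOp hη hX₀ h1
  obtain ⟨z, hz⟩ := hη.exists_poissonOp_eq_sub π hL (hX.poissonOp_volume hη)
  rw [← h] at hz
  obtain rfl := hX.eq_of_sub_eq hη hx₀ rfl hz
  refine ⟨X₀, hx₀, by rw [h, hL.map_kerProjection], ?_⟩
  obtain ⟨Y, hY, h2⟩ := hη.exists_deltaE_eq π (hX.sub hx₀).mem_contractions hz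
  exact ⟨Y, hY, by rw [← h2, add_sub_cancel]⟩

end Operations

end PoissonStructure

/-! ### Identities for derived brackets of operators -/

theorem negOnePow_eq_ite (i : ℤ) : i.negOnePow = if Even i then 1 else -1 := by
  split_ifs with h
  · exact Int.negOnePow_even i h
  · exact Int.negOnePow_odd i (Int.not_even_iff_odd.mp h)

section Derived

variable {k A : Type*} [Field k] [CharZero k] [CommRing A] [Algebra k A]
  {I : FormRelations k A}

namespace FormRelations

/-- On a closed form, the derived bracket is the failure of `d` to be a derivation. -/
theorem brE_apply_of_dOp_eq_zero (i j : ℤ) (X Y : Module.End k I.TotalForm) {w : I.TotalForm}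
    (hw : I.dOp w = 0) : I.brE i j X Y w =
      X (I.dOp (Y w)) - i.negOnePow • I.dOp (X (Y w)) +
        (i * j + i + j).negOnePow • Y (I.dOp (X w)) := by
  rw [brE_apply, lieE_apply, lieE_apply, hw, map_zero, zero_sub, map_neg, map_zsmul_unit]
  by_cases hi : Even i <;> by_cases hj : Even j <;>
    simp only [negOnePow_eq_ite, Int.even_add, Int.even_mul, Int.not_even_one, hi, hj,
      iff_true, iff_false, not_true, or_true, or_false, or_self,
      if_true, if_false, one_smul, Units.neg_smul] <;>
    module

/-- The second order identity for the de Rham differential, in terms of contractions of a closed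
form. -/
theorem dOp_mul_mul {i j l : ℤ} {X Y Z : Module.End k I.TotalForm} (hX : X ∈ I.contractions i)
    (hY : Y ∈ I.contractions j) (hZ : Z ∈ I.contractions l) {w : I.TotalForm}
    (hw : I.dOp w = 0) :
    I.dOp (X (Y (Z w))) =
      ((i + j - 1) * l).negOnePow • Z (I.dOp (X (Y w))) + i.negOnePow • X (I.dOp (Y (Z w)))
        + ((i - 1) * j).negOnePow • Y (I.dOp (X (Z w)))
        - ((i - 1) * (j + l)).negOnePow • Y (Z (I.dOp (X w)))
        - (i + (j - 1) * l).negOnePow • X (Z (I.dOp (Y w)))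
        - (i + j).negOnePow • X (Y (I.dOp (Z w))) := by
  -- The derived bracket of `X` and `Y` is a contraction and hence commutes with `Z`.
  have h := contractions_comm (brE_mem hX hY) hZ w
  rw [brE_apply_of_dOp_eq_zero i j X Y hw, brE_apply, lieE_apply, lieE_apply] at h
  simp only [map_add, map_sub, map_zsmul_unit, contractions_comm hY hX (I.dOp (Z w)),
    contractions_comm hZ hX (I.dOp (Y w)), contractions_comm hZ hY (I.dOp (X w))] at h
  by_cases hi : Even i <;> by_cases hj : Even j <;> by_cases hl : Even l <;>
    simp only [negOnePow_eq_ite, Int.even_add, Int.even_mul, Int.even_sub, Int.not_even_one, hi,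
      hj, hl, iff_true, iff_false, not_true, or_true, or_false, or_self,
      if_true, if_false, one_smul, Units.neg_smul] at h ⊢ <;>
    first
    | linear_combination (norm := module) (1 : ℤ) • h
    | linear_combination (norm := module) (-1 : ℤ) • h

end FormRelations

end Derived

section DerivedDelta

variable {k A : Type*} [Field k] [CharZero k] [CommRing A] [Algebra k A]
  {I : FormRelations k A} (π : PoissonStructure k A)

namespace FormRelations

theorem bivectorLieOp_dOp (w : I.TotalForm) :
    I.bivectorLieOp π (I.dOp w) = -I.dOp (I.bivectorLieOp π w) := by
  rw [IsVolumeForm.dOp_bivectorLieOp, neg_neg]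

theorem bivectorLieOp_apply_of_deltaE_eq_zero {i : ℤ} {X : Module.End k I.TotalForm}
    (hX : I.deltaE π i X = 0) (w : I.TotalForm) :
    I.bivectorLieOp π (X w) = i.negOnePow • X (I.bivectorLieOp π w) := by
  have h := IsVolumeForm.deltaE_apply π i X w
  rw [hX] at h
  exact sub_eq_zero.mp h.symm

/-- The Poisson differential is a derivation of the derived bracket; here the second argument is
closed. -/
theorem brE_deltaE_left {i j : ℤ} (X : Module.End k I.TotalForm) {Y : Module.End k I.TotalForm}
    (hY : I.deltaE π j Y = 0) :
    I.brE (i + 1) j (I.deltaE π i X) Y = I.deltaE π (i + j - 1) (I.brE i j X Y) := by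
  ext1 w
  simp only [IsVolumeForm.deltaE_apply, brE_apply, lieE_apply, map_sub, map_zsmul_unit,
    bivectorLieOp_apply_of_deltaE_eq_zero π hY, bivectorLieOp_dOp, map_neg]
  by_cases hi : Even i <;> by_cases hj : Even j <;>
    simp only [negOnePow_eq_ite, Int.even_add, Int.even_mul, Int.even_sub, Int.not_even_one, hi, hj,
      iff_true, iff_false, not_true, or_true, or_false, or_self,
      if_true, if_false, one_smul, Units.neg_smul] <;>
    module

theorem brE_deltaE_right {i j : ℤ} {X : Module.End k I.TotalForm} (Y : Module.End k I.TotalForm)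
    (hX : I.deltaE π i X = 0) :
    I.brE i (j + 1) X (I.deltaE π j Y) =
      -(i.negOnePow • I.deltaE π (i + j - 1) (I.brE i j X Y)) := by
  ext1 w
  rw [LinearMap.neg_apply, Units.smul_def, LinearMap.smul_apply, ← Units.smul_def]
  simp only [IsVolumeForm.deltaE_apply, brE_apply, lieE_apply, map_sub, map_zsmul_unit,
    bivectorLieOp_apply_of_deltaE_eq_zero π hX, bivectorLieOp_dOp, map_neg]
  by_cases hi : Even i <;> by_cases hj : Even j <;>
    simp only [negOnePow_eq_ite, Int.even_add, Int.even_mul, Int.even_sub, Int.not_even_one, hi, hj,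
      iff_true, iff_false, not_true, or_true, or_false, or_self,
      if_true, if_false, one_smul, Units.neg_smul] <;>
    module

theorem brE_add_left (i j : ℤ) (X X' Y : Module.End k I.TotalForm) :
    I.brE i j (X + X') Y = I.brE i j X Y + I.brE i j X' Y := by
  ext1 w
  simp only [brE_apply, lieE_apply, LinearMap.add_apply, map_add, map_sub, smul_add, smul_sub]
  abel

theorem brE_add_right (i j : ℤ) (X Y Y' : Module.End k I.TotalForm) :
    I.brE i j X (Y + Y') = I.brE i j X Y + I.brE i j X Y' := by
  simp only [brE, add_mul, mul_add, smul_add]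
  abel

end FormRelations

end DerivedDelta

/-! ### The Batalin–Vilkovisky structure -/

namespace PoissonStructure

section Structure

variable {k A : Type*} [Field k] [CharZero k] [CommRing A] [Algebra k A]
  {I : FormRelations k A} {π : PoissonStructure k A} {n : ℕ} {η : I.Form n}

variable (I) in
/-- The product `cup` of cohomology classes corresponds to the composition of contractions. -/
def IsComposition (cup : π.HP →ₗ[k] π.HP →ₗ[k] π.HP) : Prop :=
  ∀ {i j : ℤ} {X Y : Module.End k I.TotalForm} {x y : π.HP}, Represents I i X x →
    Represents I j Y y → Represents I (i + j) (X * Y) (cup x y)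

/-- The operator `Δ` on cohomology classes is given by minus the divergence of representatives that
are invariant under the modular vector. -/
def IsInvariantDivergence (hη : I.IsVolumeForm η) (Δ : π.HP →ₗ[k] π.HP) : Prop :=
  ∀ {i : ℤ} {X : Module.End k I.TotalForm} {x : π.HP}, Represents I i X x →
    hη.modularLieOp π (X (I.of n η)) = 0 →
    ∃ Z, Represents I (i - 1) Z (Δ x) ∧ Z (I.of n η) = -I.dOp (X (I.of n η))

theorem Represents.cast {i j : ℤ} {X : Module.End k I.TotalForm} {x : π.HP}
    (hX : Represents I i X x) (h : i = j) : Represents I j X x := h ▸ hX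

theorem Represents.exists_cocycle {i : ℤ} {X : Module.End k I.TotalForm} {x : π.HP}
    (hX : Represents I i X x) {m : ℕ} (h : i = m) :
    ∃ R : π.cocycles m, X = I.iOp (toPolyvector R) ∧ x = π.cls m R := by
  rcases hX with ⟨p, P, hp, rfl, rfl⟩ | ⟨rfl, rfl⟩
  · obtain rfl : p = m := by omega
    exact ⟨P, rfl, rfl⟩
  · exact ⟨0, (iOp_toPolyvector_zero I m).symm, (map_zero _).symm⟩

theorem Represents.eq_zero_of_neg {i : ℤ} {X : Module.End k I.TotalForm} {x : π.HP}
    (hX : Represents I i X x) (h : i < 0) : x = 0 := by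
  rcases hX with ⟨p, P, hp, rfl, rfl⟩ | ⟨rfl, rfl⟩
  · omega
  · rfl

variable (hη : I.IsVolumeForm η) {cup : π.HP →ₗ[k] π.HP →ₗ[k] π.HP} (hcup : IsComposition I cup)
  {Δ : π.HP →ₗ[k] π.HP}

include hη

/-- The composition of contractions that are invariant under the modular vector is invariant. -/
theorem modularLieOp_mul_volume {i : ℤ} {X Y : Module.End k I.TotalForm}
    (hX : X ∈ I.contractions i) (h : hη.modularLieOp π (X (I.of n η)) = 0)
    (h' : hη.modularLieOp π (Y (I.of n η)) = 0) :
    hη.modularLieOp π ((X * Y) (I.of n η)) = 0 := by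
  rw [Module.End.mul_apply, hη.modularLieOp_comm π hX h, h', map_zero]

include hcup

theorem IsComposition.isInducedProduct : π.IsInducedProduct cup := by
  intro p q P Q
  obtain ⟨R, hR, h⟩ := (hcup (represents_cls P) (represents_cls Q)).exists_cocycle
    (m := p + q) (by push_cast; rfl)
  refine ⟨R, iOp_injective hη ?_, h⟩
  rw [← hR]
  ext1 x
  exact (I.iOp_wedge rfl _ _ x).symm

theorem IsComposition.isGradedCommAlgebra : IsGradedCommAlgebra π.grading cup where
  internal := π.isInternal_grading
  mul_mem := by
    intro i j a b ha hb
    obtain ⟨X, hX⟩ := exists_represents_of_mem_grading (I := I) ha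
    obtain ⟨Y, hY⟩ := exists_represents_of_mem_grading (I := I) hb
    exact (hcup hX hY).mem_grading
  mul_assoc := by
    intro a b c
    induction a using hp_induction with
    | zero => simp
    | add a a' ha ha' => simp only [map_add, LinearMap.add_apply, ha, ha']
    | cls p P =>
      induction b using hp_induction with
      | zero => simp
      | add b b' hb hb' => simp only [map_add, LinearMap.add_apply, hb, hb']
      | cls q Q =>
        induction c using hp_induction with
        | zero => simp
        | add c c' hc hc' => simp only [map_add, hc, hc']
        | cls r R =>
          have hP := represents_cls (I := I) P
          have hQ := represents_cls (I := I) Q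
          have hR := represents_cls (I := I) R
          exact (hcup (hcup hP hQ) hR).eq hη (hcup hP (hcup hQ hR)) (add_assoc _ _ _) rfl
  exists_one := by
    have h1 : (1 : Module.End k I.TotalForm) ∈ I.contractions (0 : ℕ) := by
      let P : Polyvector k A A 0 := ⟨AlternatingMap.constOfIsEmpty k A (Fin 0) 1,
        fun _ i => i.elim0⟩
      have hP : I.iOp P = 1 := by
        rw [FormRelations.iOp_zero_deg]
        ext1 x
        exact one_smul A x
      exact hP ▸ I.iOp_mem P
    obtain ⟨e, he⟩ := exists_represents_of_poissonOp hη (π := π) h1 (hη.poissonOp_volume π)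
    refine ⟨e, he.mem_grading, fun a => ?_⟩
    induction a using hp_induction with
    | zero => simp
    | add a a' ha ha' =>
      simp only [map_add, LinearMap.add_apply, ha.1, ha.2, ha'.1, ha'.2, and_self]
    | cls p P =>
      have hP := represents_cls (I := I) P
      exact ⟨(hcup he hP).eq hη hP (by simp) rfl, (hcup hP he).eq hη hP (by simp) rfl⟩
  mul_comm := by
    intro i j a b ha hb
    obtain ⟨X, hX⟩ := exists_represents_of_mem_grading (I := I) ha
    obtain ⟨Y, hY⟩ := exists_represents_of_mem_grading (I := I) hb
    refine (hcup hX hY).eq hη ((hcup hY hX).units_smul _) (add_comm i j) ?_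
    exact FormRelations.contractions_comm hX.mem_contractions hY.mem_contractions _

variable (hL : IsDiagonalizable (hη.modularLieOp π)) (hΔ : IsInvariantDivergence hη Δ)

include hL hΔ

theorem IsComposition.isBVAlgebra : IsBVAlgebra π.grading cup Δ where
  toIsGradedCommAlgebra := hcup.isGradedCommAlgebra hη
  map_mem := by
    intro i a ha
    obtain ⟨X', hX'⟩ := exists_represents_of_mem_grading (I := I) ha
    obtain ⟨X, hX, hXL, -⟩ := hX'.exists_invariant hη hL
    obtain ⟨Z, hZ, -⟩ := hΔ hX hXL
    exact hZ.mem_grading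
  sq_zero := by
    intro a
    induction a using hp_induction with
    | zero => simp
    | add a a' ha ha' => simp only [map_add, ha, ha', add_zero]
    | cls p P =>
      obtain ⟨X, hX, hXL, -⟩ := (represents_cls (I := I) P).exists_invariant hη hL
      obtain ⟨Z, hZ, hZX⟩ := hΔ hX hXL
      have hZL : hη.modularLieOp π (Z (I.of n η)) = 0 := by
        rw [hZX, map_neg, hη.modularLieOp_dOp, hXL, map_zero, neg_zero]
      obtain ⟨W, hW, hWZ⟩ := hΔ hZ hZL
      refine hW.eq hη (represents_zero _) rfl ?_
      rw [hWZ, hZX, map_neg, I.dOp_dOp, neg_zero, neg_zero, LinearMap.zero_apply]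
  second_order := by
    intro i j l a b c ha hb hc
    obtain ⟨X', hX'⟩ := exists_represents_of_mem_grading (I := I) ha
    obtain ⟨Y', hY'⟩ := exists_represents_of_mem_grading (I := I) hb
    obtain ⟨Z', hZ'⟩ := exists_represents_of_mem_grading (I := I) hc
    obtain ⟨X, hX, hXL, -⟩ := hX'.exists_invariant hη hL
    obtain ⟨Y, hY, hYL, -⟩ := hY'.exists_invariant hη hL
    obtain ⟨Z, hZ, hZL, -⟩ := hZ'.exists_invariant hη hL
    have mX := hX.mem_contractions
    have mY := hY.mem_contractions
    have mZ := hZ.mem_contractions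
    have hXY := modularLieOp_mul_volume hη mX hXL hYL
    have hXZ := modularLieOp_mul_volume hη mX hXL hZL
    have hYZ := modularLieOp_mul_volume hη mY hYL hZL
    have hXYZ := modularLieOp_mul_volume hη mX hXL hYZ
    rw [← mul_assoc] at hXYZ
    obtain ⟨U, hU, hU'⟩ := hΔ (hcup (hcup hX hY) hZ) hXYZ
    obtain ⟨Uxy, hUxy, hUxy'⟩ := hΔ (hcup hX hY) hXY
    obtain ⟨Uyz, hUyz, hUyz'⟩ := hΔ (hcup hY hZ) hYZ
    obtain ⟨Uxz, hUxz, hUxz'⟩ := hΔ (hcup hX hZ) hXZ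
    obtain ⟨Ux, hUx, hUx'⟩ := hΔ hX hXL
    obtain ⟨Uy, hUy, hUy'⟩ := hΔ hY hYL
    obtain ⟨Uz, hUz, hUz'⟩ := hΔ hZ hZL
    have e1 := hcup hUxy hZ
    have e2 := ((hcup hX hUyz).units_smul i.negOnePow).cast (j := i + j - 1 + l) (by ring)
    have e3 := ((hcup hY hUxz).units_smul ((i - 1) * j).negOnePow).cast (j := i + j - 1 + l)
      (by ring)
    have e4 := (hcup (hcup hUx hY) hZ).cast (j := i + j - 1 + l) (by ring)
    have e5 := ((hcup (hcup hX hUy) hZ).units_smul i.negOnePow).cast (j := i + j - 1 + l) (by ring)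
    have e6 := ((hcup (hcup hX hY) hUz).units_smul (i + j).negOnePow).cast (j := i + j - 1 + l)
      (by ring)
    refine hU.eq hη (((((e1.add e2).add e3).sub e4).sub e5).sub e6) (by ring) ?_
    have c1 := FormRelations.contractions_comm hUxy.mem_contractions mZ (I.of n η)
    have c4 := FormRelations.contractions_comm hUx.mem_contractions
      (FormRelations.mul_mem_contractions mY mZ) (I.of n η)
    have c5 := FormRelations.contractions_comm hUy.mem_contractions mZ (I.of n η)
    simp only [Module.End.mul_apply] at hU' hUxy' hUyz' hUxz' c4
    simp only [LinearMap.add_apply, LinearMap.sub_apply, Units.smul_def, LinearMap.smul_apply,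
      Module.End.mul_apply]
    simp only [← Units.smul_def]
    rw [hU', c1, c4, c5, hUxy', hUyz', hUxz', hUx', hUy', hUz',
      FormRelations.dOp_mul_mul mX mY mZ hη.dOp_volume, Int.negOnePow_add i ((j - 1) * l), mul_smul]
    simp only [map_neg, smul_neg, map_zsmul_unit]
    abel

variable {br : π.HP →ₗ[k] π.HP →ₗ[k] π.HP} (hbr : Generates π.grading cup Δ br)

include hbr

/-- The bracket that is generated by `Δ` corresponds to the derived bracket of contractions. -/
theorem represents_br {i j : ℤ} {X Y : Module.End k I.TotalForm} {x y : π.HP}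
    (hX : Represents I i X x) (hY : Represents I j Y y) :
    Represents I (i + j - 1) (I.brE i j X Y) (br x y) := by
  obtain ⟨X₀, hX₀, hXL, Z, hZ, hXZ⟩ := hX.exists_invariant hη hL
  obtain ⟨Y₀, hY₀, hYL, Z', hZ', hYZ⟩ := hY.exists_invariant hη hL
  obtain ⟨U, hU, hU'⟩ := hΔ (hcup hX₀ hY₀)
    (modularLieOp_mul_volume hη hX₀.mem_contractions hXL hYL)
  obtain ⟨Ux, hUx, hUx'⟩ := hΔ hX₀ hXL
  obtain ⟨Uy, hUy, hUy'⟩ := hΔ hY₀ hYL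
  have e := ((hU.sub ((hcup hUx hY₀).cast (by ring))).sub
    (((hcup hX₀ hUy).units_smul i.negOnePow).cast (by ring))).units_smul i.negOnePow
  rw [← hbr hX.mem_grading hY.mem_grading] at e
  -- On invariant representatives, the derived bracket is given by `Δ`.
  have h0 : I.brE i j X₀ Y₀ (I.of n η) =
      (i.negOnePow • (U - Ux * Y₀ - i.negOnePow • (X₀ * Uy))) (I.of n η) := by
    have c1 := FormRelations.contractions_comm hUx.mem_contractions hY₀.mem_contractions (I.of n η)
    rw [Module.End.mul_apply] at hU'
    simp only [LinearMap.sub_apply, Units.smul_def, LinearMap.smul_apply, Module.End.mul_apply]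
    simp only [← Units.smul_def]
    rw [FormRelations.brE_apply_of_dOp_eq_zero i j X₀ Y₀ hη.dOp_volume, hU', c1, hUx', hUy']
    simp only [map_neg]
    by_cases hi : Even i <;> by_cases hj : Even j <;>
      simp only [negOnePow_eq_ite, Int.even_add, Int.even_mul, Int.even_sub, Int.not_even_one, hi,
        hj, iff_true, iff_false, not_true, or_true, or_false, or_self,
        if_true, if_false, one_smul, Units.neg_smul] <;>
      module
  -- In general, the derived bracket differs from that by a coboundary.
  have h1 : I.brE i j X Y = I.brE i j X₀ Y₀ + -(i.negOnePow •
      I.deltaE π (i + (j - 1) - 1) (I.brE i (j - 1) X₀ Z')) +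
      I.deltaE π (i - 1 + j - 1) (I.brE (i - 1) j Z Y) := by
    rw [← FormRelations.brE_deltaE_right π Z' hX₀.deltaE_eq_zero,
      ← FormRelations.brE_deltaE_left π Z hY.deltaE_eq_zero, sub_add_cancel, sub_add_cancel,
      ← FormRelations.brE_add_right, ← hYZ, ← FormRelations.brE_add_left, ← hXZ]
  have hXZ' := FormRelations.brE_mem hX₀.mem_contractions hZ'
  have hZY := FormRelations.brE_mem hZ hY.mem_contractions
  have h2 : I.brE i j X Y (I.of n η) -
      (i.negOnePow • (U - Ux * Y₀ - i.negOnePow • (X₀ * Uy))) (I.of n η) =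
      hη.poissonOp π (-(i.negOnePow • I.brE i (j - 1) X₀ Z' (I.of n η)) +
        I.brE (i - 1) j Z Y (I.of n η)) := by
    rw [map_add, map_neg, map_zsmul_unit, hη.poissonOp_contraction_volume π hXZ',
      hη.poissonOp_contraction_volume π hZY, h1, ← h0, LinearMap.add_apply, LinearMap.add_apply,
      LinearMap.neg_apply]
    simp only [Units.smul_def, LinearMap.smul_apply]
    abel
  obtain ⟨z, hz⟩ := exists_represents_of_poissonOp hη (π := π)
    (FormRelations.brE_mem hX.mem_contractions hY.mem_contractions) (by
      rw [sub_eq_iff_eq_add.mp h2, map_add, hη.poissonOp_sq, e.poissonOp_volume hη, add_zero])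
  rwa [hz.eq_of_sub_eq hη e rfl h2] at hz

theorem isInducedBracket_of_generates : π.IsInducedBracket br := by
  refine ⟨fun p q m h P Q => ?_, fun P Q => ?_⟩
  · obtain ⟨R, hR, h'⟩ := (represents_br hη hcup hL hΔ hbr (represents_cls P)
      (represents_cls Q)).exists_cocycle (m := m) (by omega)
    refine ⟨R, ?_, h'⟩
    rw [FormRelations.brE_iOp_eq_schouten h] at hR
    exact congrArg Subtype.val (iOp_injective hη hR).symm
  · exact (represents_br hη hcup hL hΔ hbr (represents_cls P) (represents_cls Q)).eq_zero_of_neg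
      (by simp)

end Structure

section Generated

variable {k A : Type*} [Field k] [CommRing A] [Algebra k A] {π : PoissonStructure k A}

/-- The bracket generated by `Δ`, extended linearly from homogeneous classes. -/
theorem exists_generates (cup : π.HP →ₗ[k] π.HP →ₗ[k] π.HP) (Δ : π.HP →ₗ[k] π.HP) :
    ∃ br : π.HP →ₗ[k] π.HP →ₗ[k] π.HP, Generates π.grading cup Δ br := by
  -- The sign `(-1)^|a|`, as a linear operator.
  obtain ⟨s, hs⟩ := π.exists_lift (fun p => ((p : ℤ).negOnePow : ℤ) • π.cls p) (by
    intro p P hP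
    rw [LinearMap.smul_apply, π.cls_eq_zero hP, smul_zero])
  have hs' : ∀ (i : ℤ) (a : π.HP), a ∈ π.grading i → s a = i.negOnePow • a := by
    rintro (p | p) a ha
    · obtain ⟨P, rfl⟩ := ha
      exact hs p P
    · obtain rfl : a = 0 := ha
      rw [map_zero, smul_zero]
  refine ⟨(cup.compr₂ Δ) ∘ₗ s - cup ∘ₗ Δ ∘ₗ s - cup.compl₂ Δ, fun {i j a b} ha _ => ?_⟩
  simp only [LinearMap.sub_apply, LinearMap.comp_apply, LinearMap.compr₂_apply,
    LinearMap.compl₂_apply, hs' i a ha]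
  rcases Int.even_or_odd i with hi | hi
  · simp [Int.negOnePow_even i hi]
  · simp [Int.negOnePow_odd i hi]
    abel

end Generated

end PoissonStructure

end PoissonBV

end

theorem mainTheorem2 {k A : Type*} [Field k] [CharZero k] [CommRing A] [Algebra k A]
    (π : PoissonBV.PoissonStructure k A) (I : PoissonBV.FormRelations k A)
    {n : ℕ} (η : I.Form n) (hη : I.IsVolumeForm η)
    (hν : PoissonBV.IsDiagonalizable (PoissonBV.Polyvector.toEnd (hη.modularVector π))) :
    ∃ cup br : π.HP →ₗ[k] π.HP →ₗ[k] π.HP,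
      π.IsInducedProduct cup ∧ π.IsInducedBracket br ∧
      ∃ Δ : π.HP →ₗ[k] π.HP,
        PoissonBV.IsBVAlgebra π.grading cup Δ ∧ PoissonBV.Generates π.grading cup Δ br := by
  have hL := hη.isDiagonalizable_modularLieOp π hν
  obtain ⟨cup, hcup⟩ := PoissonBV.PoissonStructure.exists_cup hη (π := π)
  obtain ⟨Δ, hΔ'⟩ := PoissonBV.PoissonStructure.exists_bvOperator hη hL
  have hΔ : PoissonBV.PoissonStructure.IsInvariantDivergence hη Δ := by
    intro i X x hX hXL
    obtain ⟨Z, hZ, h⟩ := hΔ' hX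
    exact ⟨Z, hZ, by rw [h, hL.kerProjection_of_map_eq_zero hXL]⟩
  obtain ⟨br, hbr⟩ := PoissonBV.PoissonStructure.exists_generates cup Δ
  exact ⟨cup, br, PoissonBV.PoissonStructure.IsComposition.isInducedProduct hη hcup,
    PoissonBV.PoissonStructure.isInducedBracket_of_generates hη hcup hL hΔ hbr, Δ,
    PoissonBV.PoissonStructure.IsComposition.isBVAlgebra hη hcup hL hΔ, hbr⟩
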